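/- Let $A,B$ be real numbers with $-1<A<0$, $-1<B<0$, $-2<A+B<-1$, and put $$\zeta_\pm=\frac{B^2-A^2\pm 4i\sqrt{(A+1)(B+1)(-A-B-1)}}{(A+B+2)^2}.$$ Let $\Gamma$ be the set of all $z\in\mathbb C$ such that $$\operatorname{Re}\int_{\zeta_-}^z\frac{((t-\zeta_+)(t-\zeta_-))^{1/2}}{t^2-1}\,dt=0$$ for some path of integration from $\zeta_-$ to $z$ (a $C^1$ path $[0,1]\to\mathbb C\setminus\{\pm1\}$ that meets $\zeta_\pm$ at most at its two ends) and some continuous branch of the square root along it. Then membership in $\Gamma$ does not depend on the choices: for every such path to $z$ and every such branch, $z\in\Gamma$ if and only if the real part of the integral is $0$. Moreover, $\Gamma=\Gamma_L\cup\Gamma_C\cup\Gamma_R$, where $\Gamma_L,\Gamma_C,\Gamma_R$ are simple analytic arcs (images of $[0,1]$ under injective maps that are real analytic on a neighbourhood of $[0,1]$ and have non-vanishing derivative), each with end points $\zeta_-$ and $\zeta_+$, any two of them having only $\zeta_\pm$ in common. Each arc meets the real line in exactly one point: $\Gamma_L$ in a point of $(-\infty,-1)$, $\Gamma_C$ in a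 point of $(-1,1)$, $\Gamma_R$ in a point of $(1,\infty)$. Finally, $\Gamma_L\setminus\{\zeta_\pm\}$, $\Gamma_C\setminus\{\zeta_\pm\}$, $\Gamma_R\setminus\{\zeta_\pm\}$ are exactly the critical trajectories of the quadratic differential $Q(z)\,dz^2=-\frac{(z-\zeta_-)(z-\zeta_+)}{(z^2-1)^2}\,dz^2$. Here a horizontal curve is a $C^1$ curve $\gamma:(0,1)\to\mathbb C\setminus\{\pm1\}$ with $Q(\gamma(t))\gamma'(t)^2>0$ for all $t$; a trajectory is the image of a horizontal curve that is maximal (with respect to inclusion) among such images; and a trajectory is critical if it is the image of some horizontal curve $\gamma$ with $\lim_{t\to0^+}\gamma(t)\in\{\zeta_+,\zeta_-\}$. -/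

import Mathlib

open Set Filter Topology

noncomputable section

namespace JacobiTrajectories

/-- The point `ζ₊` in the upper half-plane. -/
def zetaPlus (A B : ℝ) : ℂ :=
  ((B : ℂ) ^ 2 - (A : ℂ) ^ 2
      + 4 * Complex.I * (Real.sqrt ((A + 1) * (B + 1) * (-A - B - 1)) : ℂ))
    / ((A : ℂ) + (B : ℂ) + 2) ^ 2

/-- The point `ζ₋` in the lower half-plane. -/
def zetaMinus (A B : ℝ) : ℂ :=
  ((B : ℂ) ^ 2 - (A : ℂ) ^ 2
      - 4 * Complex.I * (Real.sqrt ((A + 1) * (B + 1) * (-A - B - 1)) : ℂ))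
    / ((A : ℂ) + (B : ℂ) + 2) ^ 2

/-- `γ : [0, 1] → ℂ` is a path of integration from `ζ₋` to `z`, and `s` is a continuous choice of
the square root `((t - ζ₊) (t - ζ₋)) ^ (1/2)` along it.  The path is `C¹` (its speed may vanish, so
that piecewise `C¹` paths are covered after reparametrization), it avoids the poles `±1` of the
integrand, and it meets the branch points `ζ₊`, `ζ₋` at most at its two ends. -/
structure IsPathWithBranch (A B : ℝ) (z : ℂ) (γ s : ℝ → ℂ) : Prop where
  contDiffOn : ContDiffOn ℝ 1 γ (Icc 0 1)
  source : γ 0 = zetaMinus A B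
  target : γ 1 = z
  avoids_poles : ∀ t ∈ Icc (0 : ℝ) 1, γ t ≠ 1 ∧ γ t ≠ -1
  avoids_branchPoints : ∀ t ∈ Ioo (0 : ℝ) 1, γ t ≠ zetaPlus A B ∧ γ t ≠ zetaMinus A B
  branch_continuousOn : ContinuousOn s (Icc 0 1)
  branch_sq : ∀ t ∈ Icc (0 : ℝ) 1, s t ^ 2 = (γ t - zetaPlus A B) * (γ t - zetaMinus A B)

/-- The integral of `((t - ζ₊) (t - ζ₋)) ^ (1/2) / (t ^ 2 - 1) dt` along the path `γ`, with the
square root given by `s`. -/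
def pathIntegral (γ s : ℝ → ℂ) : ℂ :=
  ∫ t in (0 : ℝ)..1, s t / (γ t ^ 2 - 1) * deriv γ t

/-- The set `Γ` of the points `z` such that the integral from `ζ₋` to `z` has real part zero, for
some path and some branch of the square root.  (That the choice of the path and of the branch does
not matter is a theorem, not part of the definition.) -/
def Gamma (A B : ℝ) : Set ℂ :=
  {z | ∃ γ s : ℝ → ℂ, IsPathWithBranch A B z γ s ∧ (pathIntegral γ s).re = 0}

/-- The coefficient of the quadratic differential
`- (z - ζ₋) (z - ζ₊) / (z ^ 2 - 1) ^ 2 dz ^ 2`. -/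
def quadDiff (A B : ℝ) (z : ℂ) : ℂ :=
  -((z - zetaMinus A B) * (z - zetaPlus A B)) / (z ^ 2 - 1) ^ 2

/-- A horizontal curve of the quadratic differential `Q dz ^ 2`: a `C¹` curve on `(0, 1)` that
avoids the poles, along which `Q (γ t) γ' t ^ 2` is real and positive (in particular the curve is
regular and avoids the zeros `ζ₊`, `ζ₋`). -/
structure IsHorizontal (A B : ℝ) (γ : ℝ → ℂ) : Prop where
  contDiffOn : ContDiffOn ℝ 1 γ (Ioo 0 1)
  avoids_poles : ∀ t ∈ Ioo (0 : ℝ) 1, γ t ≠ 1 ∧ γ t ≠ -1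
  re_pos : ∀ t ∈ Ioo (0 : ℝ) 1, 0 < (quadDiff A B (γ t) * deriv γ t ^ 2).re
  im_zero : ∀ t ∈ Ioo (0 : ℝ) 1, (quadDiff A B (γ t) * deriv γ t ^ 2).im = 0

/-- A trajectory: the image of a horizontal curve that is maximal among such images. -/
def IsTrajectory (A B : ℝ) (T : Set ℂ) : Prop :=
  (∃ γ : ℝ → ℂ, IsHorizontal A B γ ∧ γ '' Ioo 0 1 = T) ∧
    ∀ γ : ℝ → ℂ, IsHorizontal A B γ → T ⊆ γ '' Ioo 0 1 → γ '' Ioo 0 1 = T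

/-- A critical trajectory: a trajectory one of whose ends is a finite critical point, i.e. a
zero `ζ₊` or `ζ₋` (all poles, at `±1` and `∞`, are double). -/
def IsCriticalTrajectory (A B : ℝ) (T : Set ℂ) : Prop :=
  IsTrajectory A B T ∧
    ∃ γ : ℝ → ℂ, IsHorizontal A B γ ∧ γ '' Ioo 0 1 = T ∧
      (Tendsto γ (𝓝[>] 0) (𝓝 (zetaPlus A B)) ∨ Tendsto γ (𝓝[>] 0) (𝓝 (zetaMinus A B)))

/-- `C` is a (closed, simple, regular) analytic arc with end points `a` and `b`: the image of
`[0, 1]` under an injective map that is real analytic on a neighbourhood of `[0, 1]` and has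
non-vanishing derivative. -/
def IsAnalyticArc (C : Set ℂ) (a b : ℂ) : Prop :=
  ∃ γ : ℝ → ℂ, AnalyticOnNhd ℝ γ (Icc 0 1) ∧ InjOn γ (Icc 0 1) ∧
    (∀ t ∈ Icc (0 : ℝ) 1, deriv γ t ≠ 0) ∧ γ 0 = a ∧ γ 1 = b ∧ γ '' Icc 0 1 = C

/-- The real line as a subset of `ℂ`. -/
def realLine : Set ℂ := {z | z.im = 0}

end JacobiTrajectories

end

noncomputable section

namespace JacobiTrajectories

/-! On the Riemann surface of the square root, a sphere, use the coordinate y = s/(z - ζ₋), where s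
is the chosen root. Then y² = Y = (z - ζ₊)/(z - ζ₋), and changing sheets is y ↦ -y. Up to the factor
a + b, where a = A + 1 and b = B + 1, the real part of the integral from ζ₋ is a sum U of
logarithms, U = Re F. As it is odd in y, its vanishing does not depend on the sheet, and as it is
single-valued, neither does it depend on the path (`re_pathIntegral`). So Γ is the zero set of U.

The points 1, -1, ∞ are real and ζ± are conjugate, so all poles lie on |y| = 1, at ±1/n_k with
weights l_k. The differential dF has double zeros over the branch points, which forces Σ l_k n_k =
0: the l_k are the sides of a closed triangle and the n_k its directions. The conditions on A and B
are the strict triangle inequalities.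

The heart is that J = F/(yF') has positive real part in the unit disc (`J_re_pos_of_norm_lt`). On
the circle yF' is imaginary and Im F is locally constant; the triangle inequalities give the sign of
Re J there, and the maximum principle carries it inside. Hence arg F strictly increases along each
circle |y| = r. As F has a triple zero at 0, it increases by 3π when Y turns once, so Re F vanishes
for exactly three values of arg Y. This gives three analytic radial graphs in the disc, regular in Y
even at the centre.

Reflection in the unit circle preserves U and gives the outer halves. On the circle itself,
alternating infinite limits of U at successive poles produce three zeros; each is simple in the
angular direction, again because Re J > 0, and so joins an inner curve analytically to its mirror
image (`exists_continues`). Ordering and counting by threes match the zeros with the three curves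
(`exists_arcAngles`).

Returning to z by a Möbius map gives the arcs. The ratio of the distances to ζ± determines the
parameter, hence simplicity, disjointness and the single real point. Horizontal curves are level
curves of U², and U² tends to 0 at ζ±, so connectedness identifies the critical trajectories with
the open arcs (`isCriticalTrajectory_iff`). -/

/-- Side lengths `l` and unit side directions `n` of a closed triangle. -/
structure ClosedTriangle where
  l : Fin 3 → ℝ
  n : Fin 3 → ℂ
  κ : ℝ
  l_pos : ∀ k, 0 < l k
  norm_n : ∀ k, ‖n k‖ = 1
  sum_zero : ∑ k, (l k : ℂ) * n k = 0
  lt_zero : l 0 < l 1 + l 2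
  lt_one : l 1 < l 0 + l 2
  lt_two : l 2 < l 0 + l 1
  κ_pos : 0 < κ
  sum_cube : 2 * ∑ k, (l k : ℂ) * n k ^ 3 = κ * (n 0 * n 1 * n 2)

/-! ### The logarithmic potential of a closed triangle and its derivative -/

namespace ClosedTriangle

variable (T : ClosedTriangle)

/-- The holomorphic potential of the differential with simple poles at the points `± 1 / n k`. -/
def F (y : ℂ) : ℂ := ∑ k, (T.l k : ℂ) * (Complex.log (1 + T.n k * y) - Complex.log (1 - T.n k * y))

/-- The real part of the potential `F`. -/
def U (y : ℂ) : ℝ := ∑ k, T.l k * (Real.log ‖1 + T.n k * y‖ - Real.log ‖1 - T.n k * y‖)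

/-- The polynomial with zeros at the squares of the poles. -/
def P (Y : ℂ) : ℂ := ∏ k, (1 - T.n k ^ 2 * Y)

/-- The leading coefficient of the derivative of the potential. -/
def C : ℂ := T.κ * (T.n 0 * T.n 1 * T.n 2)

lemma n_ne_zero (k : Fin 3) : T.n k ≠ 0 := by
  intro h; have := T.norm_n k; simp [h] at this

lemma C_ne_zero : T.C ≠ 0 := by
  have := T.κ_pos.ne'
  simp [C, n_ne_zero, this]

lemma F_re (y : ℂ) : (T.F y).re = T.U y := by
  simp [F, U, Complex.log_re]

lemma conj_n (k : Fin 3) : (starRingEnd ℂ) (T.n k) * T.n k = 1 := by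
  rw [mul_comm, Complex.mul_conj, Complex.normSq_eq_norm_sq, T.norm_n]; simp

lemma conj_eq_inv (k : Fin 3) : (starRingEnd ℂ) (T.n k) = (T.n k)⁻¹ :=
  eq_inv_of_mul_eq_one_left (T.conj_n k)

lemma sum_inv : ∑ k, (T.l k : ℂ) * (T.n k)⁻¹ = 0 := by
  have := congrArg (starRingEnd ℂ) T.sum_zero
  simpa [map_sum, T.conj_eq_inv] using this

/-- Over the common denominator the numerator is quadratic in Y. Its constant term vanishes by
`sum_zero`, its Y² term by the conjugate relation `sum_inv`, and its linear coefficient is `C` by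
`sum_cube`. Thus the derivative of `F` has a double zero at 0. -/
lemma partial_fractions (Y : ℂ) (h : ∀ k, 1 - T.n k ^ 2 * Y ≠ 0) :
    ∑ k, 2 * (T.l k : ℂ) * T.n k / (1 - T.n k ^ 2 * Y) = T.C * Y / T.P Y := by
  have h0 := h 0
  have h1 := h 1
  have h2 := h 2
  have hs := T.sum_zero
  have hi := T.sum_inv
  have hc := T.sum_cube
  have n0 := T.n_ne_zero 0
  have n1 := T.n_ne_zero 1
  have n2 := T.n_ne_zero 2
  simp only [Fin.sum_univ_three, Fin.prod_univ_three, C, P] at *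
  rw [← hc]
  have hi' : (T.l 0 : ℂ) * (T.n 1 * T.n 2) + T.l 1 * (T.n 0 * T.n 2) + T.l 2 * (T.n 0 * T.n 1)
      = 0 := by
    field_simp at hi
    linear_combination hi
  rw [div_add_div _ _ h0 h1, div_add_div _ _ (mul_ne_zero h0 h1) h2,
    div_eq_div_iff (mul_ne_zero (mul_ne_zero h0 h1) h2) (mul_ne_zero (mul_ne_zero h0 h1) h2)]
  congr 1
  linear_combination (2 - 2 * Y * (T.n 0 ^ 2 + T.n 1 ^ 2 + T.n 2 ^ 2)) * hs
    + 2 * Y ^ 2 * T.n 0 * T.n 1 * T.n 2 * hi'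

/-- The points at which all logarithms in `F` are regular. -/
def Regular (y : ℂ) : Prop := ∀ k, 1 + T.n k * y ∈ Complex.slitPlane ∧
  1 - T.n k * y ∈ Complex.slitPlane

lemma Regular.ne {y : ℂ} {T : ClosedTriangle} (h : T.Regular y) (k : Fin 3) :
    1 - T.n k ^ 2 * y ^ 2 ≠ 0 := by
  have h1 := Complex.slitPlane_ne_zero (h k).1
  have h2 := Complex.slitPlane_ne_zero (h k).2
  have := mul_ne_zero h1 h2
  intro h; apply this; linear_combination h

lemma P_eq (y : ℂ) : T.P (y ^ 2) = ∏ k, ((1 + T.n k * y) * (1 - T.n k * y)) := by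
  unfold P
  exact Finset.prod_congr rfl fun k _ => by ring

lemma Regular.P_ne {y : ℂ} {T : ClosedTriangle} (h : T.Regular y) : T.P (y ^ 2) ≠ 0 :=
  Finset.prod_ne_zero_iff.2 fun k _ => h.ne k

lemma isOpen_regular : IsOpen {y | T.Regular y} := by
  have : {y | T.Regular y} = ⋂ k, {y | 1 + T.n k * y ∈ Complex.slitPlane ∧
    1 - T.n k * y ∈ Complex.slitPlane} := by ext; simp [Regular]
  rw [this]
  refine isOpen_iInter_of_finite fun k => IsOpen.inter ?_ ?_
  · exact Complex.isOpen_slitPlane.preimage (by fun_prop)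
  · exact Complex.isOpen_slitPlane.preimage (by fun_prop)

lemma hasDerivAt_F {y : ℂ} (h : T.Regular y) :
    HasDerivAt T.F (T.C * y ^ 2 / T.P (y ^ 2)) y := by
  rw [← T.partial_fractions _ h.ne]
  unfold F
  refine HasDerivAt.fun_sum fun k _ => ?_
  have e1 : HasDerivAt (fun y => 1 + T.n k * y) (T.n k) y := by
    simpa using ((hasDerivAt_id y).const_mul (T.n k)).const_add 1
  have e2 : HasDerivAt (fun y => 1 - T.n k * y) (-T.n k) y := by
    simpa using ((hasDerivAt_id y).const_mul (T.n k)).const_sub 1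
  have := ((e1.clog (h k).1).sub (e2.clog (h k).2)).const_mul (T.l k : ℂ)
  convert! this using 1
  have h1 := Complex.slitPlane_ne_zero (h k).1
  have h2 := Complex.slitPlane_ne_zero (h k).2
  have h3 := h.ne k
  rw [div_sub_div _ _ h1 h2, ← mul_div_assoc]
  congr 1
  · ring
  · ring

lemma F_neg (y : ℂ) : T.F (-y) = -T.F y := by
  simp only [F, ← Finset.sum_neg_distrib]
  refine Finset.sum_congr rfl fun k _ => ?_
  rw [mul_neg, sub_neg_eq_add, ← sub_eq_add_neg]; ring

lemma F_zero : T.F 0 = 0 := by simp [F]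

lemma re_of_norm_le {u : ℂ} (hu : ‖u‖ ≤ 1) : 0 ≤ (1 + u).re ∧ 0 ≤ (1 - u).re := by
  have := abs_le.1 ((Complex.abs_re_le_norm u).trans hu)
  constructor <;> simp <;> linarith

lemma mem_slitPlane_of_re {u : ℂ} (hu : 0 ≤ u.re) (h : u ≠ 0) : u ∈ Complex.slitPlane := by
  rw [Complex.mem_slitPlane_iff]
  by_contra! hc
  exact h (Complex.ext (le_antisymm hc.1 hu) hc.2)

lemma regular_of_norm_lt {y : ℂ} (hy : ‖y‖ < 1) : T.Regular y := by
  intro k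
  have : ‖T.n k * y‖ < 1 := by rw [norm_mul, T.norm_n, one_mul]; exact hy
  have h := re_of_norm_le this.le
  refine ⟨mem_slitPlane_of_re h.1 fun h0 => ?_, mem_slitPlane_of_re h.2 fun h0 => ?_⟩
  · rw [eq_neg_of_add_eq_zero_right h0] at this; simp at this
  · rw [← sub_eq_zero.1 h0] at this; simp at this

/-- In the closed disc 1 ± n_k y lie in the closed right half-plane, where the principal logarithm
fails to be regular only at 0. No other branch is ever needed. -/
lemma regular_of_norm_le {y : ℂ} (hy : ‖y‖ ≤ 1) (h : T.P (y ^ 2) ≠ 0) : T.Regular y := by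
  intro k
  rw [P_eq, Finset.prod_ne_zero_iff] at h
  have hk := h k (Finset.mem_univ k)
  have : ‖T.n k * y‖ ≤ 1 := by rw [norm_mul, T.norm_n, one_mul]; exact hy
  have h' := re_of_norm_le this
  exact ⟨mem_slitPlane_of_re h'.1 (left_ne_zero_of_mul hk),
    mem_slitPlane_of_re h'.2 (right_ne_zero_of_mul hk)⟩

/-! ### The quotient `J` on the closed unit disc -/

lemma continuousWithinAt_mul_log (u : ℂ) (hu : 0 ≤ u.re) :
    ContinuousWithinAt (fun u : ℂ => u * Complex.log u) {u | 0 ≤ u.re} u := by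
  by_cases h : u = 0
  · subst h
    have h1 : Tendsto (fun u : ℂ => |‖u‖ * Real.log ‖u‖| + Real.pi * ‖u‖) (𝓝 0) (𝓝 0) := by
      have : Continuous fun u : ℂ => |‖u‖ * Real.log ‖u‖| + Real.pi * ‖u‖ :=
        ((Real.continuous_mul_log.comp continuous_norm).abs).add (by fun_prop)
      simpa using this.tendsto 0
    have h2 : Tendsto (fun u : ℂ => u * Complex.log u) (𝓝 0) (𝓝 0) := by
      refine squeeze_zero_norm (fun u => ?_) h1
      rw [norm_mul, abs_mul, abs_norm, mul_comm Real.pi, ← mul_add]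
      gcongr
      refine (Complex.norm_le_abs_re_add_abs_im _).trans ?_
      rw [Complex.log_re, Complex.log_im]
      gcongr
      exact Complex.abs_arg_le_pi u
    have h3 : ContinuousAt (fun u : ℂ => u * Complex.log u) 0 := by
      simpa [ContinuousAt] using h2
    exact h3.continuousWithinAt
  · exact (continuousAt_id.mul (continuousAt_clog (mem_slitPlane_of_re hu h))).continuousWithinAt

/-- Each logarithmic pole of `F` on the circle meets a zero of `P (y ^ 2)`, and u log u tends to 0.
This is what gives `J` continuous boundary values, equal to 0 at the poles. -/
lemma continuousOn_F_mul_P :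
    ContinuousOn (fun y => T.F y * T.P (y ^ 2)) (Metric.closedBall 0 1) := by
  have key : ∀ k, ContinuousOn (fun y => (Complex.log (1 + T.n k * y)
      - Complex.log (1 - T.n k * y)) * ((1 + T.n k * y) * (1 - T.n k * y)))
      (Metric.closedBall 0 1) := by
    intro k
    have m : ∀ y ∈ Metric.closedBall (0 : ℂ) 1, ‖T.n k * y‖ ≤ 1 := fun y hy => by
      rw [norm_mul, T.norm_n, one_mul]; simpa using hy
    have c1 : ContinuousOn (fun y => (1 + T.n k * y) * Complex.log (1 + T.n k * y))
        (Metric.closedBall 0 1) := fun y hy =>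
      (continuousWithinAt_mul_log _ (re_of_norm_le (m y hy)).1).comp
        (f := fun y => 1 + T.n k * y) (by fun_prop) fun z hz => (re_of_norm_le (m z hz)).1
    have c2 : ContinuousOn (fun y => (1 - T.n k * y) * Complex.log (1 - T.n k * y))
        (Metric.closedBall 0 1) := fun y hy =>
      (continuousWithinAt_mul_log _ (re_of_norm_le (m y hy)).2).comp
        (f := fun y => 1 - T.n k * y) (by fun_prop) fun z hz => (re_of_norm_le (m z hz)).2
    have c3 : ContinuousOn (fun y => 1 + T.n k * y) (Metric.closedBall 0 1) := by fun_prop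
    have c4 : ContinuousOn (fun y => 1 - T.n k * y) (Metric.closedBall 0 1) := by fun_prop
    exact ((c1.mul c4).sub (c2.mul c3)).congr fun y _ => by simp only [Pi.mul_apply, Pi.sub_apply]; ring
  have : ∀ y, T.F y * T.P (y ^ 2) = ∑ k, (T.l k : ℂ) * (((Complex.log (1 + T.n k * y)
      - Complex.log (1 - T.n k * y)) * ((1 + T.n k * y) * (1 - T.n k * y))) *
      ∏ j ∈ Finset.univ.erase k, ((1 + T.n j * y) * (1 - T.n j * y))) := by
    intro y
    rw [F, Finset.sum_mul]
    refine Finset.sum_congr rfl fun k _ => ?_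
    rw [P_eq, ← Finset.mul_prod_erase _ _ (Finset.mem_univ k)]
    ring
  simp_rw [this]
  refine continuousOn_finsetSum _ fun k _ => continuousOn_const.mul ((key k).mul ?_)
  exact Continuous.continuousOn (by fun_prop)

lemma continuous_P : Continuous T.P := by unfold P; fun_prop

lemma P_zero : T.P 0 = 1 := by simp [P]

/-- The derivative of F - C y³/3 is C (1/P(y²) - 1) y² = o(y²), so the mean value inequality bounds
this difference by o(y³). -/
lemma tendsto_F_div_cube : Tendsto (fun y => T.F y / y ^ 3) (𝓝[≠] 0) (𝓝 (T.C / 3)) := by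
  rw [Metric.tendsto_nhds]
  intro ε hε
  have h1 : Tendsto (fun y => T.C * (1 / T.P (y ^ 2) - 1)) (𝓝 0) (𝓝 0) := by
    have hc : ContinuousAt (fun y => T.C * (1 / T.P (y ^ 2) - 1)) 0 := by
      have : ContinuousAt (fun y => T.P (y ^ 2)) 0 :=
        (T.continuous_P.comp (by fun_prop)).continuousAt
      refine continuousAt_const.mul ((continuousAt_const.div this ?_).sub continuousAt_const)
      simp [P_zero]
    simpa [ContinuousAt, P_zero] using hc
  obtain ⟨δ, hδ, h2⟩ := Metric.tendsto_nhds_nhds.1 h1 (ε / 2) (by positivity)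
  rw [eventually_nhdsWithin_iff]
  filter_upwards [Metric.ball_mem_nhds (0 : ℂ) (lt_min hδ one_pos)] with y hy hy0
  have hy0' : y ≠ 0 := hy0
  have hyn : ‖y‖ < min δ 1 := by simpa using hy
  have hb : ∀ w ∈ Metric.closedBall (0 : ℂ) ‖y‖, HasDerivWithinAt
      (fun y => T.F y - T.C * y ^ 3 / 3) (T.C * (1 / T.P (w ^ 2) - 1) * w ^ 2)
      (Metric.closedBall (0 : ℂ) ‖y‖) w := by
    intro w hw
    have hw' : ‖w‖ ≤ ‖y‖ := by simpa using hw
    have hr : T.Regular w := T.regular_of_norm_lt (hw'.trans_lt (hyn.trans_le (min_le_right _ _)))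
    have := (T.hasDerivAt_F hr).sub (((hasDerivAt_pow 3 w).const_mul T.C).div_const 3)
    refine (this.congr_deriv ?_).hasDerivWithinAt
    have := hr.P_ne
    field_simp
    push_cast
    ring
  have hbound : ∀ w ∈ Metric.closedBall (0 : ℂ) ‖y‖,
      ‖T.C * (1 / T.P (w ^ 2) - 1) * w ^ 2‖ ≤ ε / 2 * ‖y‖ ^ 2 := by
    intro w hw
    have hw' : ‖w‖ ≤ ‖y‖ := by simpa using hw
    have := h2 (x := w) (by simpa using hw'.trans_lt (hyn.trans_le (min_le_left _ _)))
    rw [norm_mul, norm_pow]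
    gcongr
    simpa using this.le
  have := (convex_closedBall (0 : ℂ) ‖y‖).norm_image_sub_le_of_norm_hasDerivWithin_le hb hbound
    (x := 0) (y := y) (by simp) (by simp)
  simp only [F_zero, sub_zero, ne_eq, OfNat.ofNat_ne_zero, not_false_eq_true, zero_pow, mul_zero,
    zero_div] at this
  rw [dist_eq_norm]
  have e : T.F y / y ^ 3 - T.C / 3 = (T.F y - T.C * y ^ 3 / 3) / y ^ 3 := by field_simp
  rw [e, norm_div, norm_pow, div_lt_iff₀ (by positivity)]
  have hp : 0 < ‖y‖ := norm_pos_iff.2 hy0'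
  calc _ ≤ ε / 2 * ‖y‖ ^ 2 * ‖y‖ := this
    _ < ε * ‖y‖ ^ 3 := by
      have : 0 < ‖y‖ ^ 3 := by positivity
      nlinarith

/-- The quotient `F / (y F')`, extended continuously. -/
def J (y : ℂ) : ℂ := if y = 0 then 1 / 3 else T.F y * T.P (y ^ 2) / (T.C * y ^ 3)

lemma J_zero : T.J 0 = 1 / 3 := by simp [J]

lemma J_neg (y : ℂ) : T.J (-y) = T.J y := by
  by_cases h : y = 0
  · simp [h]
  · simp only [J, neg_eq_zero, h, if_false, F_neg]
    rw [neg_sq, show (-y) ^ 3 = -y ^ 3 by ring]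
    simp [neg_div_neg_eq]

lemma continuousAt_J_zero : ContinuousAt T.J 0 := by
  rw [continuousAt_iff_punctured_nhds, J_zero]
  have h1 := T.tendsto_F_div_cube
  have h2 : Tendsto (fun y => T.P (y ^ 2)) (𝓝[≠] 0) (𝓝 1) := by
    have : Continuous fun y => T.P (y ^ 2) := T.continuous_P.comp (by fun_prop)
    have := this.tendsto 0
    simp only [ne_eq, OfNat.ofNat_ne_zero, not_false_eq_true, zero_pow, P_zero] at this
    exact this.mono_left nhdsWithin_le_nhds
  have h3 := (h1.mul h2).div_const T.C
  have e : T.C / 3 * 1 / T.C = 1 / 3 := by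
    have := T.C_ne_zero
    field_simp
  rw [e] at h3
  refine h3.congr' ?_
  filter_upwards [self_mem_nhdsWithin] with y hy
  have hy : y ≠ 0 := hy
  have := T.C_ne_zero
  simp only [J, hy, if_false]
  field_simp

lemma continuousOn_J : ContinuousOn T.J (Metric.closedBall 0 1) := by
  intro y hy
  by_cases h : y = 0
  · subst h; exact T.continuousAt_J_zero.continuousWithinAt
  · have : ContinuousWithinAt (fun y => T.F y * T.P (y ^ 2) / (T.C * y ^ 3))
        (Metric.closedBall 0 1) y :=
      (T.continuousOn_F_mul_P y hy).div (by fun_prop)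
        (mul_ne_zero T.C_ne_zero (pow_ne_zero _ h))
    refine this.congr_of_eventuallyEq ?_ (by simp [J, h])
    filter_upwards [mem_nhdsWithin_of_mem_nhds (isOpen_ne.mem_nhds h)] with z hz
    have hz : z ≠ 0 := hz
    simp [J, hz]

lemma differentiableOn_J : DifferentiableOn ℂ T.J (Metric.ball 0 1) := by
  rw [← Complex.differentiableOn_compl_singleton_and_continuousAt_iff
    (Metric.ball_mem_nhds (0 : ℂ) one_pos)]
  refine ⟨fun y hy => ?_, T.continuousAt_J_zero⟩
  have h : y ≠ 0 := hy.2
  have hr : T.Regular y := T.regular_of_norm_lt (by simpa using hy.1)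
  have hP : DifferentiableAt ℂ (fun y => T.P (y ^ 2)) y := by unfold P; fun_prop
  have : DifferentiableAt ℂ (fun y => T.F y * T.P (y ^ 2) / (T.C * y ^ 3)) y :=
    ((T.hasDerivAt_F hr).differentiableAt.mul hP).div (by fun_prop)
      (mul_ne_zero T.C_ne_zero (pow_ne_zero _ h))
  refine (this.congr_of_eventuallyEq ?_).differentiableWithinAt
  filter_upwards [isOpen_ne.mem_nhds h] with z hz
  have hz : z ≠ 0 := hz
  simp [J, hz]

/-! ### Positivity of Re J: boundary signs and the maximum principle -/

/-- The map u ↦ (1 + u)/(1 - u) sends the upper unit semicircle to the positive imaginary axis. -/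
lemma log_sub_log_im_of_pos {u : ℂ} (hu : ‖u‖ = 1) (h : 0 < u.im) :
    (Complex.log (1 + u) - Complex.log (1 - u)).im = Real.pi / 2 := by
  have hns : u.re ^ 2 + u.im ^ 2 = 1 := by
    have := Complex.normSq_eq_norm_sq u
    rw [hu, Complex.normSq_apply] at this; linarith
  have hre : u.re < 1 := by nlinarith
  have e : 1 + u = ((u.im / (1 - u.re) : ℝ) : ℂ) * (Complex.I * (1 - u)) := by
    have : (1 - u.re) ≠ 0 := by linarith
    apply Complex.ext
    · rw [Complex.re_ofReal_mul]; simp; field_simp; nlinarith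
    · rw [Complex.im_ofReal_mul]; simp; field_simp
  have hne : (1 - u) ≠ 0 := fun h0 => by
    have := congrArg Complex.re h0; simp at this; linarith
  have ha : |Complex.arg (1 - u)| < Real.pi / 2 := by
    rw [Complex.abs_arg_lt_pi_div_two_iff]; left; simp; linarith
  have ha := abs_lt.1 ha
  rw [Complex.sub_im, Complex.log_im, Complex.log_im, e,
    Complex.arg_real_mul _ (div_pos h (by linarith)), Complex.arg_mul Complex.I_ne_zero hne,
    Complex.arg_I]
  · ring
  · rw [Complex.arg_I]; constructor <;> linarith [Real.pi_pos]

lemma log_sub_log_im {u : ℂ} (hu : ‖u‖ = 1) (h : u.im ≠ 0) :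
    (Complex.log (1 + u) - Complex.log (1 - u)).im = Real.pi / 2 * SignType.sign u.im := by
  rcases lt_or_gt_of_ne h with h | h
  · have := log_sub_log_im_of_pos (u := -u) (by simpa using hu) (by simpa using h)
    rw [sub_neg_eq_add, ← sub_eq_add_neg] at this
    rw [sign_neg h, ← neg_sub, Complex.neg_im, this]; simp
  · rw [log_sub_log_im_of_pos hu h, sign_pos h]; simp

/-- On the circle Im F is π/2 times the sum of the l_k signed by Im(n_k y). Since Σ l_k Im(n_k y) =
0, the three signs are not all equal; by the triangle inequalities the signed sum follows the
majority, whereas the product of one odd sign and two equal ones has the odd sign. -/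
lemma im_F_mul_prod_neg {y : ℂ} (hy : ‖y‖ = 1) (h : ∀ k, (T.n k * y).im ≠ 0) :
    (T.F y).im * ∏ k, (T.n k * y).im < 0 := by
  have hn : ∀ k, ‖T.n k * y‖ = 1 := fun k => by rw [norm_mul, T.norm_n, hy, one_mul]
  have e : (T.F y).im = Real.pi / 2 * ∑ k, T.l k * SignType.sign (T.n k * y).im := by
    rw [F, Complex.im_sum, Finset.mul_sum]
    refine Finset.sum_congr rfl fun k _ => ?_
    rw [Complex.im_ofReal_mul, log_sub_log_im (hn k) (h k)]; ring
  have hs : ∑ k, T.l k * (T.n k * y).im = 0 := by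
    have := congrArg Complex.im (congrArg (· * y) T.sum_zero)
    simp only [Finset.sum_mul, zero_mul, Complex.zero_im, Complex.im_sum, mul_assoc,
      Complex.im_ofReal_mul] at this
    exact this
  rw [e, mul_assoc]
  refine mul_neg_of_pos_of_neg (by positivity) ?_
  have p0 := T.l_pos 0
  have p1 := T.l_pos 1
  have p2 := T.l_pos 2
  have t0 := T.lt_zero
  have t1 := T.lt_one
  have t2 := T.lt_two
  simp only [Fin.sum_univ_three, Fin.prod_univ_three] at hs ⊢
  have h0 := h 0
  have h1 := h 1
  have h2 := h 2
  generalize (T.n 0 * y).im = x0 at *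
  generalize (T.n 1 * y).im = x1 at *
  generalize (T.n 2 * y).im = x2 at *
  rcases lt_or_gt_of_ne h0 with g0 | g0 <;> rcases lt_or_gt_of_ne h1 with g1 | g1 <;>
    rcases lt_or_gt_of_ne h2 with g2 | g2 <;>
    simp only [sign_neg, sign_pos, g0, g1, g2, SignType.coe_one, SignType.coe_neg]
  · have := mul_neg_of_pos_of_neg p0 g0
    have := mul_neg_of_pos_of_neg p1 g1
    have := mul_neg_of_pos_of_neg p2 g2
    linarith
  · exact mul_neg_of_neg_of_pos (by linarith) (mul_pos (mul_pos_of_neg_of_neg g0 g1) g2)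
  · exact mul_neg_of_neg_of_pos (by linarith)
      (mul_pos_of_neg_of_neg (mul_neg_of_neg_of_pos g0 g1) g2)
  · exact mul_neg_of_pos_of_neg (by linarith)
      (mul_neg_of_neg_of_pos (mul_neg_of_neg_of_pos g0 g1) g2)
  · exact mul_neg_of_neg_of_pos (by linarith)
      (mul_pos_of_neg_of_neg (mul_neg_of_pos_of_neg g0 g1) g2)
  · exact mul_neg_of_pos_of_neg (by linarith)
      (mul_neg_of_neg_of_pos (mul_neg_of_pos_of_neg g0 g1) g2)
  · exact mul_neg_of_pos_of_neg (by linarith) (mul_neg_of_pos_of_neg (mul_pos g0 g1) g2)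
  · have := mul_pos p0 g0
    have := mul_pos p1 g1
    have := mul_pos p2 g2
    linarith

/-- For |w| = 1 one has 1 - w² = -2i w Im w. Hence yF' = C y³/P(y²) is purely imaginary on the
circle, away from the poles. -/
lemma P_sq_of_norm_eq_one {y : ℂ} (hy : ‖y‖ = 1) :
    T.P (y ^ 2) = T.n 0 * T.n 1 * T.n 2 * y ^ 3 * (8 * Complex.I) *
      ((∏ k, (T.n k * y).im : ℝ) : ℂ) := by
  have key : ∀ k, 1 - T.n k ^ 2 * y ^ 2 = T.n k * y * (-2 * Complex.I * ((T.n k * y).im : ℂ)) := by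
    intro k
    have h1 : T.n k * y * (starRingEnd ℂ) (T.n k * y) = 1 := by
      rw [Complex.mul_conj, Complex.normSq_eq_norm_sq, norm_mul, T.norm_n, hy]; simp
    have h2 : (T.n k * y) - (starRingEnd ℂ) (T.n k * y) = (2 * (T.n k * y).im : ℝ) * Complex.I :=
      Complex.sub_conj _
    push_cast at h2
    linear_combination -h1 - T.n k * y * h2
  simp only [P, key, Fin.prod_univ_three]
  push_cast
  linear_combination (-8 * T.n 0 * T.n 1 * T.n 2 * y ^ 3 *
    ((T.n 0 * y).im * (T.n 1 * y).im * (T.n 2 * y).im) * Complex.I) * Complex.I_sq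

lemma J_of_norm_eq_one {y : ℂ} (hy : ‖y‖ = 1) :
    (T.J y).re = -(8 / T.κ) * ((T.F y).im * ∏ k, (T.n k * y).im) := by
  have h0 : y ≠ 0 := fun h => by simp [h] at hy
  have e : T.J y = ((8 / T.κ * ∏ k, (T.n k * y).im : ℝ) : ℂ) * (Complex.I * T.F y) := by
    have : (T.κ : ℂ) ≠ 0 := Complex.ofReal_ne_zero.2 T.κ_pos.ne'
    have hC := T.C_ne_zero
    simp only [J, h0, if_false, T.P_sq_of_norm_eq_one hy]
    rw [div_eq_iff (mul_ne_zero hC (pow_ne_zero _ h0)), C]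
    push_cast
    field_simp
  rw [e, Complex.re_ofReal_mul]
  simp
  ring

lemma im_ne_zero_of_P_ne {y : ℂ} (hy : ‖y‖ = 1) (h : T.P (y ^ 2) ≠ 0) (k : Fin 3) :
    (T.n k * y).im ≠ 0 := by
  rw [T.P_sq_of_norm_eq_one hy] at h
  have := right_ne_zero_of_mul h
  rw [Complex.ofReal_ne_zero, Finset.prod_ne_zero_iff] at this
  exact this k (Finset.mem_univ k)

lemma J_re_pos_of_norm_eq_one {y : ℂ} (hy : ‖y‖ = 1) (h : T.P (y ^ 2) ≠ 0) : 0 < (T.J y).re := by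
  rw [T.J_of_norm_eq_one hy]
  have := T.im_F_mul_prod_neg hy (T.im_ne_zero_of_P_ne hy h)
  have hk : 0 < 8 / T.κ := div_pos (by norm_num) T.κ_pos
  nlinarith

lemma J_re_nonneg_of_norm_eq_one {y : ℂ} (hy : ‖y‖ = 1) : 0 ≤ (T.J y).re := by
  by_cases h : T.P (y ^ 2) = 0
  · have h0 : y ≠ 0 := fun h => by simp [h] at hy
    simp [J, h0, h]
  · exact (T.J_re_pos_of_norm_eq_one hy h).le

/-- The maximum principle for exp(-J), of modulus exp(-Re J), which is at most 1 on the circle.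
Modulus at least 1 at an interior point would make the modulus constant, contradicting J(0) = 1/3.
-/
lemma J_re_pos_of_norm_lt {y : ℂ} (hy : ‖y‖ < 1) : 0 < (T.J y).re := by
  have hd : DiffContOnCl ℂ (fun y => Complex.exp (-T.J y)) (Metric.ball 0 1) := by
    constructor
    · exact T.differentiableOn_J.neg.cexp
    · rw [closure_ball _ one_ne_zero]
      exact T.continuousOn_J.neg.cexp
  have hn : ∀ y, ‖Complex.exp (-T.J y)‖ = Real.exp (-(T.J y).re) := fun y => by
    rw [Complex.norm_exp, Complex.neg_re]
  have hle : ∀ y ∈ closure (Metric.ball (0 : ℂ) 1), ‖Complex.exp (-T.J y)‖ ≤ 1 := by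
    intro y hy
    refine Complex.norm_le_of_forall_mem_frontier_norm_le Metric.isBounded_ball hd
      (fun z hz => ?_) hy
    rw [frontier_ball _ one_ne_zero] at hz
    rw [hn, Real.exp_le_one_iff, neg_nonpos]
    exact T.J_re_nonneg_of_norm_eq_one (by simpa using hz)
  by_contra! hneg
  have hyb : y ∈ Metric.ball (0 : ℂ) 1 := by simpa using hy
  have hmax : IsMaxOn (norm ∘ fun y => Complex.exp (-T.J y)) (Metric.ball 0 1) y := by
    intro z hz
    refine (hle z (subset_closure hz)).trans ?_
    simp only [Function.comp]
    rw [hn]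
    exact Real.one_le_exp (by linarith)
  have h0 := Complex.norm_eqOn_of_isPreconnected_of_isMaxOn
    (convex_ball (0 : ℂ) 1).isPreconnected Metric.isOpen_ball hd.differentiableOn hyb hmax
    (x := 0) (by simp)
  have h1 : (1 : ℝ) ≤ ‖Complex.exp (-T.J y)‖ := by
    rw [hn]; exact Real.one_le_exp (by linarith)
  simp only [Function.comp, Function.const] at h0
  rw [← h0, hn, J_zero] at h1
  have : Real.exp (-(1 / 3 : ℂ).re) < 1 := by
    rw [Real.exp_lt_one_iff]; norm_num
  linarith

end ClosedTriangle

/-! ### Even functions, holomorphic logarithms, analytic implicit functions -/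

lemma exists_eq_comp_sq_of_even {f : ℂ → ℂ} (hf : DifferentiableOn ℂ f (Metric.ball 0 1))
    (he : ∀ y, f (-y) = f y) :
    ∃ h : ℂ → ℂ, DifferentiableOn ℂ h (Metric.ball 0 1) ∧ ∀ y, f y = h (y ^ 2) := by
  have hsq : ∀ Y : ℂ, (Y ^ (1 / 2 : ℂ)) ^ 2 = Y := fun Y => by
    rw [one_div]; exact Complex.cpow_ofNat_inv_pow Y 2
  have hy : ∀ y, f y = f ((y ^ 2) ^ (1 / 2 : ℂ)) := by
    intro y
    rcases sq_eq_sq_iff_eq_or_eq_neg.1 (hsq (y ^ 2)) with h | h <;> rw [h]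
    exact (he y).symm
  refine ⟨fun Y => f (Y ^ (1 / 2 : ℂ)), ?_, hy⟩
  have hcont : ContinuousAt (fun Y : ℂ => f (Y ^ (1 / 2 : ℂ))) 0 := by
    have h0 : ContinuousAt f ((0 : ℂ) ^ (1 / 2 : ℂ)) := by
      have : (0 : ℂ) ^ (1 / 2 : ℂ) = 0 := by simp
      rw [this]
      exact (hf.differentiableAt (Metric.ball_mem_nhds _ one_pos)).continuousAt
    exact h0.comp (f := fun Y : ℂ => Y ^ (1 / 2 : ℂ))
      (Complex.continuousAt_cpow_const_of_re_pos (Or.inl le_rfl) (by norm_num))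
  rw [← Complex.differentiableOn_compl_singleton_and_continuousAt_iff
    (Metric.ball_mem_nhds (0 : ℂ) one_pos)]
  refine ⟨fun Y hY => ?_, hcont⟩
  have hY0 : Y ≠ 0 := hY.2
  set y := Y ^ (1 / 2 : ℂ) with hydef
  have hyY : y ^ 2 = Y := hsq Y
  have hy1 : y ∈ Metric.ball (0 : ℂ) 1 := by
    have h1 : ‖Y‖ < 1 := by simpa using hY.1
    rw [← hyY, norm_pow] at h1
    simpa using (pow_lt_one_iff_of_nonneg (norm_nonneg y) two_ne_zero).1 h1
  -- The principal root jumps across the negative axis. Near Y it is replaced by the holomorphic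
  -- branch through y, which changes nothing because `f` is even; the point 0 is a removable
  -- singularity.
  have hs : DifferentiableAt ℂ (fun Z : ℂ => y * (Z / Y) ^ (1 / 2 : ℂ)) Y := by
    refine DifferentiableAt.const_mul ?_ _
    refine DifferentiableAt.cpow_const (by fun_prop) ?_
    rw [div_self hY0]; exact Complex.one_mem_slitPlane
  have hfs : DifferentiableAt ℂ (fun Z : ℂ => f (y * (Z / Y) ^ (1 / 2 : ℂ))) Y := by
    refine DifferentiableAt.comp (f := fun Z : ℂ => y * (Z / Y) ^ (1 / 2 : ℂ)) Y ?_ hs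
    simp only [div_self hY0, Complex.one_cpow, mul_one]
    exact hf.differentiableAt (Metric.isOpen_ball.mem_nhds hy1)
  refine (hfs.congr_of_eventuallyEq (Eventually.of_forall fun Z => ?_)).differentiableWithinAt
  simp only
  rw [hy (y * (Z / Y) ^ (1 / 2 : ℂ)), mul_pow, hsq (Z / Y), hyY, mul_div_cancel₀ _ hY0]

lemma exists_log_of_ne_zero {g : ℂ → ℂ} (hg : DifferentiableOn ℂ g (Metric.ball 0 1))
    (h0 : ∀ Y ∈ Metric.ball (0 : ℂ) 1, g Y ≠ 0) :
    ∃ ℓ : ℂ → ℂ, DifferentiableOn ℂ ℓ (Metric.ball 0 1) ∧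
      ∀ Y ∈ Metric.ball (0 : ℂ) 1, g Y = Complex.exp (ℓ Y) := by
  have hq : DifferentiableOn ℂ (fun Y => deriv g Y / g Y) (Metric.ball 0 1) :=
    (hg.deriv Metric.isOpen_ball).div hg h0
  obtain ⟨ℓ, hℓ0, hℓ⟩ := hq.isExactOn_ball.with_val_at 0 (Complex.log (g 0))
  refine ⟨ℓ, fun Y hY => (hℓ Y hY).differentiableAt.differentiableWithinAt, fun Y hY => ?_⟩
  have hd : ∀ Y ∈ Metric.ball (0 : ℂ) 1, HasDerivAt (fun Y => g Y * Complex.exp (-ℓ Y)) 0 Y := by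
    intro Y hY
    have h1 := (hg.differentiableAt (Metric.isOpen_ball.mem_nhds hY)).hasDerivAt
    refine (h1.mul (hℓ Y hY).neg.cexp).congr_deriv ?_
    have := h0 Y hY
    field_simp
    ring
  have hc := (convex_ball (0 : ℂ) 1).is_const_of_fderivWithin_eq_zero (𝕜 := ℂ)
    (f := fun Y => g Y * Complex.exp (-ℓ Y))
    (fun Y hY => (hd Y hY).differentiableAt.differentiableWithinAt)
    (fun Y hY => by
      rw [fderivWithin_of_isOpen Metric.isOpen_ball hY]
      ext
      simpa using (hd Y hY).deriv)
    hY (Metric.mem_ball_self one_pos)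
  rw [hℓ0, Complex.exp_neg (Complex.log _), Complex.exp_log (h0 0 (by simp)),
    mul_inv_cancel₀ (h0 0 (by simp)), Complex.exp_neg] at hc
  exact (mul_inv_eq_one₀ (Complex.exp_ne_zero _)).1 hc

lemma exists_analytic_implicit {f : ℝ × ℝ → ℝ} {u : ℝ × ℝ} (hf : AnalyticAt ℝ f u) {d : ℝ}
    (hd : HasDerivAt (fun y => f (u.1, y)) d u.2) (hd0 : d ≠ 0) :
    ∃ ψ : ℝ → ℝ, AnalyticAt ℝ ψ u.1 ∧ ψ u.1 = u.2 ∧ (∀ᶠ x in 𝓝 u.1, f (x, ψ x) = f u) ∧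
      ∀ᶠ v in 𝓝 u, f v = f u ↔ ψ v.1 = v.2 := by
  -- The smoothness exponent `⊤` is the analytic class, so the implicit function comes out analytic.
  have cdf : ContDiffAt ℝ ⊤ f u := hf.contDiffAt
  have if₂ : (fderiv ℝ f u ∘L .inr ℝ ℝ ℝ).IsInvertible := by
    refine ⟨ContinuousLinearEquiv.unitsEquivAut ℝ (Units.mk0 d hd0), ?_⟩
    have h1 : HasFDerivAt f (fderiv ℝ f u) (u.1, u.2) := hf.differentiableAt.hasFDerivAt
    have h2 := (h1.comp u.2 (hasFDerivAt_prodMk_right u.1 u.2)).hasDerivAt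
    have h3 := hd.unique h2
    ext
    simpa using h3
  exact ⟨cdf.implicitFunction (by simp) if₂,
    (cdf.contDiffAt_implicitFunction (by simp) if₂).analyticAt,
    cdf.implicitFunction_apply_self _ if₂, cdf.eventually_apply_implicitFunction _ if₂,
    cdf.eventually_apply_eq_iff_implicitFunction _ if₂⟩

/-! ### The argument of `F` on circles and the level curves in the disc -/

namespace ClosedTriangle

variable (T : ClosedTriangle)

lemma P_ne_zero_of_norm_lt {Y : ℂ} (hY : ‖Y‖ < 1) : T.P Y ≠ 0 := by
  refine Finset.prod_ne_zero_iff.2 fun k _ h => ?_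
  have : ‖T.n k ^ 2 * Y‖ = 1 := by rw [← sub_eq_zero.1 h]; simp
  rw [norm_mul, norm_pow, T.norm_n, one_pow, one_mul] at this
  linarith

lemma F_eq_J_mul {y : ℂ} (hy : ‖y‖ < 1) : T.F y = y ^ 3 * (T.C * T.J y / T.P (y ^ 2)) := by
  by_cases h : y = 0
  · simp [h, F_zero]
  · have hP : T.P (y ^ 2) ≠ 0 := (T.regular_of_norm_lt hy).P_ne
    have hC := T.C_ne_zero
    simp only [J, h, if_false]
    field_simp

/-- The quotient F/y³ = C J/P(y²) is even and, as Re J > 0, has no zero, so it is the exponential of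
a function ℓ of Y = y². Logarithmic differentiation gives 3/2 + Yℓ'(Y) = 1/(2J), whose real part is
positive. -/
lemma exists_log_factor : ∃ ℓ : ℂ → ℂ, DifferentiableOn ℂ ℓ (Metric.ball 0 1) ∧
    (∀ y, ‖y‖ < 1 → T.F y = y ^ 3 * Complex.exp (ℓ (y ^ 2))) ∧
    ∀ Y, ‖Y‖ < 1 → 0 < (3 / 2 + Y * deriv ℓ Y).re := by
  obtain ⟨h, hh, hJ⟩ := exists_eq_comp_sq_of_even T.differentiableOn_J T.J_neg
  have hroot : ∀ Y : ℂ, ‖Y‖ < 1 → ∃ y : ℂ, ‖y‖ < 1 ∧ y ^ 2 = Y := by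
    intro Y hY
    have e : (Y ^ (1 / 2 : ℂ)) ^ 2 = Y := by
      rw [one_div]; exact Complex.cpow_ofNat_inv_pow Y 2
    refine ⟨_, ?_, e⟩
    rw [← e, norm_pow] at hY
    exact (pow_lt_one_iff_of_nonneg (norm_nonneg _) two_ne_zero).1 hY
  have hP : DifferentiableOn ℂ T.P (Metric.ball 0 1) := by
    unfold P
    exact Differentiable.differentiableOn (by fun_prop)
  obtain ⟨ℓ, hℓ, hexp⟩ := exists_log_of_ne_zero (g := fun Y => T.C * h Y / T.P Y)
    ((hh.const_mul _).div hP fun Y hY => T.P_ne_zero_of_norm_lt (by simpa using hY))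
    (fun Y hY => by
      have hY : ‖Y‖ < 1 := by simpa using hY
      obtain ⟨y, hy, rfl⟩ := hroot Y hY
      rw [← hJ]
      refine div_ne_zero (mul_ne_zero T.C_ne_zero fun h0 => ?_) (T.P_ne_zero_of_norm_lt hY)
      have := T.J_re_pos_of_norm_lt hy
      simp [h0] at this)
  have hF : ∀ y, ‖y‖ < 1 → T.F y = y ^ 3 * Complex.exp (ℓ (y ^ 2)) := by
    intro y hy
    have hY : y ^ 2 ∈ Metric.ball (0 : ℂ) 1 := by
      simpa using pow_lt_one₀ (norm_nonneg y) hy two_ne_zero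
    rw [T.F_eq_J_mul hy, hJ, ← hexp _ hY]
  refine ⟨ℓ, hℓ, hF, fun Y hY => ?_⟩
  obtain ⟨y, hy, rfl⟩ := hroot Y hY
  by_cases h0 : y = 0
  · simp [h0]
  have hd : HasDerivAt (fun y => y ^ 3 * Complex.exp (ℓ (y ^ 2)))
      (y ^ 3 * Complex.exp (ℓ (y ^ 2)) * (2 / y * (3 / 2 + y ^ 2 * deriv ℓ (y ^ 2)))) y := by
    have h1 : HasDerivAt (fun y => ℓ (y ^ 2)) (deriv ℓ (y ^ 2) * (2 * y)) y := by
      have := (hℓ.differentiableAt (Metric.isOpen_ball.mem_nhds (x := y ^ 2)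
        (by simpa using hY))).hasDerivAt
      exact (this.comp y (hasDerivAt_pow 2 y)).congr_deriv (by simp)
    refine ((hasDerivAt_pow 3 y).mul h1.cexp).congr_deriv ?_
    field_simp
    push_cast
    ring
  have hF' := T.hasDerivAt_F (T.regular_of_norm_lt hy)
  have heq : T.F =ᶠ[𝓝 y] fun y => y ^ 3 * Complex.exp (ℓ (y ^ 2)) := by
    filter_upwards [Metric.isOpen_ball.mem_nhds (x := y) (s := Metric.ball 0 1) (by simpa using hy)]
      with w hw
    exact hF w (by simpa using hw)
  have hu := (hd.congr_of_eventuallyEq heq).unique hF'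
  rw [← hF y hy] at hu
  have hJpos := T.J_re_pos_of_norm_lt hy
  have hJ0 : T.J y ≠ 0 := fun h => by simp [h] at hJpos
  have hPy := T.P_ne_zero_of_norm_lt hY
  have hC := T.C_ne_zero
  have e : 3 / 2 + y ^ 2 * deriv ℓ (y ^ 2) = ((1 / 2 : ℝ) : ℂ) * (T.J y)⁻¹ := by
    rw [eq_mul_inv_iff_mul_eq₀ hJ0]
    rw [eq_div_iff hPy, T.F_eq_J_mul hy] at hu
    field_simp at hu ⊢
    push_cast
    linear_combination hu
  rw [e, Complex.re_ofReal_mul, Complex.inv_re]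
  have := Complex.normSq_pos.2 hJ0
  positivity

/-- A holomorphic function on the unit disc with `F y = y ^ 3 * exp (logFactor (y ^ 2))`. -/
def logFactor : ℂ → ℂ := T.exists_log_factor.choose

lemma differentiableOn_logFactor : DifferentiableOn ℂ T.logFactor (Metric.ball 0 1) :=
  T.exists_log_factor.choose_spec.1

lemma F_eq_cube_mul_exp {y : ℂ} (hy : ‖y‖ < 1) :
    T.F y = y ^ 3 * Complex.exp (T.logFactor (y ^ 2)) :=
  T.exists_log_factor.choose_spec.2.1 y hy

lemma logFactor_re_pos {Y : ℂ} (hY : ‖Y‖ < 1) : 0 < (3 / 2 + Y * deriv T.logFactor Y).re :=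
  T.exists_log_factor.choose_spec.2.2 Y hY

/-- The argument of the potential at the square root of `r * exp (i φ)`. -/
def Λ (p : ℝ × ℝ) : ℝ := 3 / 2 * p.2 + (T.logFactor (p.1 * Complex.exp (p.2 * Complex.I))).im

lemma norm_polar (r φ : ℝ) : ‖(r : ℂ) * Complex.exp (φ * Complex.I)‖ = |r| := by
  rw [norm_mul, Complex.norm_exp_ofReal_mul_I, mul_one, Complex.norm_real, Real.norm_eq_abs]

lemma analyticAt_Λ {p : ℝ × ℝ} (hp : |p.1| < 1) : AnalyticAt ℝ T.Λ p := by
  have h1 : AnalyticAt ℂ T.logFactor (p.1 * Complex.exp (p.2 * Complex.I)) :=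
    T.differentiableOn_logFactor.analyticAt
      (Metric.isOpen_ball.mem_nhds (by simpa [norm_polar] using hp))
  have h2 : AnalyticAt ℝ (fun p : ℝ × ℝ => (p.1 : ℂ) * Complex.exp (p.2 * Complex.I)) p := by
    have a1 : AnalyticAt ℝ (fun p : ℝ × ℝ => (p.1 : ℂ)) p :=
      (Complex.ofRealCLM.analyticAt _).comp analyticAt_fst
    have a2 : AnalyticAt ℝ (fun p : ℝ × ℝ => (p.2 : ℂ)) p :=
      (Complex.ofRealCLM.analyticAt _).comp analyticAt_snd
    have a3 : AnalyticAt ℝ Complex.exp ((p.2 : ℂ) * Complex.I) :=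
      (analyticAt_cexp (z := (p.2 : ℂ) * Complex.I)).restrictScalars
    exact a1.mul (a3.comp (f := fun p : ℝ × ℝ => (p.2 : ℂ) * Complex.I) (a2.mul analyticAt_const))
  have h3 := (h1.restrictScalars (𝕜 := ℝ)).comp
    (f := fun p : ℝ × ℝ => (p.1 : ℂ) * Complex.exp (p.2 * Complex.I)) h2
  exact (analyticAt_const.mul analyticAt_snd).add ((Complex.imCLM.analyticAt _).comp h3)

lemma hasDerivAt_exp_mul_I (φ : ℝ) : HasDerivAt (fun φ : ℝ => Complex.exp (φ * Complex.I))
    (Complex.I * Complex.exp (φ * Complex.I)) φ := by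
  have := ((hasDerivAt_id (φ : ℂ)).mul_const Complex.I).cexp.comp_ofReal
  refine this.congr_deriv ?_
  simp
  ring

lemma hasDerivAt_Λ {r : ℝ} (hr : |r| < 1) (φ : ℝ) : HasDerivAt (fun φ => T.Λ (r, φ))
    (3 / 2 + (r * Complex.exp (φ * Complex.I)) *
      deriv T.logFactor (r * Complex.exp (φ * Complex.I)) : ℂ).re φ := by
  set Y : ℂ := r * Complex.exp (φ * Complex.I) with hY
  have h1 : HasDerivAt T.logFactor (deriv T.logFactor Y) Y :=
    (T.differentiableOn_logFactor.differentiableAt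
      (Metric.isOpen_ball.mem_nhds (by simpa [hY, norm_polar] using hr))).hasDerivAt
  have h2 := h1.comp φ ((hasDerivAt_exp_mul_I φ).const_mul (r : ℂ))
  have h3 : HasDerivAt (fun φ : ℝ => (T.logFactor (r * Complex.exp (φ * Complex.I))).im)
      (deriv T.logFactor Y * (r * (Complex.I * Complex.exp (φ * Complex.I)))).im φ :=
    Complex.imCLM.hasFDerivAt.comp_hasDerivAt φ h2
  refine (((hasDerivAt_id φ).const_mul (3 / 2 : ℝ)).add h3).congr_deriv ?_
  have : deriv T.logFactor Y * (r * (Complex.I * Complex.exp (φ * Complex.I)))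
      = Complex.I * (Y * deriv T.logFactor Y) := by rw [hY]; ring
  rw [this, Complex.I_mul_im, Complex.add_re]
  norm_num

/-- This is the derivative of arg F with respect to arg Y; its positivity is the positivity of Re J.
-/
lemma Λ_deriv_pos {r : ℝ} (hr : |r| < 1) (φ : ℝ) :
    0 < (3 / 2 + (r * Complex.exp (φ * Complex.I)) *
      deriv T.logFactor (r * Complex.exp (φ * Complex.I)) : ℂ).re :=
  T.logFactor_re_pos (by simpa [norm_polar] using hr)

lemma strictMono_Λ {r : ℝ} (hr : |r| < 1) : StrictMono fun φ => T.Λ (r, φ) :=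
  strictMono_of_deriv_pos fun φ => by
    rw [(T.hasDerivAt_Λ hr φ).deriv]; exact T.Λ_deriv_pos hr φ

/-- One turn of Y adds 3π to arg F, while the zeros of Re F occur at spacing π. This is why there
are three arcs. -/
lemma Λ_add_int_mul (r φ : ℝ) (N : ℤ) :
    T.Λ (r, φ + N * (2 * Real.pi)) = T.Λ (r, φ) + N * (3 * Real.pi) := by
  have : Complex.exp (((φ + N * (2 * Real.pi) : ℝ) : ℂ) * Complex.I)
      = Complex.exp (φ * Complex.I) := by
    rw [Complex.exp_eq_exp_iff_exists_int]
    exact ⟨N, by push_cast; ring⟩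
  simp only [Λ, this]
  ring

lemma exists_Λ_eq {r : ℝ} (hr : |r| < 1) (c : ℝ) : ∃ φ, T.Λ (r, φ) = c := by
  obtain ⟨N, ⟨h1, h2⟩, -⟩ := existsUnique_add_zsmul_mem_Ico
    (show (0 : ℝ) < 3 * Real.pi by positivity) (T.Λ (r, 0)) (c - 3 * Real.pi)
  have hc : ContinuousOn (fun φ => T.Λ (r, φ))
      (Icc (0 + N * (2 * Real.pi)) (0 + ((N + 1 : ℤ) : ℝ) * (2 * Real.pi))) :=
    fun φ _ => (T.hasDerivAt_Λ hr φ).continuousAt.continuousWithinAt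
  have hle : 0 + N * (2 * Real.pi) ≤ 0 + ((N + 1 : ℤ) : ℝ) * (2 * Real.pi) := by
    push_cast; nlinarith [Real.pi_pos]
  have hm : c ∈ Icc (T.Λ (r, 0 + N * (2 * Real.pi)))
      (T.Λ (r, 0 + ((N + 1 : ℤ) : ℝ) * (2 * Real.pi))) := by
    rw [Λ_add_int_mul, Λ_add_int_mul]
    rw [zsmul_eq_mul] at h1 h2
    push_cast
    constructor <;> linarith
  obtain ⟨φ, -, h⟩ := intermediate_value_Icc hle hc hm
  exact ⟨φ, h⟩

/-- The angle of the point of modulus `r` on the level curve with index `j`. -/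
def angle (j : ℤ) (r : ℝ) : ℝ :=
  if h : |r| < 1 then (T.exists_Λ_eq h (Real.pi / 2 + j * Real.pi)).choose else 0

lemma Λ_angle (j : ℤ) {r : ℝ} (hr : |r| < 1) :
    T.Λ (r, T.angle j r) = Real.pi / 2 + j * Real.pi := by
  rw [angle, dif_pos hr]; exact (T.exists_Λ_eq hr _).choose_spec

lemma eq_angle {j : ℤ} {r φ : ℝ} (hr : |r| < 1) (h : T.Λ (r, φ) = Real.pi / 2 + j * Real.pi) :
    φ = T.angle j r :=
  (T.strictMono_Λ hr).injective (h.trans (T.Λ_angle j hr).symm)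

lemma angle_lt_angle {i j : ℤ} {r : ℝ} (hr : |r| < 1) :
    T.angle i r < T.angle j r ↔ i < j := by
  rw [← (T.strictMono_Λ hr).lt_iff_lt]
  simp only [T.Λ_angle _ hr, add_lt_add_iff_left, Real.pi_pos, mul_lt_mul_iff_left₀, Int.cast_lt]

lemma angle_add_mul (j N : ℤ) {r : ℝ} (hr : |r| < 1) :
    T.angle (j + 3 * N) r = T.angle j r + N * (2 * Real.pi) := by
  refine (T.eq_angle hr ?_).symm
  rw [Λ_add_int_mul, T.Λ_angle _ hr]
  push_cast
  ring

/-- The modulus of Y may be 0 or even negative here. This gives analyticity of the arcs on a full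
neighbourhood of their end points. -/
lemma analyticAt_angle (j : ℤ) {r : ℝ} (hr : |r| < 1) : AnalyticAt ℝ (T.angle j) r := by
  obtain ⟨ψ, h1, -, h3, -⟩ := exists_analytic_implicit (u := (r, T.angle j r))
    (T.analyticAt_Λ hr) (T.hasDerivAt_Λ hr _) (T.Λ_deriv_pos hr _).ne'
  refine h1.congr ?_
  filter_upwards [h3, (isOpen_lt continuous_abs continuous_const).mem_nhds hr] with s hs hs1
  exact T.eq_angle hs1 (hs.trans (T.Λ_angle j hr))

lemma U_polar {ρ θ : ℝ} (h0 : 0 ≤ ρ) (h1 : ρ < 1) :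
    ∃ m > 0, T.U (ρ * Complex.exp (θ * Complex.I)) = ρ ^ 3 * m * Real.cos (T.Λ (ρ ^ 2, 2 * θ)) := by
  set y : ℂ := ρ * Complex.exp (θ * Complex.I) with hy
  have hn : ‖y‖ < 1 := by rw [hy, norm_polar, abs_of_nonneg h0]; exact h1
  have hy2 : y ^ 2 = (ρ ^ 2 : ℝ) * Complex.exp ((2 * θ : ℝ) * Complex.I) := by
    rw [hy, mul_pow, ← Complex.exp_nat_mul]; push_cast; ring_nf
  have hy3 : y ^ 3 = (ρ ^ 3 : ℝ) * Complex.exp ((3 * θ : ℝ) * Complex.I) := by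
    rw [hy, mul_pow, ← Complex.exp_nat_mul]; push_cast; ring_nf
  refine ⟨Real.exp (T.logFactor (y ^ 2)).re, Real.exp_pos _, ?_⟩
  rw [← F_re, T.F_eq_cube_mul_exp hn, hy3, mul_assoc, ← Complex.exp_add, Complex.re_ofReal_mul,
    Complex.exp_re, mul_assoc]
  congr 2
  · congr 1
    simp
  · rw [Λ, ← hy2, Complex.add_im, Complex.im_ofReal_mul, Complex.I_im]
    congr 1
    ring

lemma U_polar_eq_zero_iff {ρ θ : ℝ} (h0 : 0 < ρ) (h1 : ρ < 1) :
    T.U (ρ * Complex.exp (θ * Complex.I)) = 0 ↔ ∃ j : ℤ, 2 * θ = T.angle j (ρ ^ 2) := by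
  obtain ⟨m, hm, h⟩ := T.U_polar (θ := θ) h0.le h1
  have hr : |ρ ^ 2| < 1 := by
    rw [abs_of_pos (by positivity)]; exact pow_lt_one₀ h0.le h1 two_ne_zero
  rw [h, mul_eq_zero, or_iff_right (by positivity), Real.cos_eq_zero_iff]
  refine exists_congr fun j => ⟨fun h => T.eq_angle hr (by rw [h]; ring), fun h => ?_⟩
  rw [h, T.Λ_angle _ hr]; ring

end ClosedTriangle
-- Reflection in the unit circle and continuation across it
namespace ClosedTriangle

variable (T : ClosedTriangle)

lemma norm_real_add_eq (ρ : ℝ) {w : ℂ} (hw : ‖w‖ = 1) : ‖(ρ : ℂ) + w‖ = ‖1 + (ρ : ℂ) * w‖ := by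
  have h1 : w * (starRingEnd ℂ) w = 1 := by
    rw [Complex.mul_conj, Complex.normSq_eq_norm_sq, hw]; simp
  have h2 : (ρ : ℂ) + w = w * (starRingEnd ℂ) (1 + ρ * w) := by
    simp only [map_add, map_mul, map_one, Complex.conj_ofReal]
    linear_combination -(ρ : ℂ) * h1
  rw [h2, norm_mul, hw, one_mul, Complex.norm_conj]

/-- Under y ↦ 1/ȳ both |1 + n_k y| and |1 - n_k y| are divided by |y|, so their logarithms have the
same difference. -/
lemma U_inv_modulus {ρ : ℝ} (hρ : 0 < ρ) (θ : ℝ) :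
    T.U ((ρ⁻¹ : ℝ) * Complex.exp (θ * Complex.I)) = T.U (ρ * Complex.exp (θ * Complex.I)) := by
  by_cases h1 : ρ = 1
  · simp [h1]
  have hρc : (ρ : ℂ) ≠ 0 := by exact_mod_cast hρ.ne'
  unfold U
  refine Finset.sum_congr rfl fun k _ => ?_
  congr 1
  have key : ∀ w : ℂ, ‖w‖ = 1 →
      Real.log ‖1 + ((ρ⁻¹ : ℝ) : ℂ) * w‖ = Real.log ‖1 + (ρ : ℂ) * w‖ - Real.log ρ := by
    intro w hw
    have e : 1 + ((ρ⁻¹ : ℝ) : ℂ) * w = (ρ : ℂ)⁻¹ * (ρ + w) := by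
      push_cast; field_simp
    have hne : ‖1 + (ρ : ℂ) * w‖ ≠ 0 := by
      rw [norm_ne_zero_iff]
      intro h0
      have := congrArg norm (eq_neg_of_add_eq_zero_right h0)
      rw [norm_mul, hw, norm_neg, norm_one, mul_one, Complex.norm_real, Real.norm_eq_abs,
        abs_of_pos hρ] at this
      exact h1 this
    rw [e, norm_mul, norm_real_add_eq ρ hw, norm_inv, Complex.norm_real, Real.norm_eq_abs,
      abs_of_pos hρ, Real.log_mul (inv_ne_zero hρ.ne') hne, Real.log_inv]
    ring
  have hw : ‖T.n k * Complex.exp (θ * Complex.I)‖ = 1 := by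
    rw [norm_mul, T.norm_n, Complex.norm_exp_ofReal_mul_I, one_mul]
  have k1 := key _ hw
  have k2 := key (-(T.n k * Complex.exp (θ * Complex.I))) (by rwa [norm_neg])
  have s1 : ∀ r : ℝ, 1 + T.n k * ((r : ℂ) * Complex.exp (θ * Complex.I)) =
      1 + (r : ℂ) * (T.n k * Complex.exp (θ * Complex.I)) := fun r => by ring
  have s2 : ∀ r : ℝ, 1 - T.n k * ((r : ℂ) * Complex.exp (θ * Complex.I)) =
      1 + (r : ℂ) * (-(T.n k * Complex.exp (θ * Complex.I))) := fun r => by ring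
  rw [s1, s1, s2, s2, k1, k2]
  ring

lemma P_ne_zero_of_norm_ne_one {Y : ℂ} (hY : ‖Y‖ ≠ 1) : T.P Y ≠ 0 := by
  refine Finset.prod_ne_zero_iff.2 fun k _ h => hY ?_
  have : ‖T.n k ^ 2 * Y‖ = 1 := by rw [← sub_eq_zero.1 h]; simp
  rwa [norm_mul, norm_pow, T.norm_n, one_pow, one_mul] at this

/-- The potential on the cylinder of logarithmic coordinates. -/
def cylPotential (p : ℝ × ℝ) : ℝ := T.U ((Real.exp p.1 : ℝ) * Complex.exp (p.2 * Complex.I))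

lemma cylPotential_neg (x θ : ℝ) : T.cylPotential (-x, θ) = T.cylPotential (x, θ) := by
  have := T.U_inv_modulus (Real.exp_pos x) θ
  rwa [← Real.exp_neg] at this

lemma F_analyticAt {y : ℂ} (h : T.Regular y) : AnalyticAt ℂ T.F y :=
  (show DifferentiableOn ℂ T.F {y | T.Regular y} from
    fun _ hz => (T.hasDerivAt_F hz).differentiableAt.differentiableWithinAt).analyticAt
    (T.isOpen_regular.mem_nhds h)

lemma analyticAt_cylPotential {τ : ℝ} (h : T.Regular (Complex.exp (τ * Complex.I))) :
    AnalyticAt ℝ T.cylPotential (0, τ) := by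
  have h2 : AnalyticAt ℝ
      (fun p : ℝ × ℝ => ((Real.exp p.1 : ℝ) : ℂ) * Complex.exp (p.2 * Complex.I)) (0, τ) := by
    have a0 : AnalyticAt ℝ Real.exp (0 : ℝ) := analyticAt_rexp
    have a0' : AnalyticAt ℝ (fun p : ℝ × ℝ => Real.exp p.1) (0, τ) :=
      a0.comp (f := fun p : ℝ × ℝ => p.1) (x := (0, τ)) analyticAt_fst
    have a1 : AnalyticAt ℝ (fun p : ℝ × ℝ => ((Real.exp p.1 : ℝ) : ℂ)) (0, τ) :=
      (Complex.ofRealCLM.analyticAt _).comp (f := fun p : ℝ × ℝ => Real.exp p.1) a0'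
    have a2 : AnalyticAt ℝ (fun p : ℝ × ℝ => (p.2 : ℂ)) (0, τ) :=
      (Complex.ofRealCLM.analyticAt _).comp analyticAt_snd
    have a3 : AnalyticAt ℝ Complex.exp ((τ : ℂ) * Complex.I) :=
      (analyticAt_cexp (z := (τ : ℂ) * Complex.I)).restrictScalars
    exact a1.mul (a3.comp (f := fun p : ℝ × ℝ => (p.2 : ℂ) * Complex.I) (a2.mul analyticAt_const))
  have h1 : AnalyticAt ℝ T.F (((Real.exp 0 : ℝ) : ℂ) * Complex.exp (τ * Complex.I)) := by
    simpa using (T.F_analyticAt h).restrictScalars (𝕜 := ℝ)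
  have h3 := (Complex.reCLM.analyticAt _).comp (h1.comp (f := fun p : ℝ × ℝ =>
    ((Real.exp p.1 : ℝ) : ℂ) * Complex.exp (p.2 * Complex.I)) h2)
  refine h3.congr (Eventually.of_forall fun p => ?_)
  simp [cylPotential, F_re]

/-- Put G = yF', so F = JG with G ≠ 0. A vanishing angular derivative makes G real; then U = Re J ·
G, which is nonzero because Re J > 0 on the circle away from the poles. -/
lemma exists_hasDerivAt_cylPotential {τ : ℝ}
    (hP : T.P (Complex.exp (τ * Complex.I) ^ 2) ≠ 0) (hU : T.U (Complex.exp (τ * Complex.I)) = 0) :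
    ∃ d, d ≠ 0 ∧ HasDerivAt (fun θ => T.cylPotential (0, θ)) d τ := by
  set y := Complex.exp (τ * Complex.I) with hy
  have hn : ‖y‖ = 1 := Complex.norm_exp_ofReal_mul_I τ
  have hr : T.Regular y := T.regular_of_norm_le hn.le hP
  have hF := (T.hasDerivAt_F hr).comp τ (hasDerivAt_exp_mul_I τ)
  have hre : HasDerivAt (fun θ : ℝ => (T.F (Complex.exp (θ * Complex.I))).re)
      (T.C * y ^ 2 / T.P (y ^ 2) * (Complex.I * y)).re τ :=
    Complex.reCLM.hasFDerivAt.comp_hasDerivAt τ hF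
  refine ⟨_, ?_, hre.congr_of_eventuallyEq (Eventually.of_forall fun θ => ?_)⟩
  · intro h0
    have hy0 : y ≠ 0 := Complex.exp_ne_zero _
    have hC := T.C_ne_zero
    set G := T.C * y ^ 2 / T.P (y ^ 2) * y with hG
    have hG0 : G ≠ 0 := by rw [hG]; positivity
    have hJ : T.F y = T.J y * G := by
      simp only [J, hy0, if_false, hG]; field_simp
    have him : G.im = 0 := by
      have e : T.C * y ^ 2 / T.P (y ^ 2) * (Complex.I * y) = Complex.I * G := by rw [hG]; ring
      rw [e, Complex.I_mul_re] at h0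
      linarith
    have hre0 : (T.J y).re * G.re = 0 := by
      have := congrArg Complex.re hJ
      rw [F_re, hU, Complex.mul_re, him] at this
      linarith
    rcases mul_eq_zero.1 hre0 with h | h
    · exact (T.J_re_pos_of_norm_eq_one hn hP).ne' h
    · exact hG0 (Complex.ext h him)
  · simp [cylPotential, F_re]

/-- Near a zero `exp (i τ)` of the potential on the unit circle, the zero set is the graph of an
even analytic function `ψ` of the logarithm of the modulus, which continues the level curve
with index `j` in the unit disc. -/
def Continues (τ : ℝ) (j : ℤ) (ψ : ℝ → ℝ) : Prop :=
  AnalyticAt ℝ ψ 0 ∧ ψ 0 = τ ∧ (∀ᶠ x in 𝓝 (0 : ℝ), ψ (-x) = ψ x) ∧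
    ∀ᶠ x in 𝓝 (0 : ℝ), x < 0 → 2 * ψ x = T.angle j (Real.exp (2 * x))

lemma abs_exp_lt_one {x : ℝ} (hx : x < 0) : |Real.exp x| < 1 := by
  rw [Real.abs_exp]; exact Real.exp_lt_one_iff.2 hx

lemma cylPotential_eq_zero_iff {x θ : ℝ} (hx : x < 0) :
    T.cylPotential (x, θ) = 0 ↔ ∃ j : ℤ, 2 * θ = T.angle j (Real.exp (2 * x)) := by
  unfold cylPotential
  rw [T.U_polar_eq_zero_iff (Real.exp_pos x) ((Real.exp_lt_one_iff.2 hx)), ← Real.exp_nat_mul]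
  norm_num

/-- The implicit function theorem gives the graph, and the reflection x ↦ -x of the cylinder makes
it even. For x < 0 each of its points lies on some inner level curve. -/
lemma exists_continues {τ : ℝ} (hP : T.P (Complex.exp (τ * Complex.I) ^ 2) ≠ 0)
    (hU : T.U (Complex.exp (τ * Complex.I)) = 0) : ∃ j ψ, T.Continues τ j ψ := by
  have hn : ‖Complex.exp (τ * Complex.I)‖ = 1 := Complex.norm_exp_ofReal_mul_I τ
  obtain ⟨d, hd0, hd⟩ := T.exists_hasDerivAt_cylPotential hP hU
  have hU0 : T.cylPotential (0, τ) = 0 := by simpa [cylPotential] using hU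
  obtain ⟨ψ, h1, h2, h3, h4⟩ := exists_analytic_implicit (u := (0, τ))
    (T.analyticAt_cylPotential (T.regular_of_norm_le hn.le hP)) hd hd0
  simp only [hU0] at h1 h2 h3 h4
  have heven : ∀ᶠ x in 𝓝 (0 : ℝ), ψ (-x) = ψ x := by
    have ht : Tendsto (fun x : ℝ => (x, ψ (-x))) (𝓝 0) (𝓝 (0, τ)) := by
      refine tendsto_id.prodMk_nhds ?_
      have hneg : Tendsto (fun x : ℝ => -x) (𝓝 0) (𝓝 0) := by
        simpa using (continuous_neg (G := ℝ)).tendsto 0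
      have := h1.continuousAt.tendsto.comp hneg
      rwa [h2] at this
    have hneg : Tendsto (fun x : ℝ => -x) (𝓝 0) (𝓝 0) := by
      simpa using (continuous_neg (G := ℝ)).tendsto 0
    filter_upwards [ht.eventually h4, hneg.eventually h3] with x hx hx'
    rw [← T.cylPotential_neg] at hx
    exact (hx.1 hx').symm
  obtain ⟨δ, hδ, hb⟩ := Metric.eventually_nhds_iff.1 (h3.and h1.eventually_analyticAt)
  have hmem : ∀ x ∈ Ioo (-δ) 0, T.cylPotential (x, ψ x) = 0 ∧ AnalyticAt ℝ ψ x := fun x hx =>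
    hb (by rw [Real.dist_eq, sub_zero, abs_of_neg hx.2]; linarith [hx.1])
  have hex : ∀ x ∈ Ioo (-δ) 0, ∃ j : ℤ, 2 * ψ x = T.angle j (Real.exp (2 * x)) := fun x hx =>
    (T.cylPotential_eq_zero_iff hx.2).1 (hmem x hx).1
  have habs : ∀ x ∈ Ioo (-δ) 0, |Real.exp (2 * x)| < 1 := fun x hx =>
    abs_exp_lt_one (by linarith [hx.2])
  -- `N` recovers the index of the level curve from the argument of `F`. It is continuous and
  -- integer-valued on an interval, hence constant.
  set N : ℝ → ℝ := fun x => (T.Λ (Real.exp (2 * x), 2 * ψ x) - Real.pi / 2) / Real.pi with hN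
  have hNj : ∀ x ∈ Ioo (-δ) 0, ∀ j : ℤ, 2 * ψ x = T.angle j (Real.exp (2 * x)) → N x = j := by
    intro x hx j hj
    simp only [hN]
    rw [hj, T.Λ_angle _ (habs x hx)]
    field_simp [Real.pi_ne_zero]
    ring
  have hNc : ContinuousOn N (Ioo (-δ) 0) := by
    intro x hx
    have c1 : ContinuousAt T.Λ (Real.exp (2 * x), 2 * ψ x) :=
      (T.analyticAt_Λ (habs x hx)).continuousAt
    have c2 : ContinuousAt (fun x => (Real.exp (2 * x), 2 * ψ x)) x :=
      ContinuousAt.prodMk (by fun_prop) (continuousAt_const.mul (hmem x hx).2.continuousAt)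
    exact (((c1.comp (f := fun x => (Real.exp (2 * x), 2 * ψ x)) c2).sub
      continuousAt_const).div_const _).continuousWithinAt
  have hm : -δ / 2 ∈ Ioo (-δ) 0 := by constructor <;> linarith
  obtain ⟨j, hj⟩ := hex _ hm
  refine ⟨j, ψ, h1, h2, heven, ?_⟩
  filter_upwards [Ioi_mem_nhds (show -δ < 0 by linarith)] with x hx hx0
  obtain ⟨i, hi⟩ := hex x ⟨hx, hx0⟩
  have hconst := isPreconnected_Ioo.constant_of_mapsTo
    (Int.isClosedEmbedding_coe_real.isInducing.isDiscrete_range) hNc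
    (fun x hx => by obtain ⟨i, hi⟩ := hex x hx; exact ⟨i, (hNj x hx i hi).symm⟩)
    (x := x) (y := -δ / 2) ⟨hx, hx0⟩ hm
  rw [hNj x ⟨hx, hx0⟩ i hi, hNj _ hm j hj] at hconst
  rw [hi, Int.cast_injective hconst]

variable {T}

/-- The order of two zeros on the circle persists on nearby smaller circles, where the angles are
ordered by index. -/
lemma Continues.index_lt {τ τ' : ℝ} {j j' : ℤ} {ψ ψ' : ℝ → ℝ} (h : T.Continues τ j ψ)
    (h' : T.Continues τ' j' ψ') (hτ : τ < τ') : j < j' := by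
  have e : ∀ᶠ x in 𝓝 (0 : ℝ), ψ x < ψ' x :=
    h.1.continuousAt.eventually_lt h'.1.continuousAt (by rw [h.2.1, h'.2.1]; exact hτ)
  obtain ⟨x, ⟨h1, h2, h3⟩, hx : x < 0⟩ :=
    ((e.and (h.2.2.2.and h'.2.2.2)).filter_mono nhdsWithin_le_nhds |>.and
      (self_mem_nhdsWithin : Iio (0 : ℝ) ∈ 𝓝[<] (0 : ℝ))).exists
  rw [← T.angle_lt_angle (r := Real.exp (2 * x)) (abs_exp_lt_one (by linarith)), ← h2 hx, ← h3 hx]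
  linarith

lemma Continues.add_pi {τ : ℝ} {j : ℤ} {ψ : ℝ → ℝ} (h : T.Continues τ j ψ) (N : ℤ) :
    T.Continues (τ + N * Real.pi) (j + 3 * N) (fun x => ψ x + N * Real.pi) := by
  refine ⟨h.1.add analyticAt_const, by simp [h.2.1], ?_, ?_⟩
  · filter_upwards [h.2.2.1] with x hx
    rw [hx]
  · filter_upwards [h.2.2.2] with x hx hx0
    rw [T.angle_add_mul _ _ (abs_exp_lt_one (by linarith)), ← hx hx0]
    ring

lemma Continues.eq_of_index_eq {τ τ' : ℝ} {j : ℤ} {ψ ψ' : ℝ → ℝ} (h : T.Continues τ j ψ)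
    (h' : T.Continues τ' j ψ') : τ = τ' := by
  rcases lt_trichotomy τ τ' with hlt | heq | hlt
  · exact absurd (h.index_lt h' hlt) (lt_irrefl _)
  · exact heq
  · exact absurd (h'.index_lt h hlt) (lt_irrefl _)

/-! ### Gluing inner and outer curves into three complete graphs -/

variable (T)

/-- The angle along the arc that continues the level curve with index `j` through the point
`exp (2 i τ)` of the unit circle; the parameter `t` stands for the modulus `t / (1 - t)`. -/
def arcAngle (j : ℤ) (τ t : ℝ) : ℝ :=
  if t < 1 / 2 then T.angle j (t / (1 - t)) else if t = 1 / 2 then 2 * τ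
  else T.angle j ((1 - t) / t)

variable {T}

lemma arcAngle_of_lt {j : ℤ} {τ t : ℝ} (h : t < 1 / 2) :
    T.arcAngle j τ t = T.angle j (t / (1 - t)) := by rw [arcAngle, if_pos h]

lemma arcAngle_of_gt {j : ℤ} {τ t : ℝ} (h : 1 / 2 < t) :
    T.arcAngle j τ t = T.angle j ((1 - t) / t) := by
  rw [arcAngle, if_neg (by linarith), if_neg h.ne']

lemma arcAngle_half (j : ℤ) (τ : ℝ) : T.arcAngle j τ (1 / 2) = 2 * τ := by
  rw [arcAngle, if_neg (lt_irrefl _), if_pos rfl]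

lemma abs_ratio_lt_one {t : ℝ} (h : t < 1 / 2) : |t / (1 - t)| < 1 := by
  have h1 : 0 < 1 - t := by linarith
  rw [abs_div, abs_of_pos h1, div_lt_one h1, abs_lt]
  constructor <;> linarith

lemma abs_ratio_lt_one' {t : ℝ} (h : 1 / 2 < t) : |(1 - t) / t| < 1 := by
  have h1 : 0 < t := by linarith
  rw [abs_div, abs_of_pos h1, div_lt_one h1, abs_lt]
  constructor <;> linarith

/-- Only t = 1/2 needs an argument. With X half the logarithm of t/(1 - t), both formulas equal
2ψ(X) nearby: directly where X < 0, and by evenness of ψ where X > 0. -/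
lemma Continues.analyticAt_arcAngle {τ : ℝ} {j : ℤ} {ψ : ℝ → ℝ} (h : T.Continues τ j ψ) (t : ℝ) :
    AnalyticAt ℝ (T.arcAngle j τ) t := by
  rcases lt_trichotomy t (1 / 2) with ht | ht | ht
  · have h1 : AnalyticAt ℝ (fun t : ℝ => t / (1 - t)) t :=
      analyticAt_id.div (analyticAt_const.sub analyticAt_id) (by simp; linarith)
    have h2 := (T.analyticAt_angle j (abs_ratio_lt_one ht)).comp (f := fun t : ℝ => t / (1 - t)) h1
    refine h2.congr ?_
    filter_upwards [Iio_mem_nhds ht] with s hs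
    exact (arcAngle_of_lt hs).symm
  · subst ht
    set X : ℝ → ℝ := fun t => Real.log (t / (1 - t)) / 2 with hX
    have hX0 : X (1 / 2) = 0 := by norm_num [hX]
    have h1 : AnalyticAt ℝ X (1 / 2) := by
      have a1 : AnalyticAt ℝ (fun t : ℝ => t / (1 - t)) (1 / 2) :=
        analyticAt_id.div (analyticAt_const.sub analyticAt_id) (by norm_num)
      exact (a1.log (by norm_num)).div_const
    have h2 : AnalyticAt ℝ (fun t => 2 * ψ (X t)) (1 / 2) := by
      refine analyticAt_const.mul (AnalyticAt.comp (g := ψ) (f := X) ?_ h1)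
      rw [hX0]; exact h.1
    have hXt : Tendsto X (𝓝 (1 / 2)) (𝓝 0) := by
      have := h1.continuousAt.tendsto
      rwa [hX0] at this
    have hXt' : Tendsto (fun t => -X t) (𝓝 (1 / 2)) (𝓝 0) := by simpa using hXt.neg
    refine h2.congr ?_
    filter_upwards [hXt.eventually h.2.2.1, hXt.eventually h.2.2.2, hXt'.eventually h.2.2.2,
      Ioo_mem_nhds (show (0 : ℝ) < 1 / 2 by norm_num) (show (1 / 2 : ℝ) < 1 by norm_num)]
      with t e1 e2 e3 ht
    have hpos : 0 < t / (1 - t) := div_pos ht.1 (by linarith [ht.2])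
    rcases lt_trichotomy t (1 / 2) with hlt | heq | hgt
    · have hneg : X t < 0 := by
        have : Real.log (t / (1 - t)) < 0 :=
          Real.log_neg hpos (by rw [div_lt_one] <;> linarith)
        simp only [hX]; linarith
      rw [arcAngle_of_lt hlt, e2 hneg]
      congr 1
      simp only [hX]
      rw [mul_div_cancel₀ _ two_ne_zero, Real.exp_log hpos]
    · rw [heq, hX0, h.2.1, arcAngle_half]
    · have hneg : -X t < 0 := by
        have : 0 < Real.log (t / (1 - t)) :=
          Real.log_pos (by rw [lt_div_iff₀] <;> linarith [ht.2])
        simp only [hX]; linarith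
      rw [arcAngle_of_gt hgt, ← e1, e3 hneg]
      congr 1
      simp only [hX]
      rw [mul_neg, mul_div_cancel₀ _ two_ne_zero, Real.exp_neg, Real.exp_log hpos, inv_div]
  · have h1 : AnalyticAt ℝ (fun t : ℝ => (1 - t) / t) t :=
      (analyticAt_const.sub analyticAt_id).div analyticAt_id (by simp; linarith)
    have h2 := (T.analyticAt_angle j (abs_ratio_lt_one' ht)).comp
      (f := fun t : ℝ => (1 - t) / t) h1
    refine h2.congr ?_
    filter_upwards [Ioi_mem_nhds ht] with s hs
    exact (arcAngle_of_gt hs).symm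

lemma U_eq_zero_iff_of_lt {t θ : ℝ} (h0 : 0 < t) (h : t < 1 / 2) :
    T.U ((√(t / (1 - t)) : ℝ) * Complex.exp (θ * Complex.I)) = 0 ↔
      ∃ j : ℤ, 2 * θ = T.angle j (t / (1 - t)) := by
  have hpos : 0 < t / (1 - t) := div_pos h0 (by linarith)
  rw [T.U_polar_eq_zero_iff (Real.sqrt_pos.2 hpos), Real.sq_sqrt hpos.le]
  rw [Real.sqrt_lt' one_pos, one_pow, div_lt_one] <;> linarith

lemma U_eq_zero_iff_of_gt {t θ : ℝ} (h : 1 / 2 < t) (h1 : t < 1) :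
    T.U ((√(t / (1 - t)) : ℝ) * Complex.exp (θ * Complex.I)) = 0 ↔
      ∃ j : ℤ, 2 * θ = T.angle j ((1 - t) / t) := by
  have hpos : 0 < t / (1 - t) := div_pos (by linarith) (by linarith)
  rw [← T.U_inv_modulus (Real.sqrt_pos.2 hpos), ← Real.sqrt_inv, inv_div]
  have := U_eq_zero_iff_of_lt (T := T) (t := 1 - t) (θ := θ) (by linarith) (by linarith)
  rwa [sub_sub_cancel] at this

lemma exists_index_mod_three (j₀ j : ℤ) : ∃ (i : Fin 3) (N : ℤ), j = (j₀ + (i : ℕ)) + 3 * N := by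
  refine ⟨⟨((j - j₀) % 3).toNat, by omega⟩, (j - j₀) / 3, ?_⟩
  simp only
  omega

lemma exp_add_int_mul (φ : ℝ) (N : ℤ) :
    Complex.exp (((φ + N * (2 * Real.pi) : ℝ) : ℂ) * Complex.I) = Complex.exp (φ * Complex.I) := by
  rw [Complex.exp_eq_exp_iff_exists_int]
  exact ⟨N, by push_cast; ring⟩

lemma exp_ne_exp_of_lt {φ φ' : ℝ} (h : φ < φ') (h' : φ' < φ + 2 * Real.pi) :
    Complex.exp (φ * Complex.I) ≠ Complex.exp (φ' * Complex.I) := by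
  intro he
  obtain ⟨N, hN⟩ := Complex.exp_eq_exp_iff_exists_int.1 he
  have hN' : φ = φ' + N * (2 * Real.pi) := by
    have := congrArg Complex.im hN
    simpa using this
  have hpi := Real.pi_pos
  have h1 : (N : ℝ) < 0 := by
    by_contra! hc
    nlinarith
  have h2 : (-1 : ℝ) < N := by
    by_contra! hc
    nlinarith
  have h3 : N < 0 := by exact_mod_cast h1
  have h4 : -1 < N := by exact_mod_cast h2
  omega

lemma angle_ne_of_ne {j₀ : ℤ} {r : ℝ} (hr : |r| < 1) {i k : Fin 3} (hik : i ≠ k) :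
    Complex.exp (T.angle (j₀ + (i : ℕ)) r * Complex.I) ≠
      Complex.exp (T.angle (j₀ + (k : ℕ)) r * Complex.I) := by
  wlog hlt : i < k generalizing i k
  · exact (this hik.symm (lt_of_le_of_ne (not_lt.1 hlt) hik.symm)).symm
  have hlt' : (i : ℕ) < k := hlt
  have hk := k.2
  refine exp_ne_exp_of_lt ((T.angle_lt_angle hr).2 (by omega)) ?_
  have h3 := T.angle_add_mul (j₀ + (i : ℕ)) 1 hr
  rw [Int.cast_one, one_mul] at h3
  rw [← h3]
  exact (T.angle_lt_angle hr).2 (by omega)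

variable (T)

/-- The zero set of the potential consists of three radial graphs of analytic angle functions. -/
theorem exists_arcAngles {τ : Fin 3 → ℝ} (h01 : τ 0 < τ 1) (h12 : τ 1 < τ 2)
    (h20 : τ 2 < τ 0 + Real.pi) (hP : ∀ i, T.P (Complex.exp (τ i * Complex.I) ^ 2) ≠ 0)
    (hU : ∀ i, T.U (Complex.exp (τ i * Complex.I)) = 0) :
    ∃ Φ : Fin 3 → ℝ → ℝ, (∀ i t, AnalyticAt ℝ (Φ i) t) ∧ (∀ i, Φ i (1 / 2) = 2 * τ i) ∧
      (∀ i, ∀ t ∈ Ioo (0 : ℝ) 1,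
        T.U ((√(t / (1 - t)) : ℝ) * Complex.exp ((Φ i t / 2 : ℝ) * Complex.I)) = 0) ∧
      (∀ i, ∀ t ∈ Ioo (0 : ℝ) 1,
        T.P ((t / (1 - t) : ℝ) * Complex.exp (Φ i t * Complex.I)) ≠ 0) ∧
      (∀ t ∈ Ioo (0 : ℝ) 1, ∀ θ : ℝ,
        T.P ((t / (1 - t) : ℝ) * Complex.exp ((2 * θ : ℝ) * Complex.I)) ≠ 0 →
        T.U ((√(t / (1 - t)) : ℝ) * Complex.exp (θ * Complex.I)) = 0 →
        ∃ i, Complex.exp ((2 * θ : ℝ) * Complex.I) = Complex.exp (Φ i t * Complex.I)) ∧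
      ∀ t ∈ Ioo (0 : ℝ) 1, ∀ i k, i ≠ k →
        Complex.exp (Φ i t * Complex.I) ≠ Complex.exp (Φ k t * Complex.I) := by
  have hsq : ∀ θ : ℝ, Complex.exp (θ * Complex.I) ^ 2 = Complex.exp ((2 * θ : ℝ) * Complex.I) :=
    fun θ => by rw [← Complex.exp_nat_mul]; push_cast; ring_nf
  have hhalf : ((1 / 2 : ℝ) / (1 - 1 / 2)) = 1 := by norm_num
  choose j ψ hc using fun i => T.exists_continues (hP i) (hU i)
  have l1 := (hc 0).index_lt (hc 1) h01
  have l2 := (hc 1).index_lt (hc 2) h12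
  have l3 := (hc 2).index_lt ((hc 0).add_pi 1) (by simpa using h20)
  -- Three strictly increasing integers below j₀ + 3 must be consecutive, so they exhaust the
  -- residues modulo 3.
  have hj : ∀ i : Fin 3, j i = j 0 + (i : ℕ) := by
    intro i
    fin_cases i <;> simp <;> omega
  refine ⟨fun i => T.arcAngle (j i) (τ i), fun i t => (hc i).analyticAt_arcAngle t,
    fun i => arcAngle_half _ _, ?_, ?_, ?_, ?_⟩
  · intro i t ht
    beta_reduce
    rcases lt_trichotomy t (1 / 2) with h | h | h
    · rw [U_eq_zero_iff_of_lt ht.1 h]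
      exact ⟨j i, by rw [arcAngle_of_lt h]; ring⟩
    · subst h
      rw [arcAngle_half, hhalf]
      simpa using hU i
    · rw [U_eq_zero_iff_of_gt h ht.2]
      exact ⟨j i, by rw [arcAngle_of_gt h]; ring⟩
  · intro i t ht
    beta_reduce
    by_cases h : t = 1 / 2
    · subst h
      rw [arcAngle_half, hhalf, ← hsq]
      simpa using hP i
    · refine T.P_ne_zero_of_norm_ne_one ?_
      rw [norm_polar, abs_of_pos (div_pos ht.1 (by linarith [ht.2])), ne_eq, div_eq_one_iff_eq
        (by linarith [ht.2])]
      intro h'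
      exact h (by linarith)
  · intro t ht θ hPθ hUθ
    beta_reduce
    rcases lt_trichotomy t (1 / 2) with h | h | h
    · obtain ⟨m, hm⟩ := (U_eq_zero_iff_of_lt ht.1 h).1 hUθ
      obtain ⟨i, N, hi⟩ := exists_index_mod_three (j 0) m
      refine ⟨i, ?_⟩
      rw [arcAngle_of_lt h, hm, hi, ← hj, T.angle_add_mul _ _ (abs_ratio_lt_one h),
        exp_add_int_mul]
    · subst h
      rw [hhalf] at hPθ hUθ
      -- Any further zero on the circle also continues an inner curve. Its index is that of one of
      -- the three up to a multiple of 3, so it is a translate of the corresponding zero.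
      obtain ⟨m, χ, hχ⟩ := T.exists_continues (τ := θ) (by rw [hsq]; simpa using hPθ)
        (by simpa using hUθ)
      obtain ⟨i, N, hi⟩ := exists_index_mod_three (j 0) m
      rw [← hj] at hi
      subst hi
      refine ⟨i, ?_⟩
      rw [arcAngle_half, hχ.eq_of_index_eq ((hc i).add_pi N), ← exp_add_int_mul (2 * τ i) N]
      congr 3
      ring
    · obtain ⟨m, hm⟩ := (U_eq_zero_iff_of_gt h ht.2).1 hUθ
      obtain ⟨i, N, hi⟩ := exists_index_mod_three (j 0) m
      refine ⟨i, ?_⟩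
      rw [arcAngle_of_gt h, hm, hi, ← hj, T.angle_add_mul _ _ (abs_ratio_lt_one' h),
        exp_add_int_mul]
  · intro t ht i k hik
    beta_reduce
    rcases lt_trichotomy t (1 / 2) with h | h | h
    · rw [arcAngle_of_lt h, arcAngle_of_lt h, hj i, hj k]
      exact angle_ne_of_ne (abs_ratio_lt_one h) hik
    · subst h
      rw [arcAngle_half, arcAngle_half]
      wlog hlt : i < k generalizing i k
      · exact (this k i hik.symm (lt_of_le_of_ne (not_lt.1 hlt) hik.symm)).symm
      have h0 : τ 0 ≤ τ i := by fin_cases i <;> simp <;> linarith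
      have h2 : τ k ≤ τ 2 := by fin_cases k <;> simp <;> linarith
      have h3 : τ i < τ k := by
        fin_cases i <;> fin_cases k <;> simp at hlt ⊢ <;> linarith
      exact exp_ne_exp_of_lt (by linarith) (by linarith)
    · rw [arcAngle_of_gt h, arcAngle_of_gt h, hj i, hj k]
      exact angle_ne_of_ne (abs_ratio_lt_one' h) hik

end ClosedTriangle

/-! ### The Riemann surface of the square root and its triangle -/

/-- The parameters `a = A + 1`, `b = B + 1` and `S = √(a b (1 - a - b))`. -/
structure Params where
  a : ℝ
  b : ℝ
  S : ℝ
  a_pos : 0 < a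
  b_pos : 0 < b
  add_lt : a + b < 1
  S_pos : 0 < S
  S_sq : S ^ 2 = a * b * (1 - a - b)

namespace Params

variable (D : Params)

lemma S_sq_coe : (D.S : ℂ) ^ 2 = D.a * D.b * (1 - D.a - D.b) := by exact_mod_cast D.S_sq

lemma IS_sq : (Complex.I * D.S) ^ 2 = -(D.a * D.b * (1 - D.a - D.b)) := by
  rw [mul_pow, Complex.I_sq, D.S_sq_coe]; ring

lemma ofReal_add_I_mul_ne {x : ℝ} (hx : 0 < x) (y : ℝ) : (x : ℂ) + Complex.I * y ≠ 0 := by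
  intro h; have := congrArg Complex.re h; simp at this; linarith

lemma ofReal_sub_I_mul_ne {x : ℝ} (hx : 0 < x) (y : ℝ) : (x : ℂ) - Complex.I * y ≠ 0 := by
  intro h; have := congrArg Complex.re h; simp at this; linarith

lemma norm_conj_div {x : ℝ} (hx : 0 < x) (y : ℝ) :
    ‖((x : ℂ) + Complex.I * y) / (x - Complex.I * y)‖ = 1 := by
  have : (starRingEnd ℂ) ((x : ℂ) - Complex.I * y) = x + Complex.I * y := by
    simp
  rw [norm_div, ← this, Complex.norm_conj]
  exact div_self (norm_ne_zero_iff.2 (ofReal_sub_I_mul_ne hx y))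

lemma sum_dir : ((D.a + D.b : ℝ) : ℂ) * 1
    + ((1 - D.a : ℝ) : ℂ) * -((D.b + Complex.I * D.S) / (D.b - Complex.I * D.S))
    + ((1 - D.b : ℝ) : ℂ) * -((D.a - Complex.I * D.S) / (D.a + Complex.I * D.S)) = 0 := by
  have h1 := ofReal_sub_I_mul_ne D.b_pos D.S
  have h2 := ofReal_add_I_mul_ne D.a_pos D.S
  have hS := D.IS_sq
  push_cast
  generalize Complex.I * (D.S : ℂ) = J at *
  field_simp
  linear_combination -2 * hS

lemma cube_dir : 2 * (((D.a + D.b : ℝ) : ℂ) * 1 ^ 3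
    + ((1 - D.a : ℝ) : ℂ) * (-((D.b + Complex.I * D.S) / (D.b - Complex.I * D.S))) ^ 3
    + ((1 - D.b : ℝ) : ℂ) * (-((D.a - Complex.I * D.S) / (D.a + Complex.I * D.S))) ^ 3) =
    ((32 * D.a * D.b * (1 - D.a - D.b) / ((D.a + D.b) * (1 - D.a) * (1 - D.b)) : ℝ) : ℂ) *
    (1 * (-((D.b + Complex.I * D.S) / (D.b - Complex.I * D.S))) *
    (-((D.a - Complex.I * D.S) / (D.a + Complex.I * D.S)))) := by
  have h1 := ofReal_sub_I_mul_ne D.b_pos D.S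
  have h2 := ofReal_add_I_mul_ne D.a_pos D.S
  have hS := D.IS_sq
  have p1 := D.a_pos
  have p2 := D.b_pos
  have p3 := D.add_lt
  have h3 : (D.a : ℂ) + D.b ≠ 0 := by exact_mod_cast (by linarith : D.a + D.b ≠ 0)
  have h4 : (1 : ℂ) - D.a ≠ 0 := by exact_mod_cast (by linarith : 1 - D.a ≠ 0)
  have h5 : (1 : ℂ) - D.b ≠ 0 := by exact_mod_cast (by linarith : 1 - D.b ≠ 0)
  push_cast
  generalize Complex.I * (D.S : ℂ) = J at *
  generalize (D.a : ℂ) = a at *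
  generalize (D.b : ℂ) = b at *
  field_simp
  have e3 : J ^ 3 = -(a * b * (1 - a - b)) * J := by rw [← hS]; ring
  have e4 : J ^ 4 = (a * b * (1 - a - b)) ^ 2 := by rw [show J ^ 4 = (J ^ 2) ^ 2 by ring, hS]; ring
  have e5 : J ^ 5 = (a * b * (1 - a - b)) ^ 2 * J := by
    rw [show J ^ 5 = (J ^ 2) ^ 2 * J by ring, hS]; ring
  have e6 : J ^ 6 = -(a * b * (1 - a - b)) ^ 3 := by rw [show J ^ 6 = (J ^ 2) ^ 3 by ring, hS]; ring
  ring_nf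
  rw [hS, e3, e4, e5, e6]
  ring

/-- The triangle with sides `a + b`, `1 - a`, `1 - b`. -/
def tri : ClosedTriangle where
  l := ![D.a + D.b, 1 - D.a, 1 - D.b]
  n := ![1, -((D.b + Complex.I * D.S) / (D.b - Complex.I * D.S)),
    -((D.a - Complex.I * D.S) / (D.a + Complex.I * D.S))]
  κ := 32 * D.a * D.b * (1 - D.a - D.b) / ((D.a + D.b) * (1 - D.a) * (1 - D.b))
  l_pos := by
    have := D.a_pos
    have := D.b_pos
    have := D.add_lt
    intro k
    fin_cases k <;> simp <;> linarith
  norm_n := by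
    intro k
    have h1 := norm_conj_div D.b_pos D.S
    have h2 := norm_conj_div D.a_pos (-D.S)
    rw [Complex.ofReal_neg, mul_neg, sub_neg_eq_add, ← sub_eq_add_neg] at h2
    fin_cases k
    · simp
    · simpa using h1
    · simpa using h2
  sum_zero := by simpa [Fin.sum_univ_three] using D.sum_dir
  lt_zero := by
    have := D.add_lt
    simp; linarith
  lt_one := by
    have := D.a_pos
    simp; linarith
  lt_two := by
    have := D.b_pos
    simp; linarith
  κ_pos := by
    have h1 := D.a_pos
    have h2 := D.b_pos
    have h3 := D.add_lt
    have h4 : 0 < 1 - D.a - D.b := by linarith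
    have h5 : 0 < 1 - D.a := by linarith
    have h6 : 0 < 1 - D.b := by linarith
    positivity
  sum_cube := by simpa [Fin.sum_univ_three] using D.cube_dir

/-- The common real part of the branch points. -/
def p : ℝ := (D.b - D.a) * (D.a + D.b - 2) / (D.a + D.b) ^ 2

/-- The imaginary part of the upper branch point. -/
def q : ℝ := 4 * D.S / (D.a + D.b) ^ 2

lemma add_pos : 0 < D.a + D.b := by linarith [D.a_pos, D.b_pos]

lemma q_pos : 0 < D.q := div_pos (by linarith [D.S_pos]) (pow_pos D.add_pos 2)

lemma q_ne : (D.q : ℂ) ≠ 0 := by exact_mod_cast D.q_pos.ne'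

/-- The upper branch point. -/
def zp : ℂ := D.p + D.q * Complex.I

/-- The lower branch point. -/
def zm : ℂ := D.p - D.q * Complex.I

lemma zp_ne_zm : D.zp ≠ D.zm := by
  intro h
  have := congrArg Complex.im h
  simp [zp, zm] at this
  linarith [D.q_pos]

lemma sub_mul_sub (z : ℂ) : (z - D.zp) * (z - D.zm) = (z - D.p) ^ 2 + D.q ^ 2 := by
  rw [zp, zm]
  linear_combination -(D.q : ℂ) ^ 2 * Complex.I_sq

/-- The coordinate on the Riemann surface of the square root. -/
def lift (z s : ℂ) : ℂ := (z - D.p + s) / D.q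

variable {D}

/-- Since (z - p)² - s² = -q², exchanging the sheets is v ↦ -1/v. -/
lemma lift_mul_lift_neg {z s : ℂ} (h : s ^ 2 = (z - D.zp) * (z - D.zm)) :
    D.lift z s * D.lift z (-s) = -1 := by
  have := D.q_ne
  rw [D.sub_mul_sub] at h
  simp only [lift]
  field_simp
  linear_combination -h

lemma lift_ne_zero {z s : ℂ} (h : s ^ 2 = (z - D.zp) * (z - D.zm)) : D.lift z s ≠ 0 := by
  intro h0
  have := lift_mul_lift_neg h
  simp [h0] at this

lemma lift_neg {z s : ℂ} (h : s ^ 2 = (z - D.zp) * (z - D.zm)) :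
    D.lift z (-s) = -(D.lift z s)⁻¹ := by
  have h1 := lift_mul_lift_neg h
  have h0 := lift_ne_zero h
  field_simp
  linear_combination h1

lemma lift_quadratic {z s : ℂ} (h : s ^ 2 = (z - D.zp) * (z - D.zm)) :
    D.q * D.lift z s ^ 2 - 2 * (z - D.p) * D.lift z s - D.q = 0 := by
  have := D.q_ne
  rw [D.sub_mul_sub] at h
  simp only [lift]
  field_simp
  linear_combination h

variable (D)

/-- The real part of the primitive of the differential, as a function of the lift. -/
def V (v : ℂ) : ℝ := (D.a + D.b) * Real.log ‖v‖
  + (1 - D.a) * (Real.log ‖D.S * v - D.b‖ - Real.log ‖D.b * v + D.S‖)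
  + (1 - D.b) * (Real.log ‖D.S * v + D.a‖ - Real.log ‖D.a * v - D.S‖)

/-- The lift `v` is not over a pole of the differential. -/
structure NonPole (v : ℂ) : Prop where
  ne_zero : v ≠ 0
  ne₁ : D.S * v - D.b ≠ 0
  ne₂ : D.b * v + D.S ≠ 0
  ne₃ : D.S * v + D.a ≠ 0
  ne₄ : D.a * v - D.S ≠ 0

lemma p_eq : (D.p : ℂ) * (D.a + D.b) ^ 2 = (D.b - D.a) * (D.a + D.b - 2) := by
  have := D.add_pos.ne'
  have h : D.p * (D.a + D.b) ^ 2 = (D.b - D.a) * (D.a + D.b - 2) := by rw [p]; field_simp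
  exact_mod_cast h

lemma q_eq : (D.q : ℂ) * (D.a + D.b) ^ 2 = 4 * D.S := by
  have := D.add_pos.ne'
  have h : D.q * (D.a + D.b) ^ 2 = 4 * D.S := by rw [q]; field_simp
  exact_mod_cast h

lemma sum_ne : (D.a : ℂ) + D.b ≠ 0 := by exact_mod_cast D.add_pos.ne'
lemma a_ne : (D.a : ℂ) ≠ 0 := by exact_mod_cast D.a_pos.ne'
lemma b_ne : (D.b : ℂ) ≠ 0 := by exact_mod_cast D.b_pos.ne'

variable {D}

/-- The points over z = 1 are v = b/S and v = -S/b. This and `factor_neg_one` identify the zeros of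
the linear factors in `V` with the finite poles of the differential. -/
lemma factor_one {z v : ℂ} (h : D.q * v ^ 2 - 2 * (z - D.p) * v - D.q = 0) :
    2 * ((D.S * v - D.b) * (D.b * v + D.S)) = D.b * (D.a + D.b) ^ 2 * (v * (z - 1)) := by
  linear_combination (D.b * (D.a + D.b) ^ 2 / 2 : ℂ) * h + 2 * v * D.S_sq_coe
    - (D.b * (v ^ 2 - 1) / 2 : ℂ) * D.q_eq - D.b * v * D.p_eq

lemma factor_neg_one {z v : ℂ} (h : D.q * v ^ 2 - 2 * (z - D.p) * v - D.q = 0) :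
    2 * ((D.S * v + D.a) * (D.a * v - D.S)) = D.a * (D.a + D.b) ^ 2 * (v * (z + 1)) := by
  linear_combination (D.a * (D.a + D.b) ^ 2 / 2 : ℂ) * h - 2 * v * D.S_sq_coe
    - (D.a * (v ^ 2 - 1) / 2 : ℂ) * D.q_eq - D.a * v * D.p_eq

lemma nonPole_lift {z s : ℂ} (h : s ^ 2 = (z - D.zp) * (z - D.zm)) (h1 : z ≠ 1) (h2 : z ≠ -1) :
    D.NonPole (D.lift z s) := by
  have h0 := lift_ne_zero h
  have f1 := factor_one (lift_quadratic h)
  have f2 := factor_neg_one (lift_quadratic h)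
  have e1 : D.b * (D.a + D.b) ^ 2 * (D.lift z s * (z - 1)) ≠ 0 :=
    mul_ne_zero (mul_ne_zero D.b_ne (pow_ne_zero _ D.sum_ne)) (mul_ne_zero h0 (sub_ne_zero.2 h1))
  have e2 : D.a * (D.a + D.b) ^ 2 * (D.lift z s * (z + 1)) ≠ 0 :=
    mul_ne_zero (mul_ne_zero D.a_ne (pow_ne_zero _ D.sum_ne))
      (mul_ne_zero h0 (fun h => h2 (eq_neg_of_add_eq_zero_left h)))
  rw [← f1] at e1
  rw [← f2] at e2
  refine ⟨h0, ?_, ?_, ?_, ?_⟩ <;> intro h <;> simp [h] at e1 e2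

lemma ne_of_nonPole {z v : ℂ} (h : D.q * v ^ 2 - 2 * (z - D.p) * v - D.q = 0)
    (hv : D.NonPole v) : z ≠ 1 ∧ z ≠ -1 := by
  have f1 := factor_one h
  have f2 := factor_neg_one h
  constructor <;> rintro rfl
  · simp [hv.ne₁, hv.ne₂] at f1
  · simp [hv.ne₃, hv.ne₄] at f2

/-- Changing sheets changes the sign of the integrand, hence of `V`. The vanishing of `V` is thus a
condition on z alone. -/
lemma V_neg_inv {v : ℂ} (hv : D.NonPole v) : D.V (-v⁻¹) = -D.V v := by
  have h0 := norm_ne_zero_iff.2 hv.ne_zero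
  have e1 : D.S * (-v⁻¹) - D.b = -v⁻¹ * (D.b * v + D.S) := by
    have := hv.ne_zero; field_simp; ring
  have e2 : D.b * (-v⁻¹) + D.S = v⁻¹ * (D.S * v - D.b) := by
    have := hv.ne_zero; field_simp; ring
  have e3 : D.S * (-v⁻¹) + D.a = v⁻¹ * (D.a * v - D.S) := by
    have := hv.ne_zero; field_simp; ring
  have e4 : D.a * (-v⁻¹) - D.S = -v⁻¹ * (D.S * v + D.a) := by
    have := hv.ne_zero; field_simp; ring
  simp only [V, e1, e2, e3, e4]
  simp only [norm_mul, norm_neg, norm_inv]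
  rw [Real.log_mul (inv_ne_zero h0) (norm_ne_zero_iff.2 hv.ne₁),
    Real.log_mul (inv_ne_zero h0) (norm_ne_zero_iff.2 hv.ne₂),
    Real.log_mul (inv_ne_zero h0) (norm_ne_zero_iff.2 hv.ne₃),
    Real.log_mul (inv_ne_zero h0) (norm_ne_zero_iff.2 hv.ne₄), Real.log_inv]
  ring

lemma V_lift_neg {z s : ℂ} (h : s ^ 2 = (z - D.zp) * (z - D.zm)) (h1 : z ≠ 1) (h2 : z ≠ -1) :
    D.V (D.lift z (-s)) = -D.V (D.lift z s) := by
  rw [lift_neg h, V_neg_inv (nonPole_lift h h1 h2)]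

lemma V_lift_sq_eq {z s s' : ℂ} (h : s ^ 2 = (z - D.zp) * (z - D.zm))
    (h' : s' ^ 2 = (z - D.zp) * (z - D.zm)) (h1 : z ≠ 1) (h2 : z ≠ -1) :
    D.V (D.lift z s') ^ 2 = D.V (D.lift z s) ^ 2 := by
  rcases sq_eq_sq_iff_eq_or_eq_neg.1 (h'.trans h.symm) with rfl | rfl
  · rfl
  · rw [V_lift_neg h h1 h2, neg_sq]

/-- The points v = ±i lie over ζ±. That `V` vanishes at both fixes the constant of integration at ζ₋
and puts ζ₊ on the zero set. -/
lemma V_of_sq_eq_neg_one {v : ℂ} (hv : v ^ 2 = -1) : D.V v = 0 := by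
  have h0 : ‖v‖ = 1 := by
    have := congrArg norm hv
    rw [norm_pow, norm_neg, norm_one] at this
    exact (pow_eq_one_iff_of_nonneg (norm_nonneg v) two_ne_zero).1 this
  have e1 : D.S * v - D.b = v * (D.b * v + D.S) := by linear_combination -(D.b : ℂ) * hv
  have e2 : D.S * v + D.a = -v * (D.a * v - D.S) := by linear_combination (D.a : ℂ) * hv
  simp [V, e1, e2, h0]

lemma lift_zm : D.lift D.zm 0 = -Complex.I := by
  have := D.q_ne
  simp only [lift, zm]; field_simp; ring

lemma V_continuousAt {v : ℂ} (hv : D.NonPole v) : ContinuousAt D.V v := by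
  have h0 := norm_ne_zero_iff.2 hv.ne_zero
  have h1 := norm_ne_zero_iff.2 hv.ne₁
  have h2 := norm_ne_zero_iff.2 hv.ne₂
  have h3 := norm_ne_zero_iff.2 hv.ne₃
  have h4 := norm_ne_zero_iff.2 hv.ne₄
  have c0 : ContinuousAt (fun v : ℂ => Real.log ‖v‖) v := ContinuousAt.log (by fun_prop) h0
  have c1 : ContinuousAt (fun v : ℂ => Real.log ‖D.S * v - D.b‖) v :=
    ContinuousAt.log (by fun_prop) h1
  have c2 : ContinuousAt (fun v : ℂ => Real.log ‖D.b * v + D.S‖) v :=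
    ContinuousAt.log (by fun_prop) h2
  have c3 : ContinuousAt (fun v : ℂ => Real.log ‖D.S * v + D.a‖) v :=
    ContinuousAt.log (by fun_prop) h3
  have c4 : ContinuousAt (fun v : ℂ => Real.log ‖D.a * v - D.S‖) v :=
    ContinuousAt.log (by fun_prop) h4
  exact ((continuousAt_const.mul c0).add (continuousAt_const.mul (c1.sub c2))).add
    (continuousAt_const.mul (c3.sub c4))

/-- The two descriptions of the potential agree. -/
lemma V_eq_U {v : ℂ} (hv : D.NonPole v) (hi : v + Complex.I ≠ 0) :
    D.V v = D.tri.U ((v - Complex.I) / (v + Complex.I)) := by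
  have hb := ofReal_sub_I_mul_ne D.b_pos D.S
  have ha := ofReal_add_I_mul_ne D.a_pos D.S
  have e0 : 1 + 1 * ((v - Complex.I) / (v + Complex.I)) = 2 / (v + Complex.I) * v := by
    field_simp; ring
  have e0' : 1 - 1 * ((v - Complex.I) / (v + Complex.I)) = 2 / (v + Complex.I) * Complex.I := by
    field_simp; ring
  have e1 : 1 + -((D.b + Complex.I * D.S) / (D.b - Complex.I * D.S)) *
      ((v - Complex.I) / (v + Complex.I)) =
      2 / ((D.b - Complex.I * D.S) * (v + Complex.I)) * (-Complex.I * (D.S * v - D.b)) := by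
    field_simp; ring
  have e1' : 1 - -((D.b + Complex.I * D.S) / (D.b - Complex.I * D.S)) *
      ((v - Complex.I) / (v + Complex.I)) =
      2 / ((D.b - Complex.I * D.S) * (v + Complex.I)) * (D.b * v + D.S) := by
    field_simp; linear_combination -2 * (D.S : ℂ) * Complex.I_sq
  have e2 : 1 + -((D.a - Complex.I * D.S) / (D.a + Complex.I * D.S)) *
      ((v - Complex.I) / (v + Complex.I)) =
      2 / ((D.a + Complex.I * D.S) * (v + Complex.I)) * (Complex.I * (D.S * v + D.a)) := by
    field_simp; ring
  have e2' : 1 - -((D.a - Complex.I * D.S) / (D.a + Complex.I * D.S)) *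
      ((v - Complex.I) / (v + Complex.I)) =
      2 / ((D.a + Complex.I * D.S) * (v + Complex.I)) * (D.a * v - D.S) := by
    field_simp; linear_combination 2 * (D.S : ℂ) * Complex.I_sq
  have n0 : ‖2 / (v + Complex.I)‖ ≠ 0 := norm_ne_zero_iff.2 (div_ne_zero two_ne_zero hi)
  have n1 : ‖2 / ((D.b - Complex.I * D.S) * (v + Complex.I))‖ ≠ 0 :=
    norm_ne_zero_iff.2 (div_ne_zero two_ne_zero (mul_ne_zero hb hi))
  have n2 : ‖2 / ((D.a + Complex.I * D.S) * (v + Complex.I))‖ ≠ 0 :=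
    norm_ne_zero_iff.2 (div_ne_zero two_ne_zero (mul_ne_zero ha hi))
  have k0 := norm_ne_zero_iff.2 hv.ne_zero
  have k1 := norm_ne_zero_iff.2 hv.ne₁
  have k2 := norm_ne_zero_iff.2 hv.ne₂
  have k3 := norm_ne_zero_iff.2 hv.ne₃
  have k4 := norm_ne_zero_iff.2 hv.ne₄
  simp only [ClosedTriangle.U, Fin.sum_univ_three, tri, Matrix.cons_val_zero, Matrix.cons_val_one,
    Matrix.cons_val]
  rw [e0, e0', e1, e1', e2, e2']
  simp only [norm_mul, norm_neg, Complex.norm_I, one_mul]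
  rw [Real.log_mul n0 k0, Real.log_mul n0 one_ne_zero, Real.log_mul n1 k1,
    Real.log_mul n1 k2, Real.log_mul n2 k3, Real.log_mul n2 k4, V, Real.log_one]
  ring

lemma tri_P_ne_zero_iff {v : ℂ} (hi : v + Complex.I ≠ 0) :
    D.tri.P (((v - Complex.I) / (v + Complex.I)) ^ 2) ≠ 0 ↔ D.NonPole v := by
  have hb := ofReal_sub_I_mul_ne D.b_pos D.S
  have ha := ofReal_add_I_mul_ne D.a_pos D.S
  have e0 : 1 - 1 ^ 2 * ((v - Complex.I) / (v + Complex.I)) ^ 2 =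
      4 * Complex.I * v / (v + Complex.I) ^ 2 := by
    field_simp; ring
  have e1 : 1 - (-((D.b + Complex.I * D.S) / (D.b - Complex.I * D.S))) ^ 2 *
      ((v - Complex.I) / (v + Complex.I)) ^ 2 =
      -4 * Complex.I * (D.S * v - D.b) * (D.b * v + D.S) /
        ((D.b - Complex.I * D.S) * (v + Complex.I)) ^ 2 := by
    field_simp
    linear_combination (4 * D.S * Complex.I * (v * D.S - D.b) : ℂ) * Complex.I_sq
  have e2 : 1 - (-((D.a - Complex.I * D.S) / (D.a + Complex.I * D.S))) ^ 2 *
      ((v - Complex.I) / (v + Complex.I)) ^ 2 =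
      4 * Complex.I * (D.S * v + D.a) * (D.a * v - D.S) /
        ((D.a + Complex.I * D.S) * (v + Complex.I)) ^ 2 := by
    field_simp
    linear_combination (4 * D.S * Complex.I * (v * D.S + D.a) : ℂ) * Complex.I_sq
  simp only [ClosedTriangle.P, Fin.prod_univ_three, tri, Matrix.cons_val_zero, Matrix.cons_val_one,
    Matrix.cons_val]
  rw [e0, e1, e2]
  constructor
  · intro h
    refine ⟨?_, ?_, ?_, ?_, ?_⟩ <;> intro h0 <;> simp [h0] at h
  · rintro ⟨h0, h1, h2, h3, h4⟩
    simp [h0, h1, h2, h3, h4, hb, ha, hi]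

end Params

/-! ### The potential as the real part of the path integral -/

lemma hasDerivAt_log_norm {f : ℝ → ℂ} {f' : ℂ} {t : ℝ} (hf : HasDerivAt f f' t) (h0 : f t ≠ 0) :
    HasDerivAt (fun u => Real.log ‖f u‖) (f' / f t).re t := by
  have h1 := (hf.norm_sq.log (by positivity)).div_const 2
  have e : (f' / f t).re = 2 * inner ℝ (f t) f' / ‖f t‖ ^ 2 / 2 := by
    rw [Complex.div_re, Complex.inner, Complex.normSq_eq_norm_sq]
    simp
    ring
  rw [e]
  refine h1.congr_of_eventuallyEq (Eventually.of_forall fun u => ?_)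
  simp only [Real.log_pow]
  push_cast
  ring

/-- The slope of s is the slope of s² divided by s(u) + s(t), so a continuous root is differentiable
where it is nonzero. -/
lemma hasDerivAt_of_sq_eq {f s : ℝ → ℂ} {f' : ℂ} {t : ℝ} (hf : HasDerivAt f f' t)
    (hs : ContinuousAt s t) (hsq : ∀ᶠ u in 𝓝 t, s u ^ 2 = f u) (h0 : s t ≠ 0) :
    HasDerivAt s (f' / (2 * s t)) t := by
  rw [hasDerivAt_iff_tendsto_slope] at hf ⊢
  have hs' : Tendsto (fun u => s u + s t) (𝓝[≠] t) (𝓝 (2 * s t)) := by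
    rw [two_mul]
    exact (hs.tendsto.mono_left nhdsWithin_le_nhds).add_const _
  refine (hf.div hs' (mul_ne_zero two_ne_zero h0)).congr' ?_
  have hne : ∀ᶠ u in 𝓝[≠] t, s u + s t ≠ 0 :=
    hs'.eventually_ne (mul_ne_zero two_ne_zero h0)
  filter_upwards [hne, hsq.filter_mono nhdsWithin_le_nhds] with u hu hu2
  simp only [Pi.div_apply, slope_def_module, ← hu2, ← hsq.self_of_nhds, Complex.real_smul]
  field_simp
  ring

namespace Params

variable {D : Params}

/-- The left side is v times the derivative of the holomorphic primitive with real part `V`. As dv/v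
= dz/s, it turns that derivative into (a + b) times the integrand. -/
lemma log_deriv_identity {z s v : ℂ} (h : s ^ 2 = (z - D.zp) * (z - D.zm)) (hv : v = D.lift z s)
    (h1 : z ≠ 1) (h2 : z ≠ -1) :
    (D.a + D.b) + (1 - D.a) * (D.S * v / (D.S * v - D.b) - D.b * v / (D.b * v + D.S))
      + (1 - D.b) * (D.S * v / (D.S * v + D.a) - D.a * v / (D.a * v - D.S))
      = (D.a + D.b) * (s ^ 2 / (z ^ 2 - 1)) := by
  have hN := nonPole_lift h h1 h2
  have hq := lift_quadratic h
  rw [← hv] at hN hq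
  have f1 := factor_one hq
  have f2 := factor_neg_one hq
  have hz1 : z - 1 ≠ 0 := sub_ne_zero.2 h1
  have hz2 : z + 1 ≠ 0 := fun h => h2 (eq_neg_of_add_eq_zero_left h)
  have hz3 : z ^ 2 - 1 ≠ 0 := by
    rw [show z ^ 2 - 1 = (z - 1) * (z + 1) by ring]; exact mul_ne_zero hz1 hz2
  have hab := D.sum_ne
  have ha := D.a_ne
  have hb := D.b_ne
  have n0 := hN.ne_zero
  have n1 := hN.ne₁
  have n2 := hN.ne₂
  have n3 := hN.ne₃
  have n4 := hN.ne₄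
  have e1 : D.S * v / (D.S * v - D.b) - D.b * v / (D.b * v + D.S) =
      2 * (1 - D.a) / ((D.a + D.b) * (z - 1)) := by
    rw [div_sub_div _ _ n1 n2, div_eq_div_iff (mul_ne_zero n1 n2) (mul_ne_zero hab hz1)]
    linear_combination (v * (z - 1) * (D.a + D.b)) * D.S_sq_coe - (1 - D.a) * f1
  have e2 : D.S * v / (D.S * v + D.a) - D.a * v / (D.a * v - D.S) =
      -(2 * (1 - D.b)) / ((D.a + D.b) * (z + 1)) := by
    rw [div_sub_div _ _ n3 n4, div_eq_div_iff (mul_ne_zero n3 n4) (mul_ne_zero hab hz2)]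
    linear_combination (1 - D.b) * f2 - (v * (z + 1) * (D.a + D.b)) * D.S_sq_coe
  rw [e1, e2, h, D.sub_mul_sub]
  have hpq : (D.a + D.b : ℂ) ^ 2 * (D.p ^ 2 + D.q ^ 2) =
      -(D.a + D.b) ^ 2 + 2 * (1 - D.a) ^ 2 + 2 * (1 - D.b) ^ 2 := by
    have hp := D.p_eq
    have hq := D.q_eq
    refine mul_left_cancel₀ (pow_ne_zero 2 hab) ?_
    linear_combination (D.p * (D.a + D.b) ^ 2 + (D.b - D.a) * (D.a + D.b - 2) : ℂ) * hp
      + (D.q * (D.a + D.b) ^ 2 + 4 * D.S) * hq + 16 * D.S_sq_coe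
  field_simp
  linear_combination -(z ^ 2 - 1) * hpq + 2 * z * (z ^ 2 - 1) * D.p_eq

lemma hasDerivAt_V_lift {γ s : ℝ → ℂ} {γ' : ℂ} {t : ℝ} (hγ : HasDerivAt γ γ' t)
    (hs : ContinuousAt s t) (hsq : ∀ᶠ u in 𝓝 t, s u ^ 2 = (γ u - D.zp) * (γ u - D.zm))
    (h0 : s t ≠ 0) (h1 : γ t ≠ 1) (h2 : γ t ≠ -1) :
    HasDerivAt (fun u => D.V (D.lift (γ u) (s u)))
      ((D.a + D.b) * (s t / (γ t ^ 2 - 1) * γ').re) t := by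
  have hq := D.q_ne
  have hsq0 := hsq.self_of_nhds
  have hN := nonPole_lift hsq0 h1 h2
  have hid := log_deriv_identity hsq0 rfl h1 h2
  have hR : HasDerivAt (fun u => (γ u - D.zp) * (γ u - D.zm)) (2 * (γ t - D.p) * γ') t := by
    refine ((hγ.sub_const _).mul (hγ.sub_const _)).congr_deriv ?_
    rw [zp, zm]; ring
  have hs' := hasDerivAt_of_sq_eq hR hs hsq h0
  set v := D.lift (γ t) (s t) with hv
  have hl : HasDerivAt (fun u => D.lift (γ u) (s u)) (γ' * v / s t) t := by
    refine (((hγ.sub_const _).add hs').div_const _).congr_deriv ?_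
    rw [hv, lift]
    field_simp
    ring
  have d0 := (hasDerivAt_log_norm hl hN.ne_zero).const_mul (D.a + D.b)
  have d1 := hasDerivAt_log_norm ((hl.const_mul (D.S : ℂ)).sub_const (D.b : ℂ)) hN.ne₁
  have d2 := hasDerivAt_log_norm ((hl.const_mul (D.b : ℂ)).add_const (D.S : ℂ)) hN.ne₂
  have d3 := hasDerivAt_log_norm ((hl.const_mul (D.S : ℂ)).add_const (D.a : ℂ)) hN.ne₃
  have d4 := hasDerivAt_log_norm ((hl.const_mul (D.a : ℂ)).sub_const (D.S : ℂ)) hN.ne₄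
  refine ((d0.add ((d1.sub d2).const_mul (1 - D.a))).add
    ((d3.sub d4).const_mul (1 - D.b))).congr_deriv ?_
  have n0 := hN.ne_zero
  have key := congrArg (fun w : ℂ => (w * (γ' / s t)).re) hid
  have r1 : ((D.a + D.b) * (s t ^ 2 / (γ t ^ 2 - 1)) * (γ' / s t) : ℂ) =
      ((D.a + D.b : ℝ) : ℂ) * (s t / (γ t ^ 2 - 1) * γ') := by
    push_cast; field_simp
  beta_reduce at key
  rw [r1, Complex.re_ofReal_mul] at key
  rw [← key, ← hv]
  have r2 : (((D.a + D.b) + (1 - D.a) * (D.S * v / (D.S * v - D.b) - D.b * v / (D.b * v + D.S))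
      + (1 - D.b) * (D.S * v / (D.S * v + D.a) - D.a * v / (D.a * v - D.S))) * (γ' / s t) : ℂ) =
      ((D.a + D.b : ℝ) : ℂ) * (γ' * v / s t / v)
      + ((1 - D.a : ℝ) : ℂ) * (D.S * (γ' * v / s t) / (D.S * v - D.b)
        - D.b * (γ' * v / s t) / (D.b * v + D.S))
      + ((1 - D.b : ℝ) : ℂ) * (D.S * (γ' * v / s t) / (D.S * v + D.a)
        - D.a * (γ' * v / s t) / (D.a * v - D.S)) := by
    have e0 : γ' * v / s t / v = γ' / s t := by field_simp
    rw [e0]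
    push_cast
    ring
  rw [r2]
  simp only [Complex.add_re, Complex.re_ofReal_mul, Complex.sub_re]

lemma re_pathIntegral {A B : ℝ} (hp : zetaPlus A B = D.zp) (hm : zetaMinus A B = D.zm) {z : ℂ}
    {γ s : ℝ → ℂ} (h : IsPathWithBranch A B z γ s) :
    (D.a + D.b) * (pathIntegral γ s).re = D.V (D.lift z (s 1)) := by
  have hsq : ∀ t ∈ Icc (0 : ℝ) 1, s t ^ 2 = (γ t - D.zp) * (γ t - D.zm) := by
    intro t ht; rw [← hp, ← hm]; exact h.branch_sq t ht
  -- `γ` is C¹ only within the closed interval, so `deriv γ` is uncontrolled at 0 and 1. The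
  -- derivative within the interval is continuous and agrees with it inside.
  set g : ℝ → ℂ := fun t => s t / (γ t ^ 2 - 1) * derivWithin γ (Icc 0 1) t with hg
  have hpole : ∀ t ∈ Icc (0 : ℝ) 1, γ t ^ 2 - 1 ≠ 0 := by
    intro t ht h0
    have h1 := h.avoids_poles t ht
    rw [show γ t ^ 2 - 1 = (γ t - 1) * (γ t + 1) by ring, mul_eq_zero] at h0
    rcases h0 with h0 | h0
    · exact h1.1 (sub_eq_zero.1 h0)
    · exact h1.2 (eq_neg_of_add_eq_zero_left h0)
  have hgc : ContinuousOn g (Icc 0 1) :=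
    (h.branch_continuousOn.div ((h.contDiffOn.continuousOn.pow 2).sub continuousOn_const) hpole).mul
      (h.contDiffOn.continuousOn_derivWithin (uniqueDiffOn_Icc one_pos) le_rfl)
  have hgi : IntervalIntegrable g MeasureTheory.volume 0 1 := by
    apply ContinuousOn.intervalIntegrable
    rwa [uIcc_of_le zero_le_one]
  have hder : ∀ t ∈ Ioo (0 : ℝ) 1, derivWithin γ (Icc 0 1) t = deriv γ t := fun t ht =>
    derivWithin_of_mem_nhds (Icc_mem_nhds ht.1 ht.2)
  have hint : pathIntegral γ s = ∫ t in (0 : ℝ)..1, g t := by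
    refine intervalIntegral.integral_congr_ae ?_
    have : ∀ᵐ t : ℝ, t ≠ 1 := by
      simp [MeasureTheory.ae_iff]
    filter_upwards [this] with t ht1 ht
    rw [uIoc_of_le zero_le_one] at ht
    simp only [hg]
    rw [hder t ⟨ht.1, lt_of_le_of_ne ht.2 ht1⟩]
  have hcont : ContinuousOn (fun t => D.V (D.lift (γ t) (s t))) (Icc 0 1) := by
    intro t ht
    have hN := nonPole_lift (hsq t ht) (h.avoids_poles t ht).1 (h.avoids_poles t ht).2
    have hl : ContinuousWithinAt (fun t => D.lift (γ t) (s t)) (Icc 0 1) t := by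
      unfold lift
      exact (((h.contDiffOn.continuousOn t ht).sub continuousWithinAt_const).add
        (h.branch_continuousOn t ht)).div_const _
    exact (V_continuousAt hN).comp_continuousWithinAt (f := fun t => D.lift (γ t) (s t)) hl
  have hderiv : ∀ t ∈ Ioo (0 : ℝ) 1, HasDerivAt (fun t => D.V (D.lift (γ t) (s t)))
      ((D.a + D.b) * (g t).re) t := by
    intro t ht
    have htI := Ioo_subset_Icc_self ht
    have hn := Icc_mem_nhds ht.1 ht.2
    have hγ := ((h.contDiffOn.differentiableOn one_ne_zero t htI).differentiableAt hn).hasDerivAt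
    have hav := h.avoids_branchPoints t ht
    rw [hp, hm] at hav
    have h0 : s t ≠ 0 := by
      intro h0
      have := hsq t htI
      rw [h0, zero_pow two_ne_zero, eq_comm, mul_eq_zero, sub_eq_zero, sub_eq_zero] at this
      rcases this with h | h
      · exact hav.1 h
      · exact hav.2 h
    have := hasDerivAt_V_lift (D := D) hγ (h.branch_continuousOn.continuousAt hn)
      (by filter_upwards [hn] with u hu using hsq u hu) h0 (h.avoids_poles t htI).1
      (h.avoids_poles t htI).2
    simp only [hg]
    rwa [hder t ht]
  have hre : IntervalIntegrable (fun t => (g t).re) MeasureTheory.volume 0 1 := by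
    apply ContinuousOn.intervalIntegrable
    rw [uIcc_of_le zero_le_one]
    exact Complex.continuous_re.comp_continuousOn hgc
  have hF := intervalIntegral.integral_eq_sub_of_hasDerivAt_of_le zero_le_one hcont hderiv
    (hre.const_mul _)
  have hs0 : s 0 = 0 := by
    have := hsq 0 (by simp)
    rw [h.source, hm, sub_self, mul_zero] at this
    exact pow_eq_zero_iff two_ne_zero |>.1 this
  have hV0 : D.V (D.lift (γ 0) (s 0)) = 0 := by
    rw [h.source, hm, hs0, lift_zm]
    exact V_of_sq_eq_neg_one (by simp)
  rw [intervalIntegral.integral_const_mul, hV0, h.target, sub_zero] at hF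
  rw [← hF, hint]
  congr 1
  exact (Complex.reCLM.intervalIntegral_comp_comm hgi).symm

/-- The points over which the potential vanishes. -/
def zeroSet (D : Params) : Set ℂ :=
  {z | z ≠ 1 ∧ z ≠ -1 ∧ ∃ s, s ^ 2 = (z - D.zp) * (z - D.zm) ∧ D.V (D.lift z s) = 0}

lemma V_eq_zero_of_mem_zeroSet {z s : ℂ} (hz : z ∈ D.zeroSet)
    (hs : s ^ 2 = (z - D.zp) * (z - D.zm)) : D.V (D.lift z s) = 0 := by
  obtain ⟨h1, h2, s', hs', h⟩ := hz
  have := V_lift_sq_eq hs' hs h1 h2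
  rw [h, zero_pow two_ne_zero] at this
  exact pow_eq_zero_iff two_ne_zero |>.1 this

lemma re_pathIntegral_eq_zero_iff {A B : ℝ} (hp : zetaPlus A B = D.zp)
    (hm : zetaMinus A B = D.zm) {z : ℂ} {γ s : ℝ → ℂ} (h : IsPathWithBranch A B z γ s) :
    (pathIntegral γ s).re = 0 ↔ z ∈ D.zeroSet := by
  have h1 := re_pathIntegral hp hm h
  have hI : (1 : ℝ) ∈ Icc (0 : ℝ) 1 := by simp
  have hsq := h.branch_sq 1 hI
  have hpole := h.avoids_poles 1 hI
  rw [h.target] at hsq hpole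
  rw [hp, hm] at hsq
  constructor
  · intro h0
    rw [h0, mul_zero] at h1
    exact ⟨hpole.1, hpole.2, s 1, hsq, h1.symm⟩
  · intro hz
    rw [V_eq_zero_of_mem_zeroSet hz hsq] at h1
    exact (mul_eq_zero.1 h1).resolve_left D.add_pos.ne'

lemma mem_Gamma_iff {A B : ℝ} (hp : zetaPlus A B = D.zp) (hm : zetaMinus A B = D.zm) {z : ℂ}
    {γ s : ℝ → ℂ} (h : IsPathWithBranch A B z γ s) :
    z ∈ Gamma A B ↔ (pathIntegral γ s).re = 0 := by
  refine ⟨fun ⟨γ', s', h', h0⟩ => ?_, fun h0 => ⟨γ, s, h, h0⟩⟩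
  rw [re_pathIntegral_eq_zero_iff hp hm h]
  exact (re_pathIntegral_eq_zero_iff hp hm h').1 h0

end Params
-- Zeros of the potential on the real line
namespace Params

variable {D : Params}

lemma V_ofReal (x : ℝ) : D.V x = (D.a + D.b) * Real.log x
    + (1 - D.a) * (Real.log (D.S * x - D.b) - Real.log (D.b * x + D.S))
    + (1 - D.b) * (Real.log (D.S * x + D.a) - Real.log (D.a * x - D.S)) := by
  have h : ∀ y : ℝ, Real.log ‖(y : ℂ)‖ = Real.log y := fun y => by
    rw [Complex.norm_real, Real.norm_eq_abs, Real.log_abs]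
  have h1 := h (D.S * x - D.b)
  have h2 := h (D.b * x + D.S)
  have h3 := h (D.S * x + D.a)
  have h4 := h (D.a * x - D.S)
  push_cast at h1 h2 h3 h4
  rw [V, h, h1, h2, h3, h4]

lemma tendsto_log_affine {α β e : ℝ} (hα : α ≠ 0) (he : α * e + β = 0) :
    Tendsto (fun x => Real.log (α * x + β)) (𝓝[≠] e) atBot := by
  refine Real.tendsto_log_nhdsNE_zero.comp (tendsto_nhdsWithin_iff.2 ⟨?_, ?_⟩)
  · have : Continuous fun x => α * x + β := by fun_prop
    have := this.tendsto e
    rw [he] at this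
    exact this.mono_left nhdsWithin_le_nhds
  · filter_upwards [self_mem_nhdsWithin] with x hx h0
    have h1 : α * (x - e) = 0 := by
      have : α * x + β = 0 := h0
      linarith
    exact hx (sub_eq_zero.1 ((mul_eq_zero.1 h1).resolve_left hα))

lemma tendsto_log_affine_of_ne {α β e : ℝ} (he : α * e + β ≠ 0) :
    Tendsto (fun x => Real.log (α * x + β)) (𝓝[≠] e) (𝓝 (Real.log (α * e + β))) := by
  have : ContinuousAt (fun x => Real.log (α * x + β)) e := ContinuousAt.log (by fun_prop) he
  exact this.tendsto.mono_left nhdsWithin_le_nhds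

lemma one_sub_a_pos : 0 < 1 - D.a := by linarith [D.b_pos, D.add_lt]
lemma one_sub_b_pos : 0 < 1 - D.b := by linarith [D.a_pos, D.add_lt]

lemma S_sq_lt : D.S ^ 2 < D.a * D.b := by
  have h := mul_pos (mul_pos D.a_pos D.b_pos) D.add_pos
  rw [D.S_sq]
  nlinarith

lemma V_eq_affine (x : ℝ) : D.V x = (D.a + D.b) * Real.log (1 * x + 0)
    + (1 - D.a) * (Real.log (D.S * x + -D.b) - Real.log (D.b * x + D.S))
    + (1 - D.b) * (Real.log (D.S * x + D.a) - Real.log (D.a * x + -D.S)) := by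
  rw [V_ofReal, one_mul, add_zero, ← sub_eq_add_neg, ← sub_eq_add_neg]

variable (D)

lemma div_lt_div_poles : D.S / D.a < D.b / D.S := by
  rw [div_lt_div_iff₀ D.a_pos D.S_pos]
  have := D.S_sq_lt
  nlinarith

lemma tendsto_V_zero : Tendsto (fun x : ℝ => D.V x) (𝓝[≠] 0) atBot := by
  have ha := D.a_pos
  have hb := D.b_pos
  have hS := D.S_pos
  simp only [V_eq_affine]
  have h1 := tendsto_log_affine (α := 1) (β := 0) (e := 0) one_ne_zero (by simp)
  have h2 := tendsto_log_affine_of_ne (α := D.S) (β := -D.b) (e := 0) (by simpa using hb.ne')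
  have h3 := tendsto_log_affine_of_ne (α := D.b) (β := D.S) (e := 0) (by simpa using hS.ne')
  have h4 := tendsto_log_affine_of_ne (α := D.S) (β := D.a) (e := 0) (by simpa using ha.ne')
  have h5 := tendsto_log_affine_of_ne (α := D.a) (β := -D.S) (e := 0) (by simpa using hS.ne')
  exact ((h1.const_mul_atBot D.add_pos).atBot_add ((h2.sub h3).const_mul _)).atBot_add
    ((h4.sub h5).const_mul _)

lemma tendsto_V_b_div_S : Tendsto (fun x : ℝ => D.V x) (𝓝[≠] (D.b / D.S)) atBot := by
  have ha := D.a_pos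
  have hb := D.b_pos
  have hS := D.S_pos
  have he := div_pos hb hS
  simp only [V_eq_affine]
  have h1 := tendsto_log_affine_of_ne (α := 1) (β := 0) (e := D.b / D.S) (by positivity)
  have h2 := tendsto_log_affine (α := D.S) (β := -D.b) (e := D.b / D.S) hS.ne' (by field_simp; ring)
  have h3 := tendsto_log_affine_of_ne (α := D.b) (β := D.S) (e := D.b / D.S) (by positivity)
  have h4 := tendsto_log_affine_of_ne (α := D.S) (β := D.a) (e := D.b / D.S) (by positivity)
  have h5 := tendsto_log_affine_of_ne (α := D.a) (β := -D.S) (e := D.b / D.S) (by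
    have := D.div_lt_div_poles
    rw [div_lt_iff₀ ha] at this
    intro h
    linarith)
  have h23 : Tendsto (fun x => Real.log (D.S * x + -D.b) - Real.log (D.b * x + D.S))
      (𝓝[≠] (D.b / D.S)) atBot := by
    simpa [sub_eq_add_neg] using h2.atBot_add h3.neg
  exact ((h1.const_mul _).add_atBot (h23.const_mul_atBot D.one_sub_a_pos)).atBot_add
    ((h4.sub h5).const_mul _)

lemma tendsto_V_S_div_a : Tendsto (fun x : ℝ => D.V x) (𝓝[≠] (D.S / D.a)) atTop := by
  have ha := D.a_pos
  have hb := D.b_pos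
  have hS := D.S_pos
  have he := div_pos hS ha
  simp only [V_eq_affine]
  have h1 := tendsto_log_affine_of_ne (α := 1) (β := 0) (e := D.S / D.a) (by positivity)
  have h2 := tendsto_log_affine_of_ne (α := D.S) (β := -D.b) (e := D.S / D.a) (by
    have := D.div_lt_div_poles
    rw [lt_div_iff₀ hS] at this
    intro h
    linarith)
  have h3 := tendsto_log_affine_of_ne (α := D.b) (β := D.S) (e := D.S / D.a) (by positivity)
  have h4 := tendsto_log_affine_of_ne (α := D.S) (β := D.a) (e := D.S / D.a) (by positivity)
  have h5 := tendsto_log_affine (α := D.a) (β := -D.S) (e := D.S / D.a) ha.ne' (by field_simp; ring)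
  have h45 : Tendsto (fun x => Real.log (D.S * x + D.a) - Real.log (D.a * x + -D.S))
      (𝓝[≠] (D.S / D.a)) atTop := by
    simpa [sub_eq_add_neg] using h4.add_atTop (tendsto_neg_atBot_atTop.comp h5)
  exact ((h1.const_mul _).add ((h2.sub h3).const_mul _)).add_atTop
    (h45.const_mul_atTop D.one_sub_b_pos)

lemma tendsto_V_neg : Tendsto (fun x : ℝ => D.V x) (𝓝[≠] (-(D.S / D.b))) atTop := by
  have ha := D.a_pos
  have hb := D.b_pos
  have hS := D.S_pos
  have he := div_pos hS hb
  simp only [V_eq_affine]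
  have h1 := tendsto_log_affine_of_ne (α := 1) (β := 0) (e := -(D.S / D.b)) (by
    simp [hb.ne', hS.ne'])
  have h2 := tendsto_log_affine_of_ne (α := D.S) (β := -D.b) (e := -(D.S / D.b)) (by
    have := mul_pos hS he
    intro h
    linarith)
  have h3 := tendsto_log_affine (α := D.b) (β := D.S) (e := -(D.S / D.b)) hb.ne'
    (by field_simp; ring)
  have h4 := tendsto_log_affine_of_ne (α := D.S) (β := D.a) (e := -(D.S / D.b)) (by
    have := D.S_sq_lt
    have h : D.S * (D.S / D.b) < D.a := by
      rw [← mul_div_assoc, div_lt_iff₀ hb]; nlinarith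
    intro h'
    linarith)
  have h5 := tendsto_log_affine_of_ne (α := D.a) (β := -D.S) (e := -(D.S / D.b)) (by
    have := mul_pos ha he
    intro h
    linarith)
  have h23 : Tendsto (fun x => Real.log (D.S * x + -D.b) - Real.log (D.b * x + D.S))
      (𝓝[≠] (-(D.S / D.b))) atTop := by
    simpa [sub_eq_add_neg] using h2.add_atTop (tendsto_neg_atBot_atTop.comp h3)
  exact ((h1.const_mul _).add_atTop (h23.const_mul_atTop D.one_sub_a_pos)).atTop_add
    ((h4.sub h5).const_mul _)

lemma exists_zero_of_sign_change {f : ℝ → ℝ} {x y : ℝ} (hxy : x < y) (hf : ContinuousOn f (Ioo x y))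
    (h : (Tendsto f (𝓝[≠] x) atBot ∧ Tendsto f (𝓝[≠] y) atTop) ∨
      (Tendsto f (𝓝[≠] x) atTop ∧ Tendsto f (𝓝[≠] y) atBot)) : ∃ z ∈ Ioo x y, f z = 0 := by
  have hx : ∀ {p : ℝ → Prop}, (∀ᶠ u in 𝓝[≠] x, p u) → ∃ u ∈ Ioo x y, p u := fun hp =>
    (((hp.filter_mono (nhdsWithin_mono x (s := Ioi x) fun u hu => ne_of_gt hu)).and
      (Ioo_mem_nhdsGT hxy)).exists).imp fun u hu => ⟨hu.2, hu.1⟩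
  have hy : ∀ {p : ℝ → Prop}, (∀ᶠ u in 𝓝[≠] y, p u) → ∃ u ∈ Ioo x y, p u := fun hp =>
    (((hp.filter_mono (nhdsWithin_mono y (s := Iio y) fun u hu => ne_of_lt hu)).and
      (Ioo_mem_nhdsLT hxy)).exists).imp fun u hu => ⟨hu.2, hu.1⟩
  rcases h with ⟨h1, h2⟩ | ⟨h1, h2⟩
  · obtain ⟨u, hu, hu0⟩ := hx (h1.eventually (eventually_le_atBot 0))
    obtain ⟨w, hw, hw0⟩ := hy (h2.eventually (eventually_ge_atTop 0))
    exact isPreconnected_Ioo.intermediate_value hu hw hf ⟨hu0, hw0⟩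
  · obtain ⟨u, hu, hu0⟩ := hx (h1.eventually (eventually_ge_atTop 0))
    obtain ⟨w, hw, hw0⟩ := hy (h2.eventually (eventually_le_atBot 0))
    exact isPreconnected_Ioo.intermediate_value hw hu hf ⟨hw0, hu0⟩

lemma nonPole_ofReal {x : ℝ} (h0 : x ≠ 0) (h1 : D.S * x - D.b ≠ 0) (h2 : D.b * x + D.S ≠ 0)
    (h3 : D.S * x + D.a ≠ 0) (h4 : D.a * x - D.S ≠ 0) : D.NonPole x :=
  ⟨by exact_mod_cast h0, by exact_mod_cast h1, by exact_mod_cast h2, by exact_mod_cast h3,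
    by exact_mod_cast h4⟩

/-- At the successive poles -S/b, 0, S/a, b/S the limits of `V` are +∞, -∞, +∞, -∞, so each gap
contains a zero. The gaps project to the z-intervals right of 1, left of -1 and between ±1, in this
order. -/
lemma exists_real_zeros : ∃ x : Fin 3 → ℝ, (-(D.S / D.b) < x 0 ∧ x 0 < 0) ∧
    (0 < x 1 ∧ x 1 < D.S / D.a) ∧ (D.S / D.a < x 2 ∧ x 2 < D.b / D.S) ∧
    ∀ i, D.NonPole (x i) ∧ D.V (x i) = 0 := by
  have ha := D.a_pos
  have hb := D.b_pos
  have hS := D.S_pos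
  have hlt := D.div_lt_div_poles
  have hSS := D.S_sq_lt
  have n0 : ∀ x ∈ Ioo (-(D.S / D.b)) 0, D.NonPole (x : ℂ) := by
    rintro x ⟨h1, h2⟩
    have k2 : 0 < D.b * x + D.S := by
      have := mul_lt_mul_of_pos_left h1 hb
      field_simp at this
      linarith
    have k1 : D.S * x < 0 := mul_neg_of_pos_of_neg hS h2
    have k4 : D.a * x < 0 := mul_neg_of_pos_of_neg ha h2
    have k3 : 0 < D.S * x + D.a := by
      refine pos_of_mul_pos_right (b := D.S * x + D.a) (a := D.b) ?_ hb.le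
      nlinarith
    exact D.nonPole_ofReal h2.ne (by linarith) k2.ne' k3.ne' (by linarith)
  have n1 : ∀ x ∈ Ioo 0 (D.S / D.a), D.NonPole (x : ℂ) := by
    rintro x ⟨h1, h2⟩
    have k1 : x * D.S < D.b := (lt_div_iff₀ hS).1 (h2.trans hlt)
    have k4 : x * D.a < D.S := (lt_div_iff₀ ha).1 h2
    exact D.nonPole_ofReal h1.ne' (by linarith) (by positivity) (by positivity) (by linarith)
  have n2 : ∀ x ∈ Ioo (D.S / D.a) (D.b / D.S), D.NonPole (x : ℂ) := by
    rintro x ⟨h1, h2⟩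
    have h0 : 0 < x := (div_pos hS ha).trans h1
    have k1 : x * D.S < D.b := (lt_div_iff₀ hS).1 h2
    have k4 : D.S < x * D.a := (div_lt_iff₀ ha).1 h1
    exact D.nonPole_ofReal h0.ne' (by linarith) (by positivity) (by positivity) (by linarith)
  have hcont : ∀ {s : Set ℝ}, (∀ x ∈ s, D.NonPole (x : ℂ)) →
      ContinuousOn (fun x : ℝ => D.V x) s := fun hs x hx =>
    ((V_continuousAt (hs x hx)).comp Complex.continuous_ofReal.continuousAt).continuousWithinAt
  obtain ⟨x0, m0, z0⟩ := exists_zero_of_sign_change (by linarith [div_pos hS hb]) (hcont n0)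
    (Or.inr ⟨D.tendsto_V_neg, D.tendsto_V_zero⟩)
  obtain ⟨x1, m1, z1⟩ := exists_zero_of_sign_change (div_pos hS ha) (hcont n1)
    (Or.inl ⟨D.tendsto_V_zero, D.tendsto_V_S_div_a⟩)
  obtain ⟨x2, m2, z2⟩ := exists_zero_of_sign_change hlt (hcont n2)
    (Or.inr ⟨D.tendsto_V_S_div_a, D.tendsto_V_b_div_S⟩)
  refine ⟨![x0, x1, x2], m0, m1, m2, fun i => ?_⟩
  fin_cases i
  · exact ⟨n0 x0 m0, z0⟩
  · exact ⟨n1 x1 m1, z1⟩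
  · exact ⟨n2 x2 m2, z2⟩

/-- The Cayley transform sends the real v-line to the unit circle of y. This angle increases with x,
so the order of the zeros is kept. -/
lemma exp_two_arctan (x : ℝ) :
    Complex.exp (((Real.pi + 2 * Real.arctan x : ℝ) : ℂ) * Complex.I)
      = ((x : ℂ) - Complex.I) / (x + Complex.I) := by
  have hne : (x : ℂ) + Complex.I ≠ 0 := fun h => by
    have := congrArg Complex.im h; simp at this
  have h1 : Complex.exp ((Real.arctan x : ℂ) * Complex.I) =
      ((1 / √(1 + x ^ 2) : ℝ) : ℂ) * (1 + x * Complex.I) := by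
    rw [Complex.exp_mul_I, ← Complex.ofReal_cos, ← Complex.ofReal_sin, Real.cos_arctan,
      Real.sin_arctan]
    push_cast
    ring
  have h2 : (((1 / √(1 + x ^ 2) : ℝ) : ℂ)) ^ 2 * (1 + x ^ 2) = 1 := by
    have : (1 / √(1 + x ^ 2)) ^ 2 * (1 + x ^ 2) = 1 := by
      rw [div_pow, Real.sq_sqrt (by positivity)]
      field_simp
    exact_mod_cast this
  have h3 : Complex.exp (((Real.pi + 2 * Real.arctan x : ℝ) : ℂ) * Complex.I) =
      -Complex.exp ((Real.arctan x : ℂ) * Complex.I) ^ 2 := by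
    rw [← Complex.exp_nat_mul]
    push_cast
    rw [add_mul, Complex.exp_add, Complex.exp_pi_mul_I, mul_assoc]
    ring
  rw [h3, h1, eq_div_iff hne]
  set c := ((1 / √(1 + x ^ 2) : ℝ) : ℂ)
  linear_combination (x - Complex.I) * h2
    - c ^ 2 * (x ^ 3 + x ^ 2 * Complex.I + 2 * x) * Complex.I_sq

end Params
-- From angle functions to arcs in the z-plane
namespace Params

/-- `Ψ t` is the argument of `(z - ζ₊) / (z - ζ₋)` at the point of an arc of the zero set at which
the modulus of this quotient is `(1 - t) / t`. -/
structure AngleFunction (D : Params) (Ψ : ℝ → ℝ) : Prop where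
  analytic : ∀ t, AnalyticAt ℝ Ψ t
  zero : ∀ t ∈ Ioo (0 : ℝ) 1,
    D.tri.U ((√((1 - t) / t) : ℝ) * Complex.exp ((Ψ t / 2 : ℝ) * Complex.I)) = 0
  pole : ∀ t ∈ Ioo (0 : ℝ) 1, D.tri.P (((1 - t) / t : ℝ) * Complex.exp (Ψ t * Complex.I)) ≠ 0

/-- The denominator in the parametrization of the arcs. -/
def den (Ψ : ℝ → ℝ) (t : ℝ) : ℂ := t - (1 - t) * Complex.exp (Ψ t * Complex.I)

variable (D : Params)

/-- The arc with angle function `Ψ`, from `ζ₋` to `ζ₊`. -/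
def arc (Ψ : ℝ → ℝ) (t : ℝ) : ℂ :=
  (t * D.zp - (1 - t) * Complex.exp (Ψ t * Complex.I) * D.zm) / den Ψ t

/-- A branch of the square root along the arc. -/
def branch (Ψ : ℝ → ℝ) (t : ℝ) : ℂ :=
  (√(t * (1 - t)) : ℝ) * Complex.exp ((Ψ t / 2 : ℝ) * Complex.I) * (D.zp - D.zm) / den Ψ t

variable {D} {Ψ : ℝ → ℝ}

lemma tri_P_one : D.tri.P 1 = 0 := by
  simp [ClosedTriangle.P, Fin.prod_univ_three, tri]

/-- A zero of the denominator would mean Y = 1, that is z = ∞, which is a pole of the differential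
and so excluded by `pole`. -/
lemma AngleFunction.den_ne (h : D.AngleFunction Ψ) {t : ℝ} (ht : t ∈ Icc (0 : ℝ) 1) :
    den Ψ t ≠ 0 := by
  rcases eq_or_ne t 0 with rfl | h0
  · simp [den]
  rcases eq_or_ne t 1 with rfl | h1
  · simp [den]
  have ht' : t ∈ Ioo (0 : ℝ) 1 := ⟨lt_of_le_of_ne ht.1 h0.symm, lt_of_le_of_ne ht.2 h1⟩
  intro hd
  refine h.pole t ht' ?_
  have h0c : (t : ℂ) ≠ 0 := by exact_mod_cast h0
  have : (((1 - t) / t : ℝ) : ℂ) * Complex.exp (Ψ t * Complex.I) = 1 := by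
    rw [den] at hd
    push_cast
    field_simp
    linear_combination -hd
  rw [this, tri_P_one]

lemma AngleFunction.arc_sub_zp (h : D.AngleFunction Ψ) {t : ℝ} (ht : t ∈ Icc (0 : ℝ) 1) :
    D.arc Ψ t - D.zp = (1 - t) * Complex.exp (Ψ t * Complex.I) * (D.zp - D.zm) / den Ψ t := by
  have := h.den_ne ht
  rw [arc, eq_div_iff this, sub_mul, div_mul_cancel₀ _ this, den]
  ring

lemma AngleFunction.arc_sub_zm (h : D.AngleFunction Ψ) {t : ℝ} (ht : t ∈ Icc (0 : ℝ) 1) :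
    D.arc Ψ t - D.zm = t * (D.zp - D.zm) / den Ψ t := by
  have := h.den_ne ht
  rw [arc, eq_div_iff this, sub_mul, div_mul_cancel₀ _ this, den]
  ring

lemma exp_half_sq (x : ℝ) :
    Complex.exp ((x / 2 : ℝ) * Complex.I) ^ 2 = Complex.exp (x * Complex.I) := by
  rw [← Complex.exp_nat_mul]
  congr 1
  push_cast
  ring

lemma AngleFunction.branch_sq (h : D.AngleFunction Ψ) {t : ℝ} (ht : t ∈ Icc (0 : ℝ) 1) :
    D.branch Ψ t ^ 2 = (D.arc Ψ t - D.zp) * (D.arc Ψ t - D.zm) := by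
  have hd := h.den_ne ht
  have hs : (((√(t * (1 - t)) : ℝ) : ℂ)) ^ 2 = t * (1 - t) := by
    have := Real.sq_sqrt (mul_nonneg ht.1 (sub_nonneg.2 ht.2))
    exact_mod_cast this
  rw [h.arc_sub_zp ht, h.arc_sub_zm ht, branch, div_pow, mul_pow, mul_pow, hs, exp_half_sq]
  field_simp

lemma AngleFunction.exp_analyticAt (h : D.AngleFunction Ψ) (t : ℝ) :
    AnalyticAt ℝ (fun t => Complex.exp (Ψ t * Complex.I)) t := by
  have a1 : AnalyticAt ℝ (fun t => (Ψ t : ℂ)) t :=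
    (Complex.ofRealCLM.analyticAt _).comp (h.analytic t)
  have a3 : AnalyticAt ℝ Complex.exp ((Ψ t : ℂ) * Complex.I) :=
    (analyticAt_cexp (z := (Ψ t : ℂ) * Complex.I)).restrictScalars
  exact a3.comp (f := fun t => (Ψ t : ℂ) * Complex.I) (a1.mul analyticAt_const)

lemma AngleFunction.arc_analyticAt (h : D.AngleFunction Ψ) {t : ℝ} (ht : t ∈ Icc (0 : ℝ) 1) :
    AnalyticAt ℝ (D.arc Ψ) t := by
  have a1 : AnalyticAt ℝ (fun t : ℝ => (t : ℂ)) t := Complex.ofRealCLM.analyticAt _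
  have a2 := (analyticAt_const (v := (1 : ℂ))).sub a1
  have a3 := h.exp_analyticAt t
  exact ((a1.mul analyticAt_const).sub ((a2.mul a3).mul analyticAt_const)).div
    (a1.sub (a2.mul a3)) (h.den_ne ht)

lemma AngleFunction.branch_continuousOn (h : D.AngleFunction Ψ) :
    ContinuousOn (D.branch Ψ) (Icc 0 1) := by
  have hΨ : Continuous Ψ := continuous_iff_continuousAt.2 fun t => (h.analytic t).continuousAt
  unfold branch
  refine ContinuousOn.div (Continuous.continuousOn (by fun_prop)) ?_ fun t ht => h.den_ne ht
  unfold den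
  exact Continuous.continuousOn (by fun_prop)

lemma zp_sub_zm_ne : D.zp - D.zm ≠ 0 := sub_ne_zero.2 D.zp_ne_zm

lemma AngleFunction.arc_ne_zp (h : D.AngleFunction Ψ) {t : ℝ} (ht : t ∈ Icc (0 : ℝ) 1)
    (h1 : t ≠ 1) : D.arc Ψ t ≠ D.zp := by
  rw [← sub_ne_zero, h.arc_sub_zp ht]
  have : (1 - t : ℂ) ≠ 0 := by
    rw [sub_ne_zero]; exact_mod_cast h1.symm
  exact div_ne_zero (mul_ne_zero (mul_ne_zero this (Complex.exp_ne_zero _)) zp_sub_zm_ne)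
    (h.den_ne ht)

lemma AngleFunction.arc_ne_zm (h : D.AngleFunction Ψ) {t : ℝ} (ht : t ∈ Icc (0 : ℝ) 1)
    (h0 : t ≠ 0) : D.arc Ψ t ≠ D.zm := by
  rw [← sub_ne_zero, h.arc_sub_zm ht]
  have : (t : ℂ) ≠ 0 := by exact_mod_cast h0
  exact div_ne_zero (mul_ne_zero this zp_sub_zm_ne) (h.den_ne ht)

lemma AngleFunction.arc_zero (h : D.AngleFunction Ψ) : D.arc Ψ 0 = D.zm := by
  have := h.arc_sub_zm (t := 0) (by simp)
  simpa [sub_eq_zero] using this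

lemma AngleFunction.arc_one (h : D.AngleFunction Ψ) : D.arc Ψ 1 = D.zp := by
  have := h.arc_sub_zp (t := 1) (by simp)
  simpa [sub_eq_zero] using this

lemma AngleFunction.relation (h : D.AngleFunction Ψ) {t : ℝ} (ht : t ∈ Icc (0 : ℝ) 1) :
    t * (D.arc Ψ t - D.zp) =
      (1 - t) * Complex.exp (Ψ t * Complex.I) * (D.arc Ψ t - D.zm) := by
  rw [h.arc_sub_zp ht, h.arc_sub_zm ht]; ring

lemma AngleFunction.norm_relation (h : D.AngleFunction Ψ) {t : ℝ} (ht : t ∈ Icc (0 : ℝ) 1) :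
    t * ‖D.arc Ψ t - D.zp‖ = (1 - t) * ‖D.arc Ψ t - D.zm‖ := by
  have := congrArg norm (h.relation ht)
  have e : (1 - t : ℂ) = ((1 - t : ℝ) : ℂ) := by push_cast; rfl
  rw [e, norm_mul, norm_mul, norm_mul, Complex.norm_exp_ofReal_mul_I, Complex.norm_real,
    Complex.norm_real, Real.norm_eq_abs, Real.norm_eq_abs, abs_of_nonneg ht.1,
    abs_of_nonneg (sub_nonneg.2 ht.2), mul_one] at this
  exact this

lemma norm_add_norm_pos (z : ℂ) : 0 < ‖z - D.zp‖ + ‖z - D.zm‖ := by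
  have h := zp_sub_zm_ne (D := D)
  have : ‖D.zp - D.zm‖ ≤ ‖z - D.zp‖ + ‖z - D.zm‖ := by
    have := norm_sub_le (z - D.zm) (z - D.zp)
    rw [sub_sub_sub_cancel_left] at this
    linarith
  exact (norm_pos_iff.2 h).trans_le this

/-- The parameter is a function of the point alone, the same for all arcs. So arcs are injective,
and two arcs can meet only at equal parameters. -/
lemma AngleFunction.param_eq (h : D.AngleFunction Ψ) {t : ℝ} (ht : t ∈ Icc (0 : ℝ) 1) :
    t = ‖D.arc Ψ t - D.zm‖ / (‖D.arc Ψ t - D.zp‖ + ‖D.arc Ψ t - D.zm‖) := by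
  rw [eq_div_iff (norm_add_norm_pos _).ne']
  linarith [h.norm_relation ht]

lemma AngleFunction.injOn (h : D.AngleFunction Ψ) : InjOn (D.arc Ψ) (Icc 0 1) := by
  intro t ht u hu he
  rw [h.param_eq ht, h.param_eq hu, he]

/-- Up to nonzero factors the derivative is -1 + i t(1 - t)Ψ'(t), whose real part is -1. No
information on Ψ' is needed. -/
lemma AngleFunction.deriv_ne (h : D.AngleFunction Ψ) {t : ℝ} (ht : t ∈ Icc (0 : ℝ) 1) :
    deriv (D.arc Ψ) t ≠ 0 := by
  intro h0
  have hγ := (h.arc_analyticAt ht).differentiableAt.hasDerivAt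
  rw [h0] at hγ
  have hΨ := (h.analytic t).differentiableAt.hasDerivAt
  set Ψ' := deriv Ψ t
  have hE : HasDerivAt (fun t => Complex.exp (Ψ t * Complex.I))
      (Complex.exp (Ψ t * Complex.I) * (Ψ' * Complex.I)) t :=
    (hΨ.ofReal_comp.mul_const Complex.I).cexp
  have hid : HasDerivAt (fun t : ℝ => (t : ℂ)) 1 t := Complex.ofRealCLM.hasDerivAt
  have e1 : HasDerivAt (fun t => t * D.zp - (1 - t) * Complex.exp (Ψ t * Complex.I) * D.zm)
      (D.zp - (-Complex.exp (Ψ t * Complex.I) + (1 - t) * (Complex.exp (Ψ t * Complex.I) *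
        (Ψ' * Complex.I))) * D.zm) t :=
    ((hid.mul_const D.zp).sub (((hid.const_sub 1).mul hE).mul_const D.zm)).congr_deriv (by ring)
  have e2 : HasDerivAt (den Ψ) (1 - (-Complex.exp (Ψ t * Complex.I) + (1 - t) *
      (Complex.exp (Ψ t * Complex.I) * (Ψ' * Complex.I)))) t :=
    (hid.sub ((hid.const_sub 1).mul hE)).congr_deriv (by ring)
  have hd := h.den_ne ht
  have e3 := (e1.div e2 hd).unique hγ
  rw [div_eq_zero_iff, or_iff_left (pow_ne_zero 2 hd), den] at e3
  have e4 : (D.zp - D.zm) * Complex.exp (Ψ t * Complex.I) *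
      (-1 + t * (1 - t) * (Ψ' * Complex.I)) = 0 := by
    linear_combination e3
  have e5 := (mul_eq_zero.1 e4).resolve_left (mul_ne_zero zp_sub_zm_ne (Complex.exp_ne_zero _))
  have e6 := congrArg Complex.re e5
  have e7 : ((t : ℂ) * (1 - t) * (Ψ' * Complex.I)) = ((t * (1 - t) * Ψ' : ℝ) : ℂ) * Complex.I := by
    push_cast; ring
  rw [e7] at e6
  simp at e6

lemma AngleFunction.isAnalyticArc (h : D.AngleFunction Ψ) :
    IsAnalyticArc (D.arc Ψ '' Icc 0 1) D.zm D.zp :=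
  ⟨D.arc Ψ, fun _ ht => h.arc_analyticAt ht, h.injOn, fun _ ht => h.deriv_ne ht, h.arc_zero,
    h.arc_one, rfl⟩

/-- Links the two coordinates on the surface: the Cayley transform of v is y = s/(z - ζ₋). -/
lemma lift_sub_add {z s y : ℂ} (hs : s ^ 2 = (z - D.zp) * (z - D.zm)) (hz : z ≠ D.zm)
    (hy : y = s / (z - D.zm)) : D.lift z s + Complex.I ≠ 0 ∧
      (D.lift z s - Complex.I) / (D.lift z s + Complex.I) = y := by
  have hq := D.q_ne
  have hz' := sub_ne_zero.2 hz
  have e1 : D.lift z s - Complex.I = (z - D.zp + s) / D.q := by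
    rw [lift, zp]; field_simp; ring
  have e2 : D.lift z s + Complex.I = (z - D.zm + s) / D.q := by
    rw [lift, zm]; field_simp; ring
  have hne : z - D.zm + s ≠ 0 := by
    intro h0
    have : s = -(z - D.zm) := by linear_combination h0
    rw [this, neg_sq, sq] at hs
    have := mul_right_cancel₀ hz' hs
    exact D.zp_ne_zm (by linear_combination this)
  refine ⟨by rw [e2]; exact div_ne_zero hne hq, ?_⟩
  rw [e1, e2, hy, div_div_div_cancel_right₀ hq, div_eq_div_iff hne hz']
  linear_combination -hs

lemma AngleFunction.branch_div (h : D.AngleFunction Ψ) {t : ℝ} (ht : t ∈ Ioo (0 : ℝ) 1) :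
    D.branch Ψ t / (D.arc Ψ t - D.zm) =
      (√((1 - t) / t) : ℝ) * Complex.exp ((Ψ t / 2 : ℝ) * Complex.I) := by
  have htI := Ioo_subset_Icc_self ht
  have hd := h.den_ne htI
  have h0 : (t : ℂ) ≠ 0 := by exact_mod_cast ht.1.ne'
  have hk := zp_sub_zm_ne (D := D)
  have hs : √(t * (1 - t)) = t * √((1 - t) / t) := by
    have e : t * (1 - t) = t ^ 2 * ((1 - t) / t) := by
      have := ht.1.ne'
      field_simp
    rw [e, Real.sqrt_mul (sq_nonneg t), Real.sqrt_sq ht.1.le]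
  rw [h.arc_sub_zm htI, branch, hs]
  push_cast
  field_simp

lemma sq_polar {t : ℝ} (ht : t ∈ Ioo (0 : ℝ) 1) (x : ℝ) :
    (((√((1 - t) / t) : ℝ) : ℂ) * Complex.exp ((x / 2 : ℝ) * Complex.I)) ^ 2 =
      ((1 - t) / t : ℝ) * Complex.exp (x * Complex.I) := by
  have : √((1 - t) / t) ^ 2 = (1 - t) / t :=
    Real.sq_sqrt (div_nonneg (by linarith [ht.2]) ht.1.le)
  rw [mul_pow, exp_half_sq, ← Complex.ofReal_pow, this]

lemma AngleFunction.nonPole (h : D.AngleFunction Ψ) {t : ℝ} (ht : t ∈ Ioo (0 : ℝ) 1) :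
    D.NonPole (D.lift (D.arc Ψ t) (D.branch Ψ t)) := by
  have htI := Ioo_subset_Icc_self ht
  obtain ⟨h1, h2⟩ := lift_sub_add (h.branch_sq htI) (h.arc_ne_zm htI ht.1.ne')
    (h.branch_div ht).symm
  rw [← tri_P_ne_zero_iff h1, h2, sq_polar ht]
  exact h.pole t ht

lemma AngleFunction.V_eq_zero (h : D.AngleFunction Ψ) {t : ℝ} (ht : t ∈ Ioo (0 : ℝ) 1) :
    D.V (D.lift (D.arc Ψ t) (D.branch Ψ t)) = 0 := by
  have htI := Ioo_subset_Icc_self ht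
  obtain ⟨h1, h2⟩ := lift_sub_add (h.branch_sq htI) (h.arc_ne_zm htI ht.1.ne')
    (h.branch_div ht).symm
  rw [V_eq_U (h.nonPole ht) h1, h2]
  exact h.zero t ht

lemma zp_mem_zeroSet : D.zp ∈ D.zeroSet := by
  have hq := D.q_pos
  refine ⟨fun h => ?_, fun h => ?_, 0, by simp, V_of_sq_eq_neg_one ?_⟩
  · have := congrArg Complex.im h; simp [zp] at this; linarith
  · have := congrArg Complex.im h; simp [zp] at this; linarith
  · have := D.q_ne
    simp only [lift, zp]
    field_simp
    linear_combination (D.q : ℂ) ^ 2 * Complex.I_sq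

lemma zm_mem_zeroSet : D.zm ∈ D.zeroSet := by
  have hq := D.q_pos
  refine ⟨fun h => ?_, fun h => ?_, 0, by simp, V_of_sq_eq_neg_one (by simp [lift_zm])⟩
  · have := congrArg Complex.im h; simp [zm] at this; linarith
  · have := congrArg Complex.im h; simp [zm] at this; linarith

lemma AngleFunction.arc_mem_zeroSet (h : D.AngleFunction Ψ) {t : ℝ} (ht : t ∈ Icc (0 : ℝ) 1) :
    D.arc Ψ t ∈ D.zeroSet := by
  rcases eq_or_ne t 0 with rfl | h0
  · rw [h.arc_zero]; exact zm_mem_zeroSet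
  rcases eq_or_ne t 1 with rfl | h1
  · rw [h.arc_one]; exact zp_mem_zeroSet
  have ht' : t ∈ Ioo (0 : ℝ) 1 := ⟨lt_of_le_of_ne ht.1 h0.symm, lt_of_le_of_ne ht.2 h1⟩
  obtain ⟨k1, k2⟩ := ne_of_nonPole (lift_quadratic (h.branch_sq ht)) (h.nonPole ht')
  exact ⟨k1, k2, _, h.branch_sq ht, h.V_eq_zero ht'⟩

lemma AngleFunction.isPathWithBranch (h : D.AngleFunction Ψ) {A B : ℝ}
    (hp : zetaPlus A B = D.zp) (hm : zetaMinus A B = D.zm) {f : ℝ → ℝ} (hf : ContDiff ℝ 1 f)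
    (hf0 : f 0 = 0) (hfI : MapsTo f (Icc 0 1) (Icc 0 1)) (hfo : MapsTo f (Ioo 0 1) (Ioo 0 1)) :
    IsPathWithBranch A B (D.arc Ψ (f 1)) (D.arc Ψ ∘ f) (D.branch Ψ ∘ f) where
  contDiffOn := ContDiffOn.comp (t := Icc 0 1)
    (fun t ht => (h.arc_analyticAt ht).contDiffAt.contDiffWithinAt) hf.contDiffOn hfI
  source := by simp [hf0, h.arc_zero, hm]
  target := rfl
  avoids_poles t ht := ⟨(h.arc_mem_zeroSet (hfI ht)).1, (h.arc_mem_zeroSet (hfI ht)).2.1⟩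
  avoids_branchPoints t ht := by
    have := hfo ht
    rw [hp, hm]
    exact ⟨h.arc_ne_zp (Ioo_subset_Icc_self this) this.2.ne,
      h.arc_ne_zm (Ioo_subset_Icc_self this) this.1.ne'⟩
  branch_continuousOn := h.branch_continuousOn.comp hf.continuous.continuousOn hfI
  branch_sq t ht := by
    rw [hp, hm]; exact h.branch_sq (hfI ht)

lemma AngleFunction.arc_mem_Gamma (h : D.AngleFunction Ψ) {A B : ℝ}
    (hp : zetaPlus A B = D.zp) (hm : zetaMinus A B = D.zm) {t : ℝ} (ht : t ∈ Icc (0 : ℝ) 1) :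
    D.arc Ψ t ∈ Gamma A B := by
  rcases eq_or_lt_of_le ht.1 with h0 | h0
  -- To reach ζ₋ itself a constant path is not allowed, as the interior must avoid the branch
  -- points. The path runs out along the arc and back.
  · have hP := h.isPathWithBranch hp hm (f := fun u => u * (1 - u)) (by fun_prop) (by simp)
      (fun u hu => ⟨mul_nonneg hu.1 (by linarith [hu.2]), by nlinarith [hu.1, hu.2]⟩)
      (fun u hu => ⟨mul_pos hu.1 (by linarith [hu.2]), by nlinarith [hu.1, hu.2]⟩)
    have e : (1 : ℝ) * (1 - 1) = t := by simp [← h0]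
    rw [e] at hP
    exact ⟨_, _, hP, (re_pathIntegral_eq_zero_iff hp hm hP).2 (h.arc_mem_zeroSet ht)⟩
  · have hP := h.isPathWithBranch hp hm (f := fun u => t * u) (by fun_prop) (by simp)
      (fun u hu => ⟨mul_nonneg ht.1 hu.1, mul_le_one₀ ht.2 hu.1 hu.2⟩)
      (fun u hu => ⟨mul_pos h0 hu.1, by nlinarith [hu.1, hu.2, ht.2]⟩)
    have e : t * 1 = t := mul_one t
    rw [e] at hP
    exact ⟨_, _, hP, (re_pathIntegral_eq_zero_iff hp hm hP).2 (h.arc_mem_zeroSet ht)⟩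

lemma exists_polar_of_mem_zeroSet {z : ℂ} (hz : z ∈ D.zeroSet) (hzp : z ≠ D.zp) (hzm : z ≠ D.zm) :
    ∃ t ∈ Ioo (0 : ℝ) 1, ∃ θ : ℝ, (z - D.zp) / (z - D.zm) =
        ((1 - t) / t : ℝ) * Complex.exp ((2 * θ : ℝ) * Complex.I) ∧
      D.tri.P (((1 - t) / t : ℝ) * Complex.exp ((2 * θ : ℝ) * Complex.I)) ≠ 0 ∧
      D.tri.U ((√((1 - t) / t) : ℝ) * Complex.exp (θ * Complex.I)) = 0 := by
  obtain ⟨h1, h2, s, hs, hV⟩ := hz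
  have kp := norm_pos_iff.2 (sub_ne_zero.2 hzp)
  have km := norm_pos_iff.2 (sub_ne_zero.2 hzm)
  have ksum := norm_add_norm_pos (D := D) z
  set t := ‖z - D.zm‖ / (‖z - D.zp‖ + ‖z - D.zm‖) with ht
  have hratio : (1 - t) / t = ‖z - D.zp‖ / ‖z - D.zm‖ := by
    rw [ht]; field_simp; ring
  have htI : t ∈ Ioo (0 : ℝ) 1 := ⟨div_pos km ksum, by rw [ht, div_lt_one ksum]; linarith⟩
  set y := s / (z - D.zm) with hy
  have hy2 : y ^ 2 = (z - D.zp) / (z - D.zm) := by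
    have := sub_ne_zero.2 hzm
    rw [hy, div_pow, hs]; field_simp
  have hny : ‖y‖ = √((1 - t) / t) := by
    rw [hratio, ← norm_div, ← hy2, norm_pow, Real.sqrt_sq (norm_nonneg y)]
  have hpol : y = (√((1 - t) / t) : ℝ) * Complex.exp ((y.arg : ℝ) * Complex.I) := by
    rw [← hny, Complex.norm_mul_exp_arg_mul_I]
  obtain ⟨k1, k2⟩ := lift_sub_add hs hzm hy
  have hN := nonPole_lift hs h1 h2
  have hP := (tri_P_ne_zero_iff k1).2 hN
  rw [V_eq_U hN k1, k2] at hV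
  rw [k2] at hP
  have hsq := sq_polar htI (2 * y.arg)
  rw [mul_div_cancel_left₀ _ (two_ne_zero' ℝ), ← hpol] at hsq
  refine ⟨t, htI, y.arg, ?_, ?_, ?_⟩
  · rw [← hy2, hsq]
  · rw [← hsq]; exact hP
  · rw [← hpol]; exact hV

lemma AngleFunction.eq_arc (h : D.AngleFunction Ψ) {z : ℂ} {t : ℝ} (ht : t ∈ Ioo (0 : ℝ) 1)
    (hzm : z ≠ D.zm)
    (hz : (z - D.zp) / (z - D.zm) = ((1 - t) / t : ℝ) * Complex.exp (Ψ t * Complex.I)) :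
    D.arc Ψ t = z := by
  have hd := h.den_ne (Ioo_subset_Icc_self ht)
  have h0 : (t : ℂ) ≠ 0 := by exact_mod_cast ht.1.ne'
  have hz' := sub_ne_zero.2 hzm
  rw [arc, div_eq_iff hd, den]
  push_cast at hz
  field_simp at hz
  linear_combination -hz

/-! ### Real points of the arcs and assembly of the three angle functions -/

variable (D)

/-- The image of a real point of the Riemann surface. -/
def realPoint (x : ℝ) : ℝ := D.p + D.q * (x - x⁻¹) / 2

lemma realPoint_quadratic {x : ℝ} (hx : x ≠ 0) :
    D.q * x ^ 2 - 2 * (D.realPoint x - D.p) * x - D.q = 0 := by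
  rw [realPoint]; field_simp; ring

lemma realPoint_sub_one {x : ℝ} (hx : x ≠ 0) :
    2 * ((D.S * x - D.b) * (D.b * x + D.S)) =
      D.b * (D.a + D.b) ^ 2 * (x * (D.realPoint x - 1)) := by
  have h := D.realPoint_quadratic hx
  have := factor_one (D := D) (z := D.realPoint x) (v := x) (by exact_mod_cast h)
  exact_mod_cast this

lemma realPoint_add_one {x : ℝ} (hx : x ≠ 0) :
    2 * ((D.S * x + D.a) * (D.a * x - D.S)) =
      D.a * (D.a + D.b) ^ 2 * (x * (D.realPoint x + 1)) := by
  have h := D.realPoint_quadratic hx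
  have := factor_neg_one (D := D) (z := D.realPoint x) (v := x) (by exact_mod_cast h)
  exact_mod_cast this

lemma one_lt_realPoint {x : ℝ} (h1 : -(D.S / D.b) < x) (h2 : x < 0) : 1 < D.realPoint x := by
  have hb := D.b_pos
  have hS := D.S_pos
  have k2 : 0 < D.b * x + D.S := by
    have := mul_lt_mul_of_pos_left h1 hb
    field_simp at this
    linarith
  have k1 : D.S * x - D.b < 0 := by linarith [mul_neg_of_pos_of_neg hS h2]
  have hlt := mul_neg_of_neg_of_pos k1 k2
  have hc : 0 < D.b * (D.a + D.b) ^ 2 := mul_pos hb (pow_pos D.add_pos 2)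
  have h := D.realPoint_sub_one h2.ne
  have h3 : x * (D.realPoint x - 1) < 0 := by
    by_contra! hcon
    linarith [mul_nonneg hc.le hcon]
  linarith [pos_of_mul_neg_right h3 h2.le]

lemma realPoint_lt_neg_one {x : ℝ} (h1 : 0 < x) (h2 : x < D.S / D.a) : D.realPoint x < -1 := by
  have ha := D.a_pos
  have hS := D.S_pos
  have k2 : x * D.a < D.S := (lt_div_iff₀ ha).1 h2
  have hlt : (D.S * x + D.a) * (D.a * x - D.S) < 0 :=
    mul_neg_of_pos_of_neg (by positivity) (by linarith)
  have hc : 0 < D.a * (D.a + D.b) ^ 2 := mul_pos ha (pow_pos D.add_pos 2)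
  have h := D.realPoint_add_one h1.ne'
  have h3 : x * (D.realPoint x + 1) < 0 := by
    by_contra! hcon
    linarith [mul_nonneg hc.le hcon]
  linarith [neg_of_mul_neg_right h3 h1.le]

lemma neg_one_lt_realPoint {x : ℝ} (h1 : D.S / D.a < x) : -1 < D.realPoint x := by
  have ha := D.a_pos
  have hS := D.S_pos
  have h0 : 0 < x := (div_pos hS ha).trans h1
  have k2 : D.S < x * D.a := (div_lt_iff₀ ha).1 h1
  have hlt : 0 < (D.S * x + D.a) * (D.a * x - D.S) := mul_pos (by positivity) (by linarith)
  have hc : 0 < D.a * (D.a + D.b) ^ 2 := mul_pos ha (pow_pos D.add_pos 2)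
  have h := D.realPoint_add_one h0.ne'
  have h3 : 0 < x * (D.realPoint x + 1) := by
    by_contra! hcon
    linarith [mul_nonneg_of_nonpos_of_nonpos (neg_nonpos.2 hc.le) hcon]
  linarith [pos_of_mul_pos_right h3 h0.le]

lemma realPoint_lt_one {x : ℝ} (h0 : 0 < x) (h1 : x < D.b / D.S) : D.realPoint x < 1 := by
  have hb := D.b_pos
  have hS := D.S_pos
  have k2 : x * D.S < D.b := (lt_div_iff₀ hS).1 h1
  have hlt : (D.S * x - D.b) * (D.b * x + D.S) < 0 :=
    mul_neg_of_neg_of_pos (by linarith) (by positivity)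
  have hc : 0 < D.b * (D.a + D.b) ^ 2 := mul_pos hb (pow_pos D.add_pos 2)
  have h := D.realPoint_sub_one h0.ne'
  have h3 : x * (D.realPoint x - 1) < 0 := by
    by_contra! hcon
    linarith [mul_nonneg hc.le hcon]
  linarith [neg_of_mul_neg_right h3 h0.le]

theorem exists_angleFunctions : ∃ (Ψ : Fin 3 → ℝ → ℝ) (ξ : Fin 3 → ℝ),
    (∀ i, D.AngleFunction (Ψ i)) ∧ (∀ z ∈ D.zeroSet, ∃ i, ∃ t ∈ Icc (0 : ℝ) 1, D.arc (Ψ i) t = z) ∧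
    (∀ t ∈ Ioo (0 : ℝ) 1, ∀ i k, i ≠ k → D.arc (Ψ i) t ≠ D.arc (Ψ k) t) ∧
    (∀ i, D.arc (Ψ i) (1 / 2) = ξ i) ∧ 1 < ξ 0 ∧ ξ 1 < -1 ∧ -1 < ξ 2 ∧ ξ 2 < 1 := by
  have ha := D.a_pos
  have hb := D.b_pos
  have hS := D.S_pos
  obtain ⟨x, ⟨h0, h0'⟩, ⟨h1, h1'⟩, ⟨h2, h2'⟩, hx⟩ := D.exists_real_zeros
  have hxi : ∀ i, (x i : ℂ) + Complex.I ≠ 0 := fun i h => by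
    have := congrArg Complex.im h; simp at this
  obtain ⟨Φ, c1, c2, c3, c4, c5, c6⟩ := D.tri.exists_arcAngles
    (τ := fun i => Real.pi + 2 * Real.arctan (x i))
    (by have := Real.arctan_strictMono (h0'.trans h1); linarith)
    (by have := Real.arctan_strictMono (h1'.trans h2); linarith)
    -- The bounds -S/b and b/S are exchanged by v ↦ -1/v, so their arctangents differ by exactly
    -- π/2. Hence the three zeros lie within half a turn in y.
    (by
      have e1 := Real.arctan_strictMono h2'
      have e2 := Real.arctan_strictMono h0
      have e3 : Real.arctan (D.b / D.S) = Real.pi / 2 - Real.arctan (D.S / D.b) := by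
        rw [← inv_div, Real.arctan_inv_of_pos (div_pos hS hb)]
      rw [Real.arctan_neg] at e2
      linarith)
    (fun i => by rw [exp_two_arctan]; exact (tri_P_ne_zero_iff (hxi i)).2 (hx i).1)
    (fun i => by rw [exp_two_arctan, ← V_eq_U (hx i).1 (hxi i)]; exact (hx i).2)
  -- `Φ` is indexed so that |Y| = t/(1 - t), which starts at ζ₊; replacing t by 1 - t makes the arcs
  -- start at ζ₋.
  have hA : ∀ i, D.AngleFunction fun t => Φ i (1 - t) := fun i => by
    have hm : ∀ t ∈ Ioo (0 : ℝ) 1, 1 - t ∈ Ioo (0 : ℝ) 1 := fun t ht =>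
      ⟨by linarith [ht.2], by linarith [ht.1]⟩
    refine ⟨fun t => ?_, fun t ht => ?_, fun t ht => ?_⟩
    · exact (c1 i (1 - t)).comp (f := fun t => 1 - t) (analyticAt_const.sub analyticAt_id)
    · simpa using c3 i (1 - t) (hm t ht)
    · simpa using c4 i (1 - t) (hm t ht)
  refine ⟨fun i t => Φ i (1 - t), fun i => D.realPoint (x i), hA, ?_, ?_, ?_,
    D.one_lt_realPoint h0 h0', D.realPoint_lt_neg_one h1 h1', D.neg_one_lt_realPoint h2,
    D.realPoint_lt_one ((div_pos hS ha).trans h2) h2'⟩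
  · intro z hz
    by_cases hzp : z = D.zp
    · exact ⟨0, 1, by simp, by rw [(hA 0).arc_one, hzp]⟩
    by_cases hzm : z = D.zm
    · exact ⟨0, 0, by simp, by rw [(hA 0).arc_zero, hzm]⟩
    obtain ⟨t, ht, θ, e1, e2, e3⟩ := exists_polar_of_mem_zeroSet hz hzp hzm
    obtain ⟨i, hi⟩ := c5 (1 - t) ⟨by linarith [ht.2], by linarith [ht.1]⟩ θ (by simpa using e2)
      (by simpa using e3)
    rw [hi] at e1
    exact ⟨i, t, Ioo_subset_Icc_self ht, (hA i).eq_arc ht hzm e1⟩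
  · intro t ht i k hik he
    have htI := Ioo_subset_Icc_self ht
    refine c6 (1 - t) ⟨by linarith [ht.2], by linarith [ht.1]⟩ i k hik ?_
    have r1 := (hA i).relation htI
    have r2 := (hA k).relation htI
    rw [he, r2] at r1
    have n1 : (1 - t : ℂ) ≠ 0 := by
      rw [sub_ne_zero]; exact_mod_cast ht.2.ne'
    have n2 := sub_ne_zero.2 ((hA k).arc_ne_zm htI ht.1.ne')
    exact (mul_left_cancel₀ n1 (mul_right_cancel₀ n2 r1)).symm
  · intro i
    have hhalf : (1 / 2 : ℝ) ∈ Ioo (0 : ℝ) 1 := by norm_num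
    have hx0 : x i ≠ 0 := by
      have := (hx i).1.ne_zero
      exact_mod_cast this
    have hx0c : (x i : ℂ) ≠ 0 := (hx i).1.ne_zero
    have hexp : Complex.exp (Φ i (1 - 1 / 2) * Complex.I) =
        (((x i : ℂ) - Complex.I) / (x i + Complex.I)) ^ 2 := by
      rw [show (1 - 1 / 2 : ℝ) = 1 / 2 by norm_num, c2, ← exp_two_arctan, ← Complex.exp_nat_mul]
      congr 1
      push_cast
      ring
    have hq := D.q_ne
    have e1 : (D.realPoint (x i) : ℂ) - D.zp =
        D.q / (2 * x i) * ((x i : ℂ) - Complex.I) ^ 2 := by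
      rw [realPoint, zp]; push_cast; field_simp; linear_combination -(D.q : ℂ) * Complex.I_sq
    have e2 : (D.realPoint (x i) : ℂ) - D.zm =
        D.q / (2 * x i) * ((x i : ℂ) + Complex.I) ^ 2 := by
      rw [realPoint, zm]; push_cast; field_simp; linear_combination -(D.q : ℂ) * Complex.I_sq
    have hk : (D.q : ℂ) / (2 * x i) ≠ 0 := div_ne_zero hq (mul_ne_zero two_ne_zero hx0c)
    refine (hA i).eq_arc hhalf ?_ ?_
    · rw [← sub_ne_zero, e2]
      exact mul_ne_zero hk (pow_ne_zero 2 (hxi i))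
    · rw [e1, e2, hexp, mul_div_mul_left _ _ hk, div_pow]
      norm_num

end Params
-- Critical trajectories as level sets of the squared potential
namespace Params

variable (D : Params)

/-- The square of the potential, as a single-valued function of `z`. -/
def sqPotential (z : ℂ) : ℝ := D.V (D.lift z (((z - D.zp) * (z - D.zm)) ^ (1 / 2 : ℂ))) ^ 2

variable {D} {A B : ℝ}

lemma sqrt_sq (w : ℂ) : (w ^ (1 / 2 : ℂ)) ^ 2 = w := by
  rw [one_div]; exact Complex.cpow_ofNat_inv_pow w 2

lemma sqPotential_eq {z s : ℂ} (hs : s ^ 2 = (z - D.zp) * (z - D.zm)) (h1 : z ≠ 1)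
    (h2 : z ≠ -1) : D.sqPotential z = D.V (D.lift z s) ^ 2 :=
  V_lift_sq_eq hs (sqrt_sq _) h1 h2

lemma mem_zeroSet_iff {z : ℂ} (h1 : z ≠ 1) (h2 : z ≠ -1) :
    z ∈ D.zeroSet ↔ D.sqPotential z = 0 :=
  ⟨fun h => by rw [sqPotential, V_eq_zero_of_mem_zeroSet h (sqrt_sq _)]; simp,
    fun h => ⟨h1, h2, _, sqrt_sq _, by simpa [sqPotential] using h⟩⟩

lemma neg_sq_eq_quadDiff (hp : zetaPlus A B = D.zp) (hm : zetaMinus A B = D.zm) {z s w : ℂ}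
    (hs : s ^ 2 = (z - D.zp) * (z - D.zm)) :
    quadDiff A B z * w ^ 2 = -(s / (z ^ 2 - 1) * w) ^ 2 := by
  rw [quadDiff, hp, hm, mul_pow, div_pow, hs]; ring

lemma horizontal_ne (hp : zetaPlus A B = D.zp) (hm : zetaMinus A B = D.zm) {γ : ℝ → ℂ}
    (h : IsHorizontal A B γ) {t : ℝ} (ht : t ∈ Ioo (0 : ℝ) 1) : γ t ≠ D.zp ∧ γ t ≠ D.zm := by
  have hr := h.re_pos t ht
  rw [quadDiff, hp, hm] at hr
  constructor <;> intro h0 <;> simp [h0] at hr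

/-- Horizontality makes the integrand times γ' have positive real multiple of -1 as its square, so
it is purely imaginary and `V` is stationary along γ. -/
lemma hasDerivAt_sqPotential (hp : zetaPlus A B = D.zp) (hm : zetaMinus A B = D.zm) {γ : ℝ → ℂ}
    (h : IsHorizontal A B γ) {t : ℝ} (ht : t ∈ Ioo (0 : ℝ) 1) :
    HasDerivAt (fun u => D.sqPotential (γ u)) 0 t := by
  have hn := isOpen_Ioo.mem_nhds ht
  have hγ := ((h.contDiffOn.differentiableOn one_ne_zero t ht).differentiableAt hn).hasDerivAt
  obtain ⟨hzp, hzm⟩ := horizontal_ne hp hm h ht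
  set R : ℂ → ℂ := fun z => (z - D.zp) * (z - D.zm) with hR
  have hR0 : R (γ t) ≠ 0 := mul_ne_zero (sub_ne_zero.2 hzp) (sub_ne_zero.2 hzm)
  set s₀ := R (γ t) ^ (1 / 2 : ℂ) with hs₀
  have hs₀2 : s₀ ^ 2 = R (γ t) := sqrt_sq _
  have hs₀0 : s₀ ≠ 0 := fun h0 => hR0 (by rw [← hs₀2, h0]; simp)
  -- A branch continuous near t: the principal root is applied only to the ratio R(γ(u))/R(γ(t)),
  -- which is near 1.
  set s : ℝ → ℂ := fun u => s₀ * (R (γ u) / R (γ t)) ^ (1 / 2 : ℂ) with hs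
  have hsq : ∀ u, s u ^ 2 = R (γ u) := fun u => by
    simp only [hs]
    rw [mul_pow, hs₀2, sqrt_sq, mul_div_cancel₀ _ hR0]
  have hst : s t = s₀ := by simp [hs, div_self hR0]
  have hsc : ContinuousAt s t := by
    refine continuousAt_const.mul (ContinuousAt.cpow ?_ continuousAt_const ?_)
    · have : ContinuousAt (fun u => R (γ u)) t :=
        (hγ.continuousAt.sub continuousAt_const).mul (hγ.continuousAt.sub continuousAt_const)
      exact this.div_const _
    · rw [div_self hR0]; exact Complex.one_mem_slitPlane
  have hd := hasDerivAt_V_lift (D := D) hγ hsc (Eventually.of_forall hsq) (by rw [hst]; exact hs₀0)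
    (h.avoids_poles t ht).1 (h.avoids_poles t ht).2
  have hre := h.re_pos t ht
  have him := h.im_zero t ht
  rw [neg_sq_eq_quadDiff hp hm (hsq t)] at hre him
  set w := s t / (γ t ^ 2 - 1) * deriv γ t
  have hw : w.re = 0 := by
    simp only [sq, Complex.neg_re, Complex.neg_im, Complex.mul_re, Complex.mul_im] at hre him
    by_contra hne
    have : w.im = 0 := by
      have : w.re * w.im = 0 := by linarith
      exact (mul_eq_zero.1 this).resolve_left hne
    rw [this] at hre
    nlinarith [mul_self_nonneg w.re]
  rw [hw, mul_zero] at hd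
  have hd2 := hd.pow 2
  simp only [mul_zero] at hd2
  refine hd2.congr_of_eventuallyEq ?_
  filter_upwards [hn] with u hu
  exact sqPotential_eq (hsq u) (h.avoids_poles u hu).1 (h.avoids_poles u hu).2

lemma sqPotential_const (hp : zetaPlus A B = D.zp) (hm : zetaMinus A B = D.zm) {γ : ℝ → ℂ}
    (h : IsHorizontal A B γ) {t u : ℝ} (ht : t ∈ Ioo (0 : ℝ) 1) (hu : u ∈ Ioo (0 : ℝ) 1) :
    D.sqPotential (γ t) = D.sqPotential (γ u) :=
  isOpen_Ioo.is_const_of_deriv_eq_zero isPreconnected_Ioo (f := fun u => D.sqPotential (γ u))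
    (fun _ hv => (hasDerivAt_sqPotential hp hm h hv).differentiableAt.differentiableWithinAt)
    (fun _ hv => (hasDerivAt_sqPotential hp hm h hv).deriv) ht hu

lemma horizontal_subset_zeroSet (hp : zetaPlus A B = D.zp) (hm : zetaMinus A B = D.zm)
    {γ : ℝ → ℂ} (h : IsHorizontal A B γ) {u : ℝ} (hu : u ∈ Ioo (0 : ℝ) 1)
    (h0 : D.sqPotential (γ u) = 0) : γ '' Ioo 0 1 ⊆ D.zeroSet := by
  rintro _ ⟨t, ht, rfl⟩
  rw [mem_zeroSet_iff (h.avoids_poles t ht).1 (h.avoids_poles t ht).2,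
    sqPotential_const hp hm h ht hu, h0]

/-- Needed only at ζ±, where the principal root has argument 0 and is continuous despite its cut. -/
lemma sqPotential_continuousAt {z : ℂ} (hz : (z - D.zp) * (z - D.zm) = 0) (h1 : z ≠ 1)
    (h2 : z ≠ -1) : ContinuousAt D.sqPotential z := by
  have c1 : ContinuousAt (fun z => ((z - D.zp) * (z - D.zm)) ^ (1 / 2 : ℂ)) z := by
    refine ContinuousAt.comp (g := fun w : ℂ => w ^ (1 / 2 : ℂ))
      (f := fun z => (z - D.zp) * (z - D.zm)) ?_ (by fun_prop)
    exact Complex.continuousAt_cpow_const_of_re_pos (Or.inl (by rw [hz]; simp)) (by norm_num)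
  have c2 : ContinuousAt (fun z => D.lift z (((z - D.zp) * (z - D.zm)) ^ (1 / 2 : ℂ))) z := by
    unfold lift
    exact ((continuousAt_id.sub continuousAt_const).add c1).div_const _
  have c3 := V_continuousAt (nonPole_lift (D := D) (sqrt_sq ((z - D.zp) * (z - D.zm))) h1 h2)
  exact (c3.comp (f := fun z => D.lift z (((z - D.zp) * (z - D.zm)) ^ (1 / 2 : ℂ))) c2).pow 2

lemma horizontal_subset_of_tendsto (hp : zetaPlus A B = D.zp) (hm : zetaMinus A B = D.zm)
    {γ : ℝ → ℂ} (h : IsHorizontal A B γ) {z : ℂ} (hz : (z - D.zp) * (z - D.zm) = 0)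
    (hzero : z ∈ D.zeroSet) (hlim : Tendsto γ (𝓝[>] 0) (𝓝 z)) : γ '' Ioo 0 1 ⊆ D.zeroSet := by
  have hhalf : (1 / 2 : ℝ) ∈ Ioo (0 : ℝ) 1 := by norm_num
  refine horizontal_subset_zeroSet hp hm h hhalf ?_
  have t1 := (sqPotential_continuousAt hz hzero.1 hzero.2.1).tendsto.comp hlim
  rw [(mem_zeroSet_iff hzero.1 hzero.2.1).1 hzero] at t1
  refine tendsto_nhds_unique (tendsto_const_nhds.congr' ?_) t1
  filter_upwards [Ioo_mem_nhdsGT one_pos] with t ht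
  exact sqPotential_const hp hm h hhalf ht

namespace AngleFunction

variable {Ψ Ψ' : ℝ → ℝ}

/-- Since `V` is identically 0 along the arc, the integrand times the velocity has zero real part;
it is nonzero, so minus its square is positive. -/
lemma isHorizontal (h : D.AngleFunction Ψ) (hp : zetaPlus A B = D.zp)
    (hm : zetaMinus A B = D.zm) : IsHorizontal A B (D.arc Ψ) := by
  have key : ∀ t ∈ Ioo (0 : ℝ) 1, 0 < (quadDiff A B (D.arc Ψ t) * deriv (D.arc Ψ) t ^ 2).re ∧
      (quadDiff A B (D.arc Ψ t) * deriv (D.arc Ψ) t ^ 2).im = 0 := by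
    intro t ht
    have htI := Ioo_subset_Icc_self ht
    have hn := Icc_mem_nhds ht.1 ht.2
    have hz := h.arc_mem_zeroSet htI
    have hb0 : D.branch Ψ t ≠ 0 := by
      intro h0
      have := h.branch_sq htI
      rw [h0, zero_pow two_ne_zero, eq_comm, mul_eq_zero, sub_eq_zero, sub_eq_zero] at this
      rcases this with h' | h'
      · exact h.arc_ne_zp htI ht.2.ne h'
      · exact h.arc_ne_zm htI ht.1.ne' h'
    have hd := hasDerivAt_V_lift (D := D) (h.arc_analyticAt htI).differentiableAt.hasDerivAt
      (h.branch_continuousOn.continuousAt hn)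
      (by filter_upwards [hn] with u hu using h.branch_sq hu) hb0 hz.1 hz.2.1
    have hc : HasDerivAt (fun u => D.V (D.lift (D.arc Ψ u) (D.branch Ψ u))) 0 t := by
      refine (hasDerivAt_const t (0 : ℝ)).congr_of_eventuallyEq ?_
      filter_upwards [isOpen_Ioo.mem_nhds ht] with u hu using h.V_eq_zero hu
    have hre := (mul_eq_zero.1 (hd.unique hc)).resolve_left D.add_pos.ne'
    rw [neg_sq_eq_quadDiff hp hm (h.branch_sq htI)]
    have hw0 : D.branch Ψ t / (D.arc Ψ t ^ 2 - 1) * deriv (D.arc Ψ) t ≠ 0 := by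
      refine mul_ne_zero (div_ne_zero hb0 ?_) (h.deriv_ne htI)
      rw [show D.arc Ψ t ^ 2 - 1 = (D.arc Ψ t - 1) * (D.arc Ψ t + 1) by ring]
      exact mul_ne_zero (sub_ne_zero.2 hz.1) fun h' => hz.2.1 (eq_neg_of_add_eq_zero_left h')
    set w := D.branch Ψ t / (D.arc Ψ t ^ 2 - 1) * deriv (D.arc Ψ) t
    have him : w.im ≠ 0 := fun h' => hw0 (Complex.ext hre h')
    simp only [sq, Complex.neg_re, Complex.neg_im, Complex.mul_re, Complex.mul_im, hre]
    constructor
    · have := mul_self_pos.2 him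
      linarith
    · ring
  exact
    { contDiffOn := fun t ht =>
        (h.arc_analyticAt (Ioo_subset_Icc_self ht)).contDiffAt.contDiffWithinAt
      avoids_poles := fun t ht => ⟨(h.arc_mem_zeroSet (Ioo_subset_Icc_self ht)).1,
        (h.arc_mem_zeroSet (Ioo_subset_Icc_self ht)).2.1⟩
      re_pos := fun t ht => (key t ht).1
      im_zero := fun t ht => (key t ht).2 }

lemma isClosed_image (h : D.AngleFunction Ψ) : IsClosed (D.arc Ψ '' Icc 0 1) :=
  (isCompact_Icc.image_of_continuousOn fun _ ht =>
    (h.arc_analyticAt ht).continuousAt.continuousWithinAt).isClosed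

lemma image_diff (h : D.AngleFunction Ψ) :
    D.arc Ψ '' Icc 0 1 \ {D.zm, D.zp} = D.arc Ψ '' Ioo 0 1 := by
  ext z
  constructor
  · rintro ⟨⟨t, ht, rfl⟩, hz⟩
    simp only [mem_insert_iff, mem_singleton_iff, not_or] at hz
    refine ⟨t, ⟨lt_of_le_of_ne ht.1 ?_, lt_of_le_of_ne ht.2 ?_⟩, rfl⟩
    · rintro rfl; exact hz.1 h.arc_zero
    · rintro rfl; exact hz.2 h.arc_one
  · rintro ⟨t, ht, rfl⟩
    have htI := Ioo_subset_Icc_self ht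
    refine ⟨⟨t, htI, rfl⟩, ?_⟩
    simp only [mem_insert_iff, mem_singleton_iff, not_or]
    exact ⟨h.arc_ne_zm htI ht.1.ne', h.arc_ne_zp htI ht.2.ne⟩

lemma image_inter (h : D.AngleFunction Ψ) (h' : D.AngleFunction Ψ')
    (hne : ∀ t ∈ Ioo (0 : ℝ) 1, D.arc Ψ t ≠ D.arc Ψ' t) :
    D.arc Ψ '' Icc 0 1 ∩ D.arc Ψ' '' Icc 0 1 = {D.zm, D.zp} := by
  ext z
  simp only [mem_insert_iff, mem_singleton_iff]
  constructor
  · rintro ⟨⟨t, ht, rfl⟩, ⟨u, hu, he⟩⟩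
    have htu : t = u := by rw [h.param_eq ht, h'.param_eq hu, he]
    subst htu
    rcases eq_or_ne t 0 with rfl | h0
    · exact Or.inl h.arc_zero
    rcases eq_or_ne t 1 with rfl | h1
    · exact Or.inr h.arc_one
    exact absurd he.symm (hne t ⟨lt_of_le_of_ne ht.1 h0.symm, lt_of_le_of_ne ht.2 h1⟩)
  · rintro (rfl | rfl)
    · exact ⟨⟨0, by simp, h.arc_zero⟩, ⟨0, by simp, h'.arc_zero⟩⟩
    · exact ⟨⟨1, by simp, h.arc_one⟩, ⟨1, by simp, h'.arc_one⟩⟩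

/-- Real points are equidistant from the conjugate points ζ±, which forces t = 1/2. -/
lemma image_inter_realLine (h : D.AngleFunction Ψ) {ξ : ℝ} (hξ : D.arc Ψ (1 / 2) = ξ) :
    D.arc Ψ '' Icc 0 1 ∩ realLine = {(ξ : ℂ)} := by
  ext z
  simp only [mem_singleton_iff]
  constructor
  · rintro ⟨⟨t, ht, rfl⟩, hz : (D.arc Ψ t).im = 0⟩
    have hq := D.q_pos
    have hconj : ‖D.arc Ψ t - D.zm‖ = ‖D.arc Ψ t - D.zp‖ := by
      rw [← Complex.norm_conj]
      congr 1
      apply Complex.ext <;> simp [zp, zm, hz]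
    have hpos : 0 < ‖D.arc Ψ t - D.zp‖ := by
      rw [norm_pos_iff, sub_ne_zero]
      intro h0
      rw [h0] at hz
      simp [zp] at hz
      linarith
    have hrel := h.norm_relation ht
    rw [hconj] at hrel
    have : t = 1 - t := mul_right_cancel₀ hpos.ne' hrel
    rw [← hξ, show t = 1 / 2 by linarith]
  · rintro rfl
    exact ⟨⟨1 / 2, by norm_num, hξ⟩, by simp [realLine]⟩

end AngleFunction

lemma subset_one_of_subset_union {K : Fin 3 → Set ℂ} {S E : Set ℂ} (hS : IsPreconnected S)
    (hK : ∀ i, IsClosed (K i)) (hE : ∀ i k, i ≠ k → K i ∩ K k ⊆ E) (hSE : Disjoint S E)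
    (hSK : ∀ z ∈ S, ∃ i, z ∈ K i) : ∃ i, S ⊆ K i := by
  have hdis : ∀ i k, i ≠ k → ∀ z ∈ S, z ∈ K i → z ∉ K k := fun i k hik z hz h1 h2 =>
    disjoint_left.1 hSE hz (hE i k hik ⟨h1, h2⟩)
  have hcov : S ⊆ K 0 ∪ (K 1 ∪ K 2) := fun z hz => by
    obtain ⟨i, hi⟩ := hSK z hz
    fin_cases i
    · exact Or.inl hi
    · exact Or.inr (Or.inl hi)
    · exact Or.inr (Or.inr hi)
  have hpc := isPreconnected_iff_subset_of_disjoint_closed.1 hS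
  rcases hpc _ _ (hK 0) ((hK 1).union (hK 2)) hcov (by
    rw [eq_empty_iff_forall_notMem]
    rintro z ⟨hz, h0, h1 | h1⟩
    · exact hdis 0 1 (by decide) z hz h0 h1
    · exact hdis 0 2 (by decide) z hz h0 h1) with h | h
  · exact ⟨0, h⟩
  · rcases hpc _ _ (hK 1) (hK 2) h (by
      rw [eq_empty_iff_forall_notMem]
      rintro z ⟨hz, h0, h1⟩
      exact hdis 1 2 (by decide) z hz h0 h1) with h | h
    · exact ⟨1, h⟩
    · exact ⟨2, h⟩

lemma horizontal_subset_arc (hp : zetaPlus A B = D.zp) (hm : zetaMinus A B = D.zm)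
    {Ψ : Fin 3 → ℝ → ℝ} (hΨ : ∀ i, D.AngleFunction (Ψ i))
    (hcov : ∀ z ∈ D.zeroSet, ∃ i, ∃ t ∈ Icc (0 : ℝ) 1, D.arc (Ψ i) t = z)
    (hne : ∀ t ∈ Ioo (0 : ℝ) 1, ∀ i k, i ≠ k → D.arc (Ψ i) t ≠ D.arc (Ψ k) t)
    {γ : ℝ → ℂ} (h : IsHorizontal A B γ) (hsub : γ '' Ioo 0 1 ⊆ D.zeroSet) :
    ∃ i, γ '' Ioo 0 1 ⊆ D.arc (Ψ i) '' Ioo 0 1 := by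
  have hdisj : Disjoint (γ '' Ioo 0 1) {D.zm, D.zp} := by
    rw [disjoint_left]
    rintro _ ⟨t, ht, rfl⟩ hz
    obtain ⟨h1, h2⟩ := horizontal_ne hp hm h ht
    simp only [mem_insert_iff, mem_singleton_iff] at hz
    exact hz.elim h2 h1
  obtain ⟨i, hi⟩ := subset_one_of_subset_union (K := fun i => D.arc (Ψ i) '' Icc 0 1)
    (E := {D.zm, D.zp}) (isPreconnected_Ioo.image γ h.contDiffOn.continuousOn)
    (fun i => (hΨ i).isClosed_image)
    (fun i k hik => ((hΨ i).image_inter (hΨ k) fun t ht => hne t ht i k hik).subset) hdisj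
    (fun z hz => hcov z (hsub hz))
  exact ⟨i, fun z hz => by
    rw [← (hΨ i).image_diff]
    exact ⟨hi hz, disjoint_left.1 hdisj hz⟩⟩

/-- A horizontal curve issuing from ζ± has squared potential 0, so by connectedness it lies in one
open arc, and maximality makes it all of that arc. Conversely, a horizontal curve containing an open
arc lies in the zero set, hence in a single open arc. -/
theorem isCriticalTrajectory_iff (hp : zetaPlus A B = D.zp) (hm : zetaMinus A B = D.zm)
    {Ψ : Fin 3 → ℝ → ℝ} (hΨ : ∀ i, D.AngleFunction (Ψ i))
    (hcov : ∀ z ∈ D.zeroSet, ∃ i, ∃ t ∈ Icc (0 : ℝ) 1, D.arc (Ψ i) t = z)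
    (hne : ∀ t ∈ Ioo (0 : ℝ) 1, ∀ i k, i ≠ k → D.arc (Ψ i) t ≠ D.arc (Ψ k) t) (T : Set ℂ) :
    IsCriticalTrajectory A B T ↔ ∃ i, T = D.arc (Ψ i) '' Icc 0 1 \ {D.zm, D.zp} := by
  have hhalf : (1 / 2 : ℝ) ∈ Ioo (0 : ℝ) 1 := by norm_num
  constructor
  · rintro ⟨⟨-, hmax⟩, γ, hγ, rfl, hlim⟩
    have hsub : γ '' Ioo 0 1 ⊆ D.zeroSet := by
      rw [hp, hm] at hlim
      rcases hlim with hlim | hlim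
      · exact horizontal_subset_of_tendsto hp hm hγ (by simp) zp_mem_zeroSet hlim
      · exact horizontal_subset_of_tendsto hp hm hγ (by simp) zm_mem_zeroSet hlim
    obtain ⟨i, hi⟩ := horizontal_subset_arc hp hm hΨ hcov hne hγ hsub
    refine ⟨i, ?_⟩
    rw [(hΨ i).image_diff]
    exact (hmax _ ((hΨ i).isHorizontal hp hm) hi).symm
  · rintro ⟨i, rfl⟩
    rw [(hΨ i).image_diff]
    have hor := (hΨ i).isHorizontal hp hm
    refine ⟨⟨⟨_, hor, rfl⟩, fun γ hγ hsub => subset_antisymm ?_ hsub⟩, _, hor, rfl, Or.inr ?_⟩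
    · obtain ⟨u, hu, he⟩ := hsub ⟨1 / 2, hhalf, rfl⟩
      have hmem := (hΨ i).arc_mem_zeroSet (Ioo_subset_Icc_self hhalf)
      have h0 : D.sqPotential (γ u) = 0 := by
        rw [he, ← mem_zeroSet_iff hmem.1 hmem.2.1]; exact hmem
      obtain ⟨k, hk⟩ := horizontal_subset_arc hp hm hΨ hcov hne hγ
        (horizontal_subset_zeroSet hp hm hγ hu h0)
      -- The midpoint of arc i lies on arc k as well, necessarily at the same parameter 1/2;
      -- distinct arcs differ there.
      have hik : i = k := by
        by_contra hik
        obtain ⟨t, ht, he'⟩ := hk ⟨u, hu, rfl⟩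
        rw [he] at he'
        have htt : t = 1 / 2 := by
          rw [(hΨ k).param_eq (Ioo_subset_Icc_self ht), he',
            ← (hΨ i).param_eq (Ioo_subset_Icc_self hhalf)]
        rw [htt] at he'
        exact hne _ hhalf i k hik he'.symm
      rw [hik]; exact hk
    · rw [hm, ← (hΨ i).arc_zero]
      exact ((hΨ i).arc_analyticAt (by simp)).continuousAt.tendsto.mono_left nhdsWithin_le_nhds

end Params

lemma exists_params (A B : ℝ) (hA : -1 < A) (hB : -1 < B) (hAB : A + B < -1) :
    ∃ D : Params, zetaPlus A B = D.zp ∧ zetaMinus A B = D.zm := by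
  have h1 : 0 < A + 1 := by linarith
  have h2 : 0 < B + 1 := by linarith
  have h3 : 0 < -A - B - 1 := by linarith
  have hpos : 0 < (A + 1) * (B + 1) * (-A - B - 1) := by positivity
  have hne : (A : ℂ) + B + 2 ≠ 0 := by
    have : A + B + 2 ≠ 0 := by linarith
    exact_mod_cast this
  have hne' : (A : ℂ) + 1 + (B + 1) ≠ 0 := by
    rw [show (A : ℂ) + 1 + (B + 1) = A + B + 2 by ring]; exact hne
  refine ⟨⟨A + 1, B + 1, √((A + 1) * (B + 1) * (-A - B - 1)), h1, h2, by linarith,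
    Real.sqrt_pos.2 hpos, by rw [Real.sq_sqrt hpos.le]; ring⟩, ?_, ?_⟩
  · simp only [zetaPlus, Params.zp, Params.p, Params.q]
    push_cast
    field_simp
    ring
  · simp only [zetaMinus, Params.zm, Params.p, Params.q]
    push_cast
    field_simp
    ring

end JacobiTrajectories

end

theorem lemma2p1 (A B : ℝ) (hA : -1 < A) (hA' : A < 0) (hB : -1 < B) (hB' : B < 0)
    (hAB : -2 < A + B) (hAB' : A + B < -1) :
    -- whether `z` belongs to `Γ` can be tested on any path and with any branch
    (∀ (z : ℂ) (γ s : ℝ → ℂ), JacobiTrajectories.IsPathWithBranch A B z γ s →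
      (z ∈ JacobiTrajectories.Gamma A B ↔ (JacobiTrajectories.pathIntegral γ s).re = 0)) ∧
    ∃ ΓL ΓC ΓR : Set ℂ,
      JacobiTrajectories.IsAnalyticArc ΓL
        (JacobiTrajectories.zetaMinus A B) (JacobiTrajectories.zetaPlus A B) ∧
      JacobiTrajectories.IsAnalyticArc ΓC
        (JacobiTrajectories.zetaMinus A B) (JacobiTrajectories.zetaPlus A B) ∧
      JacobiTrajectories.IsAnalyticArc ΓR
        (JacobiTrajectories.zetaMinus A B) (JacobiTrajectories.zetaPlus A B) ∧
      JacobiTrajectories.Gamma A B = ΓL ∪ ΓC ∪ ΓR ∧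
      -- the arcs have only their end points in common
      ΓL ∩ ΓC = {JacobiTrajectories.zetaMinus A B, JacobiTrajectories.zetaPlus A B} ∧
      ΓC ∩ ΓR = {JacobiTrajectories.zetaMinus A B, JacobiTrajectories.zetaPlus A B} ∧
      ΓL ∩ ΓR = {JacobiTrajectories.zetaMinus A B, JacobiTrajectories.zetaPlus A B} ∧
      -- each arc meets the real line in exactly one point, in the indicated interval
      (∃ ξ : ℝ, ξ < -1 ∧ ΓL ∩ JacobiTrajectories.realLine = {(ξ : ℂ)}) ∧
      (∃ ξ : ℝ, -1 < ξ ∧ ξ < 1 ∧ ΓC ∩ JacobiTrajectories.realLine = {(ξ : ℂ)}) ∧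
      (∃ ξ : ℝ, 1 < ξ ∧ ΓR ∩ JacobiTrajectories.realLine = {(ξ : ℂ)}) ∧
      -- without their end points, the arcs are exactly the critical trajectories
      (∀ T : Set ℂ, JacobiTrajectories.IsCriticalTrajectory A B T ↔
        T = ΓL \ {JacobiTrajectories.zetaMinus A B, JacobiTrajectories.zetaPlus A B} ∨
        T = ΓC \ {JacobiTrajectories.zetaMinus A B, JacobiTrajectories.zetaPlus A B} ∨
        T = ΓR \ {JacobiTrajectories.zetaMinus A B, JacobiTrajectories.zetaPlus A B}) := by
  obtain ⟨D, hp, hm⟩ := JacobiTrajectories.exists_params A B hA hB hAB'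
  obtain ⟨Ψ, ξ, hΨ, hcov, hne, hmid, h0, h1, h2, h3⟩ := D.exists_angleFunctions
  -- The indices follow the order of the real zeros in v: 1 is the left arc, 2 the central one, 0
  -- the right one.
  refine ⟨fun z γ s h => JacobiTrajectories.Params.mem_Gamma_iff hp hm h,
    D.arc (Ψ 1) '' Icc 0 1, D.arc (Ψ 2) '' Icc 0 1, D.arc (Ψ 0) '' Icc 0 1, ?_⟩
  have hinter : ∀ i k, i ≠ k → D.arc (Ψ i) '' Icc 0 1 ∩ D.arc (Ψ k) '' Icc 0 1 = {D.zm, D.zp} :=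
    fun i k hik => (hΨ i).image_inter (hΨ k) fun t ht => hne t ht i k hik
  rw [hp, hm]
  refine ⟨(hΨ 1).isAnalyticArc, (hΨ 2).isAnalyticArc, (hΨ 0).isAnalyticArc, ?_,
    hinter 1 2 (by decide), hinter 2 0 (by decide), hinter 1 0 (by decide),
    ⟨ξ 1, h1, (hΨ 1).image_inter_realLine (hmid 1)⟩,
    ⟨ξ 2, h2, h3, (hΨ 2).image_inter_realLine (hmid 2)⟩,
    ⟨ξ 0, h0, (hΨ 0).image_inter_realLine (hmid 0)⟩, fun T => ?_⟩
  · ext z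
    constructor
    · rintro ⟨γ, s, h, hre⟩
      obtain ⟨i, hi⟩ :=
        hcov z ((JacobiTrajectories.Params.re_pathIntegral_eq_zero_iff hp hm h).1 hre)
      fin_cases i
      · exact Or.inr hi
      · exact Or.inl (Or.inl hi)
      · exact Or.inl (Or.inr hi)
    · rintro ((⟨t, ht, rfl⟩ | ⟨t, ht, rfl⟩) | ⟨t, ht, rfl⟩)
      · exact (hΨ 1).arc_mem_Gamma hp hm ht
      · exact (hΨ 2).arc_mem_Gamma hp hm ht
      · exact (hΨ 0).arc_mem_Gamma hp hm ht
  · rw [JacobiTrajectories.Params.isCriticalTrajectory_iff hp hm hΨ hcov hne]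
    constructor
    · rintro ⟨i, hi⟩
      fin_cases i
      · exact Or.inr (Or.inr hi)
      · exact Or.inl hi
      · exact Or.inr (Or.inl hi)
    · rintro (h | h | h)
      · exact ⟨1, h⟩
      · exact ⟨2, h⟩
      · exact ⟨0, h⟩
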